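/- Let $q\in\mathbb C$ with $0<|q|<1$. For $x\in\mathbb C$ put $(x)_\infty=\prod_{j\ge 0}(1-xq^j)$, and for $k\in\mathbb Z$ let $(x)_k=(x)_\infty/(xq^k)_\infty$, i.e. $(x)_k=\prod_{0\le j<k}(1-xq^j)$ for $k\ge 0$ and $(x)_k=\prod_{1\le j\le -k}(1-xq^{-j})^{-1}$ for $k<0$; write $(x_1,\dots,x_m)_k=(x_1)_k\cdots(x_m)_k$ for $k\in\mathbb Z\cup\{\infty\}$. As usual, $${}_s\phi_{s-1}\!\left[{a_1,\dots,a_s\atop b_1,\dots,b_{s-1}};q,z\right]=\sum_{k\ge 0}\frac{(a_1,\dots,a_s)_k}{(q,b_1,\dots,b_{s-1})_k}z^k,\qquad {}_s\psi_s\!\left[{a_1,\dots,a_s\atop b_1,\dots,b_s};q,z\right]=\sum_{k\in\mathbb Z}\frac{(a_1,\dots,a_s)_k}{(b_1,\dots,b_s)_k}z^k.$$ Let $a,c,d,e,f$ be nonzero complex numbers, let $\sqrt a$ be either square root of $a$, and let $b=qa^2/cdef$. (i) For every integer $n\ge 0$ such that no division by zero occurs in the expressions below, the two series below converge absolutely and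 $$\sum_{k\geq -n}\frac{(aq^{-n},q\sqrt{a},-q\sqrt{a},bq^n,c,d,e,f)_k}{(q^{1+n},\sqrt{a},-\sqrt{a},aq^{1-n}/b,aq/c,aq/d,aq/e,aq/f)_k}q^k=A_n+B_n,$$ where $$A_n=\frac{(aq,c,d,e,f,bq^{1+2n}/a,bq^{1+n}/c,bq^{1+n}/d,bq^{1+n}/e,bq^{1+n}/f)_\infty}{(aq/b,aq/c,aq/d,aq/e,aq/f,bcq^n/a,bdq^n/a,beq^n/a,bfq^n/a,b^2q^{1+2n}/a)_\infty}\cdot\frac{b^{n+1}}{a}\frac{(q,q/a)_n}{(b,b/a)_n}$$ $$\times{}_{8}\phi_7\!\left[{b^2q^{2n}/a,\,bq^{1+n}/\sqrt{a},-bq^{1+n}/\sqrt{a},b,bcq^n/a,bdq^n/a,beq^n/a,bfq^n/a\atop bq^n/\sqrt{a},-bq^n/\sqrt{a},bq^{1+2n}/a,bq^{1+n}/c,bq^{1+n}/d,bq^{1+n}/e,bq^{1+n}/f};q,q\right],$$ $$B_n=\frac{(aq,aq/cd,aq/ce,aq/cf,aq/de,aq/df,aq/ef,bq^{n}/a)_\infty}{(aq/c,aq/d,aq/e,aq/f,bcq^n/a,bdq^n/a,beq^n/a,bfq^n/a)_\infty}\cdot\frac{(q,q/a)_n}{(b,q/c,q/d,q/e,q/f)_n}.$$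 (ii) Suppose that $|b|<1$ and that no division by zero occurs in $$\Psi={}_6\psi_6\!\left[{q\sqrt{a},-q\sqrt{a},c,d,e,f\atop \sqrt{a},-\sqrt{a},aq/c,aq/d,aq/e,aq/f};q,\frac{qa^2}{cdef}\right],\qquad P=\frac{(q,aq,q/a,aq/cd,aq/ce,aq/cf,aq/de,aq/df,aq/ef)_\infty}{(q/c,q/d,q/e,q/f,aq/c,aq/d,aq/e,aq/f,qa^2/cdef)_\infty}.$$ If $b/a$ is not an integer power of $q$ (so that the identity in (i) makes sense for all large $n$), then, as $n\to\infty$, the left-hand side of the identity in (i) tends to $\Psi$, while $A_n\to 0$ and $B_n\to P$. Moreover (without that restriction on $b/a$) the series $\Psi$ converges absolutely and Bailey's summation formula $\Psi=P$ holds. -/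

import Mathlib

open Filter Topology

/-- `(x; q)_∞ = ∏_{j ≥ 0} (1 - x q^j)`. -/
noncomputable def qInf (q x : ℂ) : ℂ := ∏' j : ℕ, (1 - x * q ^ j)

/-- The `q`-shifted factorial `(x; q)_k` for an integer `k`:
`∏_{0 ≤ j < k} (1 - x q^j)` if `k ≥ 0` and `1 / ∏_{1 ≤ j ≤ -k} (1 - x q^{-j})` if `k < 0`.
It is `(x; q)_∞ / (x q^k; q)_∞` whenever the latter denominator is not zero, see `qFac_eq_div`. -/
noncomputable def qFac (q x : ℂ) : ℤ → ℂ
  | Int.ofNat m => ∏ j ∈ Finset.range m, (1 - x * q ^ j)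
  | Int.negSucc m => (∏ j ∈ Finset.range (m + 1), (1 - x * q ^ (-((j : ℤ) + 1))))⁻¹

/-- `(x₁, …, x_m; q)_∞`. -/
noncomputable def qInfs (q : ℂ) (xs : List ℂ) : ℂ := (xs.map (qInf q)).prod

/-- `(x₁, …, x_m; q)_k` for an integer `k`. -/
noncomputable def qFacs (q : ℂ) (xs : List ℂ) (k : ℤ) : ℂ := (xs.map fun x => qFac q x k).prod

theorem qInf_eq_mul (q x : ℂ) (hq : ‖q‖ < 1) (m : ℕ) :
    qInf q x = (∏ j ∈ Finset.range m, (1 - x * q ^ j)) * qInf q (x * q ^ m) := by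
  have hm : Multipliable fun j : ℕ => 1 - x * q ^ m * q ^ j := by
    have h : Summable fun j : ℕ => ‖-(x * q ^ m * q ^ j)‖ := by
      simp only [norm_neg, norm_mul, norm_pow]
      exact (summable_geometric_of_lt_one (norm_nonneg q) hq).mul_left _
    simpa [sub_eq_add_neg] using multipliable_one_add_of_summable h
  have e : (fun j : ℕ => 1 - x * q ^ m * q ^ j) = fun j : ℕ => 1 - x * q ^ (j + m) := by
    funext j
    rw [pow_add, mul_assoc, mul_comm (q ^ m)]
  rw [e] at hm
  have key := Multipliable.prod_mul_tprod_nat_mul' (f := fun j : ℕ => 1 - x * q ^ j) hm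
  rw [qInf, qInf, e]
  exact key.symm

theorem qFac_eq_div (q x : ℂ) (hq0 : q ≠ 0) (hq : ‖q‖ < 1) (k : ℤ)
    (hk : qInf q (x * q ^ k) ≠ 0) :
    qFac q x k = qInf q x / qInf q (x * q ^ k) := by
  rw [eq_div_iff hk]
  cases k with
  | ofNat m =>
    have := qInf_eq_mul q x hq m
    simpa [qFac] using this.symm
  | negSucc m =>
    have h := qInf_eq_mul q (x * q ^ (Int.negSucc m)) hq (m + 1)
    have h1 : x * q ^ (Int.negSucc m) * q ^ (m + 1) = x := by
      rw [Int.negSucc_eq, zpow_neg, mul_assoc]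
      have : q ^ ((m : ℤ) + 1) = q ^ (m + 1) := by exact_mod_cast zpow_natCast q (m + 1)
      rw [this, inv_mul_cancel₀ (pow_ne_zero _ hq0), mul_one]
    have h2 : ∏ j ∈ Finset.range (m + 1), (1 - x * q ^ (Int.negSucc m) * q ^ j)
        = ∏ j ∈ Finset.range (m + 1), (1 - x * q ^ (-((j : ℤ) + 1))) := by
      rw [← Finset.prod_range_reflect]
      refine Finset.prod_congr rfl fun j hj => ?_
      have hj' : j ≤ m := by
        have := Finset.mem_range.mp hj
        omega
      rw [mul_assoc, ← zpow_natCast q, ← zpow_add₀ hq0, Int.negSucc_eq]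
      congr 3
      omega
    rw [h1, h2] at h
    have hP : ∏ j ∈ Finset.range (m + 1), (1 - x * q ^ (-((j : ℤ) + 1))) ≠ 0 := by
      intro h0
      rw [h0, zero_mul] at h
      exact hk h
    rw [h]
    simp only [qFac]
    rw [inv_mul_cancel_left₀ hP]

/-- The `k`-th term of the basic hypergeometric series `_sφ_{s-1}[as; bs; q, z]`. -/
noncomputable def phiTerm (q : ℂ) (as bs : List ℂ) (z : ℂ) (k : ℕ) : ℂ :=
  qFacs q as k / qFacs q (q :: bs) k * z ^ k

/-- The basic hypergeometric series `_sφ_{s-1}[as; bs; q, z]`. -/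
noncomputable def phi (q : ℂ) (as bs : List ℂ) (z : ℂ) : ℂ := ∑' k : ℕ, phiTerm q as bs z k

/-- The `k`-th term of the bilateral basic hypergeometric series `_sψ_s[as; bs; q, z]`. -/
noncomputable def psiTerm (q : ℂ) (as bs : List ℂ) (z : ℂ) (k : ℤ) : ℂ :=
  qFacs q as k / qFacs q bs k * z ^ k

/-- The bilateral basic hypergeometric series `_sψ_s[as; bs; q, z]`. -/
noncomputable def psi (q : ℂ) (as bs : List ℂ) (z : ℂ) : ℂ := ∑' k : ℤ, psiTerm q as bs z k

/-- The `k`-th term of the semi-finite sum; `r` stands for `√a`. -/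
noncomputable def semiTerm (q a r b c d e f : ℂ) (n : ℕ) (k : ℤ) : ℂ :=
  qFacs q [a * q ^ (-(n : ℤ)), q * r, -(q * r), b * q ^ n, c, d, e, f] k /
    qFacs q [q ^ (1 + n), r, -r, a * q ^ (1 - (n : ℤ)) / b,
      a * q / c, a * q / d, a * q / e, a * q / f] k * q ^ k

/-- The semi-finite sum `∑_{k ≥ -n}`. -/
noncomputable def semiSum (q a r b c d e f : ℂ) (n : ℕ) : ℂ :=
  ∑' k : Set.Ici (-(n : ℤ)), semiTerm q a r b c d e f n k

/-- Upper parameters of the `_8φ_7` on the right-hand side; `r` stands for `√a`. -/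
noncomputable def upperParams (q a r b c d e f : ℂ) (n : ℕ) : List ℂ :=
  [b ^ 2 * q ^ (2 * n) / a, b * q ^ (1 + n) / r, -(b * q ^ (1 + n) / r), b,
    b * c * q ^ n / a, b * d * q ^ n / a, b * e * q ^ n / a, b * f * q ^ n / a]

/-- Lower parameters of the `_8φ_7` on the right-hand side; `r` stands for `√a`. -/
noncomputable def lowerParams (q a r b c d e f : ℂ) (n : ℕ) : List ℂ :=
  [b * q ^ n / r, -(b * q ^ n / r), b * q ^ (1 + 2 * n) / a,
    b * q ^ (1 + n) / c, b * q ^ (1 + n) / d, b * q ^ (1 + n) / e, b * q ^ (1 + n) / f]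

/-- The first term of the right-hand side. -/
noncomputable def rhsFirst (q a r b c d e f : ℂ) (n : ℕ) : ℂ :=
  qInfs q [a * q, c, d, e, f, b * q ^ (1 + 2 * n) / a,
      b * q ^ (1 + n) / c, b * q ^ (1 + n) / d, b * q ^ (1 + n) / e, b * q ^ (1 + n) / f] /
    qInfs q [a * q / b, a * q / c, a * q / d, a * q / e, a * q / f,
      b * c * q ^ n / a, b * d * q ^ n / a, b * e * q ^ n / a, b * f * q ^ n / a,
      b ^ 2 * q ^ (1 + 2 * n) / a] *
  (b ^ (n + 1) / a * (qFacs q [q, q / a] n / qFacs q [b, b / a] n)) *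
  phi q (upperParams q a r b c d e f n) (lowerParams q a r b c d e f n) q

/-- The second term of the right-hand side. -/
noncomputable def rhsSecond (q a b c d e f : ℂ) (n : ℕ) : ℂ :=
  qInfs q [a * q, a * q / (c * d), a * q / (c * e), a * q / (c * f),
      a * q / (d * e), a * q / (d * f), a * q / (e * f), b * q ^ n / a] /
    qInfs q [a * q / c, a * q / d, a * q / e, a * q / f,
      b * c * q ^ n / a, b * d * q ^ n / a, b * e * q ^ n / a, b * f * q ^ n / a] *
  (qFacs q [q, q / a] n / qFacs q [b, q / c, q / d, q / e, q / f] n)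

/-- The infinite product in Bailey's `_6ψ_6` summation. -/
noncomputable def baileyProduct (q a c d e f : ℂ) : ℂ :=
  qInfs q [q, a * q, q / a, a * q / (c * d), a * q / (c * e), a * q / (c * f),
      a * q / (d * e), a * q / (d * f), a * q / (e * f)] /
    qInfs q [q / c, q / d, q / e, q / f, a * q / c, a * q / d, a * q / e, a * q / f,
      q * a ^ 2 / (c * d * e * f)]

/-! The substitution k = m - n turns the semi-finite sum into a unilateral very-well-poised series
with base aq^{-2n}. Part (i) then becomes Bailey's nonterminating extension of Jackson's sum: for
six parameters with t₀t₁t₂t₃t₄t₅ = q, two very-well-poised series, interchanged by t₀ ↔ t₁, combine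
to an infinite product. Here t₀ = √a q^{-n}, t₁ = bq^n/√a, and t₂, …, t₅ are c, d, e, f divided by
√a. With denominators cleared the formula is `jLeft_eq_jRight`, an identity of functions holomorphic
in nonzero parameters.

It is proved by a q-difference equation. A combination of the terms of two contiguous series
telescopes (`jTerm_contiguous`), so each series satisfies an inhomogeneous first-order equation
relating (t₂, t₅) to (qt₂, t₅/q). The inhomogeneous terms of the two series cancel in `jLeft`, which
therefore obeys the homogeneous equation satisfied by the product. For generic parameters the
quotient of the two sides extends to a q-periodic holomorphic function of t₂ on the punctured plane;
composed with exp it is entire and bounded, hence constant by Liouville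
(`eq_of_proportional_of_qDiff`). At t₀t₂ = 1 one series reduces to its first term and the other
drops out, which fixes the constant. Genericity is removed by continuity.

For part (ii), the terms of Bailey's series are O(|b|^{|k|}) in both directions, the terms of the
semi-finite sum are these times a ratio tending to 1, and dominated convergence applies
(`tendsto_semiSum`). A_n carries the factor b^{n+1} while its other factors stay bounded, and B_n
converges factor by factor. If b/a is a power of q, then c is replaced by cs with s near 1, and both
sides of Bailey's formula are continuous at s = 1. -/

/-! ### Elementary properties and bounds of q-shifted factorials -/

/-- The finite `q`-shifted factorial `∏_{0 ≤ j < k} (1 - x q^j)`. -/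
noncomputable def qPoch (q x : ℂ) (k : ℕ) : ℂ := ∏ j ∈ Finset.range k, (1 - x * q ^ j)

/-- A common bound for the norms of all `(x; q)_k` and of `(x; q)_∞`. -/
noncomputable def qMaj (q x : ℂ) : ℝ := Real.exp (‖x‖ / (1 - ‖q‖))

theorem qFac_natCast (q x : ℂ) (k : ℕ) : qFac q x (k : ℤ) = qPoch q x k := rfl

@[simp] theorem qPoch_zero (q x : ℂ) : qPoch q x 0 = 1 := by simp [qPoch]

theorem qPoch_succ (q x : ℂ) (k : ℕ) :
    qPoch q x (k + 1) = qPoch q x k * (1 - x * q ^ k) := Finset.prod_range_succ _ _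

theorem qPoch_add (q x : ℂ) (m n : ℕ) :
    qPoch q x (m + n) = qPoch q x m * qPoch q (x * q ^ m) n := by
  simp only [qPoch, Finset.prod_range_add, pow_add, mul_assoc]

theorem qPoch_succ' (q x : ℂ) (k : ℕ) :
    qPoch q x (k + 1) = (1 - x) * qPoch q (x * q) k := by
  rw [add_comm, qPoch_add, pow_one]; simp [qPoch]

@[simp] theorem qPoch_one (q x : ℂ) : qPoch q x 1 = 1 - x := by simp [qPoch]

theorem qInf_eq_qPoch_mul {q : ℂ} (hq : ‖q‖ < 1) (x : ℂ) (m : ℕ) :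
    qInf q x = qPoch q x m * qInf q (x * q ^ m) := qInf_eq_mul q x hq m

theorem qInf_succ {q : ℂ} (hq : ‖q‖ < 1) (x : ℂ) :
    qInf q x = (1 - x) * qInf q (x * q) := by
  simpa using qInf_eq_qPoch_mul hq x 1

@[simp] theorem qInf_zero (q : ℂ) : qInf q 0 = 1 := by simp [qInf]

@[simp] theorem qInf_one {q : ℂ} (hq : ‖q‖ < 1) : qInf q 1 = 0 := by
  rw [qInf_succ hq]; simp

theorem summable_norm_mul_pow {q : ℂ} (hq : ‖q‖ < 1) (x : ℂ) :
    Summable fun j : ℕ => ‖-(x * q ^ j)‖ := by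
  simp only [norm_neg, norm_mul, norm_pow]
  exact (summable_geometric_of_lt_one (norm_nonneg q) hq).mul_left _

theorem tendsto_qPoch {q : ℂ} (hq : ‖q‖ < 1) (x : ℂ) :
    Tendsto (qPoch q x) atTop (𝓝 (qInf q x)) := by
  have h := multipliable_one_add_of_summable (summable_norm_mul_pow hq x)
  have := h.hasProd.tendsto_prod_nat
  simpa [qPoch, qInf, sub_eq_add_neg] using! this

theorem qInf_ne_zero_iff {q : ℂ} (hq : ‖q‖ < 1) (x : ℂ) :
    qInf q x ≠ 0 ↔ ∀ j : ℕ, 1 - x * q ^ j ≠ 0 := by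
  constructor
  · intro h j hj
    apply h
    rw [qInf_eq_qPoch_mul hq x (j + 1), qPoch_succ, hj, mul_zero, zero_mul]
  · intro h
    have := tprod_one_add_ne_zero_of_summable (f := fun j : ℕ => -(x * q ^ j))
      (fun j => by simpa [sub_eq_add_neg] using h j) (summable_norm_mul_pow hq x)
    simpa [qInf, sub_eq_add_neg] using! this

theorem qPoch_ne_zero {q : ℂ} (hq : ‖q‖ < 1) {x : ℂ} (h : qInf q x ≠ 0) (k : ℕ) :
    qPoch q x k ≠ 0 := fun h0 => h (by rw [qInf_eq_qPoch_mul hq x k, h0, zero_mul])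

theorem qInf_mul_pow_ne_zero {q : ℂ} (hq : ‖q‖ < 1) {x : ℂ} (h : qInf q x ≠ 0) (k : ℕ) :
    qInf q (x * q ^ k) ≠ 0 := fun h0 => h (by rw [qInf_eq_qPoch_mul hq x k, h0, mul_zero])

theorem qInf_ne_zero_of_norm_lt_one {q : ℂ} (hq : ‖q‖ < 1) {x : ℂ} (h : ‖x‖ < 1) :
    qInf q x ≠ 0 := by
  rw [qInf_ne_zero_iff hq]
  intro j hj
  have h1 : ‖x * q ^ j‖ < 1 := by
    rw [norm_mul, norm_pow]
    exact (mul_le_of_le_one_right (norm_nonneg _)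
      (pow_le_one₀ (norm_nonneg _) hq.le)).trans_lt h
  rw [← sub_eq_zero.mp hj] at h1
  simp at h1

theorem qInf_self_ne_zero {q : ℂ} (hq : ‖q‖ < 1) : qInf q q ≠ 0 :=
  qInf_ne_zero_of_norm_lt_one hq hq

theorem qMaj_pos (q x : ℂ) : 0 < qMaj q x := Real.exp_pos _

theorem qMaj_le_qMaj {q x y : ℂ} (hq : ‖q‖ < 1) (h : ‖x‖ ≤ ‖y‖) : qMaj q x ≤ qMaj q y := by
  have : 0 < 1 - ‖q‖ := by linarith
  unfold qMaj
  gcongr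

theorem norm_mul_pow_le {q : ℂ} (hq : ‖q‖ < 1) (x : ℂ) (k : ℕ) : ‖x * q ^ k‖ ≤ ‖x‖ := by
  rw [norm_mul, norm_pow]
  exact mul_le_of_le_one_right (norm_nonneg _) (pow_le_one₀ (norm_nonneg _) hq.le)

/-- Each factor is at most 1 + |x||q|^j ≤ exp(|x||q|^j), and the exponents form a geometric series
with sum |x|/(1 - |q|). -/
theorem norm_qPoch_le {q : ℂ} (hq : ‖q‖ < 1) (x : ℂ) (k : ℕ) : ‖qPoch q x k‖ ≤ qMaj q x := by
  rw [qPoch, norm_prod]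
  calc ∏ j ∈ Finset.range k, ‖1 - x * q ^ j‖
      ≤ ∏ j ∈ Finset.range k, (1 + ‖x‖ * ‖q‖ ^ j) := by
        refine Finset.prod_le_prod (fun _ _ => norm_nonneg _) fun j _ => ?_
        simpa using norm_sub_le (1 : ℂ) (x * q ^ j)
    _ ≤ Real.exp (∑ j ∈ Finset.range k, ‖x‖ * ‖q‖ ^ j) :=
        Real.prod_one_add_le_exp_sum _ fun j => by positivity
    _ ≤ qMaj q x := by
        refine Real.exp_le_exp.mpr ?_
        rw [← Finset.mul_sum, div_eq_mul_inv, ← tsum_geometric_of_lt_one (norm_nonneg q) hq]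
        exact mul_le_mul_of_nonneg_left ((summable_geometric_of_lt_one (norm_nonneg q) hq).sum_le_tsum
          _ fun j _ => by positivity) (norm_nonneg _)

theorem norm_qInf_le {q : ℂ} (hq : ‖q‖ < 1) (x : ℂ) : ‖qInf q x‖ ≤ qMaj q x :=
  le_of_tendsto (tendsto_qPoch hq x).norm (Eventually.of_forall (norm_qPoch_le hq x))

theorem norm_qInf_mul_pow_le {q : ℂ} (hq : ‖q‖ < 1) (x : ℂ) (k : ℕ) :
    ‖qInf q (x * q ^ k)‖ ≤ qMaj q x :=
  (norm_qInf_le hq _).trans (qMaj_le_qMaj hq (norm_mul_pow_le hq x k))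

/-- Since (x)_∞ = (x)_k (xq^k)_∞, the reciprocal of (x)_k is (xq^k)_∞/(x)_∞, and its numerator is
bounded uniformly in k. -/
theorem norm_qPoch_inv_le {q : ℂ} (hq : ‖q‖ < 1) (x : ℂ) (h : qInf q x ≠ 0) (k : ℕ) :
    ‖(qPoch q x k)⁻¹‖ ≤ qMaj q x / ‖qInf q x‖ := by
  rw [norm_inv, le_div_iff₀ (norm_pos_iff.mpr h), qInf_eq_qPoch_mul hq x k, norm_mul,
    inv_mul_cancel_left₀ (norm_ne_zero_iff.mpr (qPoch_ne_zero hq h k))]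
  exact norm_qInf_mul_pow_le hq x k

/-- The product converges locally uniformly: on the ball of radius |x| + 1 the factors are dominated
by a geometric series. -/
theorem differentiable_qInf {q : ℂ} (hq : ‖q‖ < 1) : Differentiable ℂ (qInf q) := by
  intro x
  have hopen : IsOpen (Metric.ball (0 : ℂ) (‖x‖ + 1)) := Metric.isOpen_ball
  have h := Summable.hasProdLocallyUniformlyOn_one_add (f := fun (j : ℕ) (y : ℂ) => -(y * q ^ j))
    (u := fun j => (‖x‖ + 1) * ‖q‖ ^ j) hopen
    ((summable_geometric_of_lt_one (norm_nonneg q) hq).mul_left _)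
    (Eventually.of_forall fun j y hy => by
      rw [norm_neg, norm_mul, norm_pow]
      gcongr
      exact (mem_ball_zero_iff.mp hy).le)
    (fun j => by fun_prop)
  rw [hasProdLocallyUniformlyOn_iff_tendstoLocallyUniformlyOn] at h
  have hd := h.differentiableOn (Eventually.of_forall fun s => by
    apply Differentiable.differentiableOn; fun_prop) hopen
  have := hd.differentiableAt (hopen.mem_nhds (mem_ball_zero_iff.mpr (lt_add_one ‖x‖)))
  simpa [qInf, sub_eq_add_neg] using! this

theorem differentiable_qPoch (q : ℂ) (k : ℕ) : Differentiable ℂ fun x => qPoch q x k := by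
  unfold qPoch; fun_prop

theorem continuous_qInf {q : ℂ} (hq : ‖q‖ < 1) : Continuous (qInf q) :=
  (differentiable_qInf hq).continuous

theorem continuous_qPoch (q : ℂ) (k : ℕ) : Continuous fun x => qPoch q x k :=
  (differentiable_qPoch q k).continuous

theorem continuous_qMaj (q : ℂ) : Continuous (qMaj q) := by unfold qMaj; fun_prop

/-! ### Very-well-poised series in symmetric form -/

/-- The contribution of the parameter `y` to the `k`-th term of `jSum`. -/
noncomputable def jFac (q x y : ℂ) (k : ℕ) : ℂ := qPoch q (x * y) k * qInf q (x * q / y * q ^ k)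

/-- The `k`-th term of a very-well-poised series, with the parameters in symmetric form
and with the denominators cleared. -/
noncomputable def jTerm (q x y₁ y₂ y₃ y₄ y₅ : ℂ) (k : ℕ) : ℂ :=
  x * q ^ k * (1 - (x * q ^ k) ^ 2) * (qInf q (q * q ^ k) * qPoch q (x ^ 2) k) *
    (jFac q x y₁ k * jFac q x y₂ k * jFac q x y₃ k * jFac q x y₄ k * jFac q x y₅ k)

/-- A very-well-poised series, with the parameters in symmetric form and with the
denominators cleared. -/
noncomputable def jSum (q x y₁ y₂ y₃ y₄ y₅ : ℂ) : ℂ := ∑' k, jTerm q x y₁ y₂ y₃ y₄ y₅ k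

/-- A bound for the terms of `jSum`, up to a geometric factor. -/
noncomputable def jMaj (q x y₁ y₂ y₃ y₄ y₅ : ℂ) : ℝ :=
  (1 + ‖x‖ ^ 2) * (qMaj q q * qMaj q (x ^ 2)) *
    (qMaj q (x * y₁) * qMaj q (x * q / y₁) * (qMaj q (x * y₂) * qMaj q (x * q / y₂)) *
      (qMaj q (x * y₃) * qMaj q (x * q / y₃)) * (qMaj q (x * y₄) * qMaj q (x * q / y₄)) *
      (qMaj q (x * y₅) * qMaj q (x * q / y₅)))

theorem norm_jFac_le {q : ℂ} (hq : ‖q‖ < 1) (x y : ℂ) (k : ℕ) :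
    ‖jFac q x y k‖ ≤ qMaj q (x * y) * qMaj q (x * q / y) := by
  rw [jFac, norm_mul]
  exact mul_le_mul (norm_qPoch_le hq _ _) (norm_qInf_mul_pow_le hq _ _) (norm_nonneg _)
    (qMaj_pos _ _).le

theorem norm_one_sub_mul_pow_sq_le {q : ℂ} (hq : ‖q‖ < 1) (x : ℂ) (k : ℕ) :
    ‖1 - (x * q ^ k) ^ 2‖ ≤ 1 + ‖x‖ ^ 2 := by
  refine (norm_sub_le _ _).trans ?_
  rw [norm_one, norm_pow]
  gcongr
  exact norm_mul_pow_le hq x k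

theorem norm_jTerm_le {q : ℂ} (hq : ‖q‖ < 1) (x y₁ y₂ y₃ y₄ y₅ : ℂ) (k : ℕ) :
    ‖jTerm q x y₁ y₂ y₃ y₄ y₅ k‖ ≤ ‖x‖ * jMaj q x y₁ y₂ y₃ y₄ y₅ * ‖q‖ ^ k := by
  have h0 := fun y => qMaj_pos q y
  have h1 := norm_jFac_le hq x
  have h2 := norm_one_sub_mul_pow_sq_le hq x k
  have h3 := norm_qInf_mul_pow_le hq q k
  have h4 := norm_qPoch_le hq (x ^ 2) k
  have h5 : ∀ y, 0 ≤ qMaj q (x * y) * qMaj q (x * q / y) :=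
    fun y => mul_nonneg (h0 _).le (h0 _).le
  have h6 : 0 ≤ qMaj q q * qMaj q (x ^ 2) := mul_nonneg (h0 _).le (h0 _).le
  rw [jTerm, jMaj]
  simp only [norm_mul, norm_pow]
  calc _ = ‖x‖ * ‖q‖ ^ k * (‖1 - (x * q ^ k) ^ 2‖ * (‖qInf q (q * q ^ k)‖ * ‖qPoch q (x ^ 2) k‖) *
        (‖jFac q x y₁ k‖ * ‖jFac q x y₂ k‖ * ‖jFac q x y₃ k‖ * ‖jFac q x y₄ k‖ *
          ‖jFac q x y₅ k‖)) := by ring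
    _ ≤ ‖x‖ * ‖q‖ ^ k * ((1 + ‖x‖ ^ 2) * (qMaj q q * qMaj q (x ^ 2)) *
    (qMaj q (x * y₁) * qMaj q (x * q / y₁) * (qMaj q (x * y₂) * qMaj q (x * q / y₂)) *
      (qMaj q (x * y₃) * qMaj q (x * q / y₃)) * (qMaj q (x * y₄) * qMaj q (x * q / y₄)) *
      (qMaj q (x * y₅) * qMaj q (x * q / y₅)))) := by
        have := h5 y₁
        have := h5 y₂
        have := h5 y₃
        have := h5 y₄
        have := h5 y₅
        have := (h0 q).le
        gcongr <;> apply h1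
    _ = _ := by ring

theorem summable_jTerm {q : ℂ} (hq : ‖q‖ < 1) (x y₁ y₂ y₃ y₄ y₅ : ℂ) :
    Summable (jTerm q x y₁ y₂ y₃ y₄ y₅) :=
  Summable.of_norm_bounded ((summable_geometric_of_lt_one (norm_nonneg q) hq).mul_left _)
    (norm_jTerm_le hq x y₁ y₂ y₃ y₄ y₅)

theorem norm_jSum_le {q : ℂ} (hq : ‖q‖ < 1) (x y₁ y₂ y₃ y₄ y₅ : ℂ) :
    ‖jSum q x y₁ y₂ y₃ y₄ y₅‖ ≤ ‖x‖ * jMaj q x y₁ y₂ y₃ y₄ y₅ * (1 - ‖q‖)⁻¹ := by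
  rw [← tsum_geometric_of_lt_one (norm_nonneg q) hq, ← tsum_mul_left]
  exact tsum_of_norm_bounded
    ((summable_geometric_of_lt_one (norm_nonneg q) hq).mul_left _).hasSum
    (norm_jTerm_le hq x y₁ y₂ y₃ y₄ y₅)

/-! ### The contiguous relation, by telescoping -/

/-- The function whose differences give the contiguous relation for `jSum`. -/
noncomputable def jTel (q x α β γ t u : ℂ) (k : ℕ) : ℂ :=
  qInf q (q ^ k) * qPoch q (x ^ 2) k * (qPoch q (x * α) k * qInf q (x / α * q ^ k)) *
    (qPoch q (x * β) k * qInf q (x / β * q ^ k)) * (qPoch q (x * γ) k * qInf q (x / γ * q ^ k)) *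
    (qPoch q (x * t * q) (k - 1) * qInf q (x / t * q ^ k)) *
    (qPoch q (x * u * q) (k - 1) * qInf q (x / u * q ^ k))

/-- Let P(z) be the product of 1 - zy over the six parameters y. As their product is 1, the last
bracket is z⁶P(1/z) - P(z). It has degree at most 5, vanishes at 0, 1 and -1, and is therefore z(1 -
z²) times a palindromic quadratic. Such quadratics are spanned, for generic t and u, by (1 - zu)(1 -
z/u) and (1 - zt)(1 - z/t); the coefficients are found by putting z = t and z = u. In the
application z = xq^k. -/
theorem jTel_poly_identity {x α β γ t u : ℂ} (z : ℂ) (h : x * α * β * γ * t * u = 1) :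
    z * (1 - z ^ 2) * (u ^ 2 * ((1 - t * α) * (1 - t * β) * (1 - t * γ)) *
        ((1 - x * t) * (1 - z * u) * (1 - z / u)) -
      t ^ 2 * ((1 - u * α) * (1 - u * β) * (1 - u * γ)) *
        ((1 - x * u) * (1 - z * t) * (1 - z / t))) =
    (t - u) * t * u * ((1 - z / x) * (1 - z / α) * (1 - z / β) * (1 - z / γ) * (1 - z / t) *
        (1 - z / u) -
      (1 - z * x) * (1 - z * α) * (1 - z * β) * (1 - z * γ) * (1 - z * t) * (1 - z * u)) := by
  have hx : x ≠ 0 := by rintro rfl; simp at h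
  have hα : α ≠ 0 := by rintro rfl; simp at h
  have hβ : β ≠ 0 := by rintro rfl; simp at h
  have hγ : γ ≠ 0 := by rintro rfl; simp at h
  have ht : t ≠ 0 := by rintro rfl; simp at h
  have hu : u ≠ 0 := by rintro rfl; simp at h
  obtain rfl : γ = 1 / (x * α * β * t * u) := by field_simp; linear_combination h
  field_simp
  ring

/-- This is `jTel_poly_identity` at z = x with the factor (1 - x²)(1 - xt)(1 - xu) removed. It is
verified separately because that factor may vanish. -/
theorem jTel_poly_identity_zero {x α β γ t u : ℂ} (h : x * α * β * γ * t * u = 1) :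
    u ^ 2 * ((1 - t * α) * (1 - t * β) * (1 - t * γ)) * (x * (1 - x / u)) -
      t ^ 2 * ((1 - u * α) * (1 - u * β) * (1 - u * γ)) * (x * (1 - x / t)) =
    -((t - u) * t * u * ((1 - x * α) * (1 - x * β) * (1 - x * γ))) := by
  have hx : x ≠ 0 := by rintro rfl; simp at h
  have hα : α ≠ 0 := by rintro rfl; simp at h
  have hβ : β ≠ 0 := by rintro rfl; simp at h
  have hγ : γ ≠ 0 := by rintro rfl; simp at h
  have ht : t ≠ 0 := by rintro rfl; simp at h
  have hu : u ≠ 0 := by rintro rfl; simp at h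
  obtain rfl : γ = 1 / (x * α * β * t * u) := by field_simp; linear_combination h
  field_simp
  ring

/-- The terms involved differ only by a few linear factors in xq^k. Once the common shifted
factorials are taken out, a polynomial identity remains. -/
theorem jTerm_contiguous {q : ℂ} (hq0 : q ≠ 0) (hq : ‖q‖ < 1) {x α β γ t u : ℂ}
    (h : x * α * β * γ * t * u = 1) (k : ℕ) :
    u ^ 2 * ((1 - t * α) * (1 - t * β) * (1 - t * γ)) * jTerm q x α t β γ (q * u) k -
      t ^ 2 * ((1 - u * α) * (1 - u * β) * (1 - u * γ)) * jTerm q x α (q * t) β γ u k =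
    (t - u) * t * u * (jTel q x α β γ t u k - jTel q x α β γ t u (k + 1)) := by
  have hx : x ≠ 0 := by rintro rfl; simp at h
  have e1 : ∀ y, x * q / (q * y) = x / y := fun y => by
    rw [mul_comm q y, mul_div_mul_right _ _ hq0]
  have e2 : ∀ y, x * q / y = x / y * q := fun y => by ring
  have e3 : ∀ y, x * (q * y) = x * y * q := fun y => by ring
  have e4 : ∀ y, qInf q (x / y * q * q ^ k) = qInf q (x / y * q ^ (k + 1)) := fun y => by
    congr 1; ring
  have e5 : qInf q (q * q ^ k) = qInf q (q ^ (k + 1)) := by rw [pow_succ']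
  have e6 : ∀ y m, qInf q (y * q ^ m) = (1 - y * q ^ m) * qInf q (y * q ^ (m + 1)) := fun y m => by
    rw [qInf_succ hq, pow_succ, mul_assoc]
  simp only [jTerm, jTel, jFac, e1, e2, e3, e4, e5]
  -- The index k - 1 in `jTel` is truncated at k = 0. This is harmless, because (q^0; q)_∞ = 0 makes
  -- `jTel` vanish there, but the case needs its own polynomial identity.
  rcases k with - | m
  · have id0 := jTel_poly_identity_zero h
    simp only [pow_zero, mul_one, qInf_one hq, qPoch_zero, zero_mul, zero_sub, zero_add,
      pow_one, Nat.sub_self, one_mul, qPoch_one]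
    have e7 : ∀ y, qInf q (x / y) = (1 - x / y) * qInf q (x / y * q) := fun y => qInf_succ hq _
    rw [e7 u, e7 t]
    linear_combination (1 - x ^ 2) * qInf q q * (qInf q (x / α * q) * qInf q (x / β * q) *
      qInf q (x / γ * q) * qInf q (x / t * q) * qInf q (x / u * q)) * id0
  · have id1 := jTel_poly_identity (x * q ^ (m + 1)) h
    have e8 : qInf q (q ^ (m + 1)) = (1 - q ^ (m + 1)) * qInf q (q ^ (m + 1 + 1)) := by
      simpa using e6 1 (m + 1)
    have e9 : x * q ^ (m + 1) / x = q ^ (m + 1) := by field_simp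
    rw [e9] at id1
    rw [e8, e6 (x / α) (m + 1), e6 (x / β) (m + 1), e6 (x / γ) (m + 1), e6 (x / t) (m + 1),
      e6 (x / u) (m + 1), qPoch_succ' q (x * t) m, qPoch_succ' q (x * u) m]
    simp only [qPoch_succ q _ (m + 1), Nat.add_sub_cancel, qPoch_succ q (x * t * q) m,
      qPoch_succ q (x * u * q) m]
    have r1 : ∀ y, x * y * q * q ^ m = x * q ^ (m + 1) * y := fun y => by ring
    have r2 : ∀ y, x * y * q ^ (m + 1) = x * q ^ (m + 1) * y := fun y => by ring
    have r3 : ∀ y, x / y * q ^ (m + 1) = x * q ^ (m + 1) / y := fun y => by ring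
    have r4 : x ^ 2 * q ^ (m + 1) = x * q ^ (m + 1) * x := by ring
    rw [r1, r1, r2, r2, r2, r3, r3, r3, r3, r3, r4]
    generalize x * q ^ (m + 1) = z at *
    generalize qInf q (x / α * q ^ (m + 1 + 1)) = A1 at *
    generalize qInf q (x / β * q ^ (m + 1 + 1)) = A2 at *
    generalize qInf q (x / γ * q ^ (m + 1 + 1)) = A3 at *
    generalize qInf q (x / t * q ^ (m + 1 + 1)) = A4 at *
    generalize qInf q (x / u * q ^ (m + 1 + 1)) = A5 at *
    generalize qInf q (q ^ (m + 1 + 1)) = A6 at *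
    generalize qPoch q (x ^ 2) (m + 1) = B0 at *
    generalize qPoch q (x * α) (m + 1) = B1 at *
    generalize qPoch q (x * β) (m + 1) = B2 at *
    generalize qPoch q (x * γ) (m + 1) = B3 at *
    generalize qPoch q (x * t * q) m = B4 at *
    generalize qPoch q (x * u * q) m = B5 at *
    generalize q ^ (m + 1) = Q at *
    generalize z / α = zα at *
    generalize z / β = zβ at *
    generalize z / γ = zγ at *
    generalize z / t = zt at *
    generalize z / u = zu at *
    linear_combination (A1 * A2 * A3 * A4 * A5 * A6 * B0 * B1 * B2 * B3 * B4 * B5) * id1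

theorem tendsto_jTel {q : ℂ} (hq : ‖q‖ < 1) (x α β γ t u : ℂ) :
    Tendsto (jTel q x α β γ t u) atTop (𝓝 (qInf q (x ^ 2) * qInf q (x * α) * qInf q (x * β) *
      qInf q (x * γ) * qInf q (x * t * q) * qInf q (x * u * q))) := by
  have h1 : Tendsto (fun k : ℕ => q ^ k) atTop (𝓝 0) := tendsto_pow_atTop_nhds_zero_of_norm_lt_one hq
  have h2 : ∀ y : ℂ, Tendsto (fun k : ℕ => qInf q (y * q ^ k)) atTop (𝓝 1) := fun y => by
    have := ((continuous_qInf hq).tendsto _).comp (h1.const_mul y)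
    rw [mul_zero, qInf_zero] at this
    exact this
  have h3 := tendsto_qPoch hq
  have h4 : ∀ y, Tendsto (fun k => qPoch q y (k - 1)) atTop (𝓝 (qInf q y)) := fun y =>
    (h3 y).comp (tendsto_sub_atTop_nat 1)
  have h5 := h2 1
  simp only [one_mul] at h5
  have := ((((((h5.mul (h3 (x ^ 2))).mul ((h3 (x * α)).mul (h2 (x / α)))).mul
    ((h3 (x * β)).mul (h2 (x / β)))).mul ((h3 (x * γ)).mul (h2 (x / γ)))).mul
    ((h4 (x * t * q)).mul (h2 (x / t)))).mul ((h4 (x * u * q)).mul (h2 (x / u))))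
  simp only [one_mul, mul_one] at this
  exact this

/-- The sum of the differences telescopes. The boundary term at 0 vanishes because (1; q)_∞ = 0, and
the limit at infinity gives the product on the right. -/
theorem jSum_contiguous {q : ℂ} (hq0 : q ≠ 0) (hq : ‖q‖ < 1) {x α β γ t u : ℂ}
    (h : x * α * β * γ * t * u = 1) :
    u ^ 2 * ((1 - t * α) * (1 - t * β) * (1 - t * γ)) * jSum q x α t β γ (q * u) -
      t ^ 2 * ((1 - u * α) * (1 - u * β) * (1 - u * γ)) * jSum q x α (q * t) β γ u =
    -((t - u) * t * u * (qInf q (x ^ 2) * qInf q (x * α) * qInf q (x * β) *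
      qInf q (x * γ) * qInf q (x * t * q) * qInf q (x * u * q))) := by
  have hs := ((summable_jTerm hq x α t β γ (q * u)).hasSum.mul_left
      (u ^ 2 * ((1 - t * α) * (1 - t * β) * (1 - t * γ)))).sub
    ((summable_jTerm hq x α (q * t) β γ u).hasSum.mul_left
      (t ^ 2 * ((1 - u * α) * (1 - u * β) * (1 - u * γ))))
  refine tendsto_nhds_unique hs.tendsto_sum_nat ?_
  simp only [jTerm_contiguous hq0 hq h, ← Finset.mul_sum, Finset.sum_range_sub']
  have h0 : jTel q x α β γ t u 0 = 0 := by simp [jTel, qInf_one hq]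
  simpa [h0] using ((tendsto_jTel hq x α β γ t u).const_sub 0).const_mul ((t - u) * t * u)

/-! ### The nonterminating Jackson sum: difference equation and normalisation -/

/-- The difference of two very-well-poised series in the nonterminating form of Jackson's sum,
with the denominators cleared. -/
noncomputable def jLeft (q t₀ t₁ t₂ t₃ t₄ t₅ : ℂ) : ℂ :=
  jSum q t₀ t₁ t₂ t₃ t₄ t₅ * (qInf q (t₁ ^ 2) * (qInf q (t₁ * t₂) * qInf q (t₁ * t₃) *
      qInf q (t₁ * t₄) * qInf q (t₁ * t₅))) -
    jSum q t₁ t₀ t₂ t₃ t₄ t₅ * (qInf q (t₀ ^ 2) * (qInf q (t₀ * t₂) * qInf q (t₀ * t₃) *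
      qInf q (t₀ * t₄) * qInf q (t₀ * t₅)))

/-- The infinite product in the nonterminating form of Jackson's sum, with the denominators
cleared. -/
noncomputable def jRight (q t₀ t₁ t₂ t₃ t₄ t₅ : ℂ) : ℂ :=
  t₀ * (qInf q q * qInf q (q * t₀ / t₁) * qInf q (t₁ / t₀) * qInf q (t₀ ^ 2) * qInf q (t₁ ^ 2)) *
    (qInf q (q / (t₂ * t₃)) * qInf q (q / (t₂ * t₄)) * qInf q (q / (t₃ * t₅)) *
      qInf q (q / (t₄ * t₅)) * (qInf q (q / (t₂ * t₅)) * qInf q (q / (t₃ * t₄))))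

/-- `jSum_contiguous` is applied twice, with x and α interchanged. Each relation is multiplied by
the product that accompanies its series in `jLeft`; the inhomogeneous terms then become symmetric in
x and α and cancel. The factors 1 - tα and 1 - uα, or 1 - tx and 1 - ux, are absorbed into those
products. -/
theorem jLeft_contiguous {q : ℂ} (hq0 : q ≠ 0) (hq : ‖q‖ < 1) {x α β γ t u : ℂ}
    (h : x * α * β * γ * t * u = 1) :
    u ^ 2 * ((1 - t * β) * (1 - t * γ)) * jLeft q x α t β γ (q * u) =
      t ^ 2 * ((1 - u * β) * (1 - u * γ)) * jLeft q x α (q * t) β γ u := by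
  have h1 := jSum_contiguous hq0 hq h
  have h2 := jSum_contiguous hq0 hq (x := α) (α := x) (β := β) (γ := γ) (t := t) (u := u)
    (by linear_combination h)
  have e1 : ∀ y z, qInf q (y * z) = (1 - z * y) * qInf q (y * z * q) := fun y z => by
    rw [qInf_succ hq, mul_comm z y]
  have e2 : ∀ y z, y * (q * z) = y * z * q := fun y z => by ring
  have e3 : α * x = x * α := mul_comm _ _
  rw [e3] at h2
  simp only [jLeft, e2]
  rw [e1 α t, e1 α u, e1 x t, e1 x u]
  linear_combination (qInf q (α ^ 2) * qInf q (α * t * q) * qInf q (α * β) * qInf q (α * γ) *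
      qInf q (α * u * q)) * h1 - (qInf q (x ^ 2) * qInf q (x * t * q) * qInf q (x * β) *
      qInf q (x * γ) * qInf q (x * u * q)) * h2


/-- The value that fixes the constant of proportionality. If t₀t₂ = 1, then (t₀t₂)_k = (1)_k
vanishes for k ≥ 1, which leaves one term of the first series, and the factor (t₀t₂)_∞ = 0 removes
the second series. -/
theorem jLeft_eq_jRight_of_mul_eq_one {q : ℂ} (hq0 : q ≠ 0) (hq : ‖q‖ < 1) {t₀ t₁ t₂ t₃ t₄ t₅ : ℂ}
    (h : t₀ * t₁ * t₂ * t₃ * t₄ * t₅ = q) (h2 : t₀ * t₂ = 1) :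
    jLeft q t₀ t₁ t₂ t₃ t₄ t₅ = jRight q t₀ t₁ t₂ t₃ t₄ t₅ := by
  have h0 : t₀ ≠ 0 := by rintro rfl; simp at h2
  have h3 : t₃ ≠ 0 := by rintro rfl; simp at h; exact hq0 h.symm
  have h4 : t₄ ≠ 0 := by rintro rfl; simp at h; exact hq0 h.symm
  have h5 : t₅ ≠ 0 := by rintro rfl; simp at h; exact hq0 h.symm
  have hs : jSum q t₀ t₁ t₂ t₃ t₄ t₅ = jTerm q t₀ t₁ t₂ t₃ t₄ t₅ 0 := by
    refine tsum_eq_single 0 fun k hk => ?_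
    obtain ⟨m, rfl⟩ := Nat.exists_eq_succ_of_ne_zero hk
    have hz : qPoch q 1 (m + 1) = 0 := by rw [qPoch_succ', sub_self, zero_mul]
    simp [jTerm, jFac, h2, hz]
  obtain rfl : t₂ = 1 / t₀ := by field_simp; linear_combination h2
  have hp : q = t₁ * t₃ * t₄ * t₅ := by rw [← h]; field_simp
  have e1 : q / (t₃ * t₅) = t₁ * t₄ := by rw [hp]; field_simp
  have e2 : q / (t₄ * t₅) = t₁ * t₃ := by rw [hp]; field_simp
  have e3 : q / (t₃ * t₄) = t₁ * t₅ := by rw [hp]; field_simp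
  have e4 : ∀ y, q / (1 / t₀ * y) = t₀ * q / y := fun y => by field_simp
  have e5 : t₀ * q / (1 / t₀) = t₀ ^ 2 * q := by field_simp
  have e6 : qInf q (t₀ ^ 2) = (1 - t₀ ^ 2) * qInf q (t₀ ^ 2 * q) := qInf_succ hq _
  rw [jLeft, jRight, hs, jTerm]
  simp only [jFac, h2, qInf_one hq, e1, e2, e3, e4, e5, e6, pow_zero, mul_one, qPoch_zero, one_mul,
    zero_mul, mul_zero, sub_zero, mul_one_div, mul_comm q t₀]
  ring

/-! ### Holomorphy of the series in its parameters -/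

theorem differentiableAt_jSum {q : ℂ} (hq : ‖q‖ < 1) {x y₁ y₂ y₃ y₄ y₅ : ℂ → ℂ} {U : Set ℂ}
    (hU : IsOpen U) (hx : DifferentiableOn ℂ x U) (h₁ : DifferentiableOn ℂ y₁ U)
    (h₂ : DifferentiableOn ℂ y₂ U) (h₃ : DifferentiableOn ℂ y₃ U) (h₄ : DifferentiableOn ℂ y₄ U)
    (h₅ : DifferentiableOn ℂ y₅ U) (n₁ : ∀ s ∈ U, y₁ s ≠ 0) (n₂ : ∀ s ∈ U, y₂ s ≠ 0)
    (n₃ : ∀ s ∈ U, y₃ s ≠ 0) (n₄ : ∀ s ∈ U, y₄ s ≠ 0) (n₅ : ∀ s ∈ U, y₅ s ≠ 0) {s₀ : ℂ}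
    (hs₀ : s₀ ∈ U) :
    DifferentiableAt ℂ (fun s => jSum q (x s) (y₁ s) (y₂ s) (y₃ s) (y₄ s) (y₅ s)) s₀ := by
  let B : ℂ → ℝ := fun s => ‖x s‖ * jMaj q (x s) (y₁ s) (y₂ s) (y₃ s) (y₄ s) (y₅ s)
  have hm := continuous_qMaj q
  have hB : ContinuousOn B U := by
    have hx := hx.continuousOn
    have h₁ := h₁.continuousOn
    have h₂ := h₂.continuousOn
    have h₃ := h₃.continuousOn
    have h₄ := h₄.continuousOn
    have h₅ := h₅.continuousOn
    have key : ∀ y : ℂ → ℂ, ContinuousOn y U → (∀ s ∈ U, y s ≠ 0) →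
        ContinuousOn (fun s => qMaj q (x s * y s) * qMaj q (x s * q / y s)) U := fun y hy ny =>
      (hm.comp_continuousOn (hx.mul hy)).mul
        (hm.comp_continuousOn ((hx.mul continuousOn_const).div hy ny))
    exact hx.norm.mul (((continuousOn_const.add (hx.norm.pow 2)).mul
      (continuousOn_const.mul (hm.comp_continuousOn (hx.pow 2)))).mul
      (((((key y₁ h₁ n₁).mul (key y₂ h₂ n₂)).mul (key y₃ h₃ n₃)).mul (key y₄ h₄ n₄)).mul
        (key y₅ h₅ n₅)))
  -- The bound B is continuous, so it stays below B s₀ + 1 on a neighbourhood of s₀, where the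
  -- geometric series gives the Weierstrass majorant.
  have hopen : IsOpen (U ∩ B ⁻¹' Set.Iio (B s₀ + 1)) := hB.isOpen_inter_preimage hU isOpen_Iio
  have hmem : s₀ ∈ U ∩ B ⁻¹' Set.Iio (B s₀ + 1) := ⟨hs₀, lt_add_one (B s₀)⟩
  refine (Complex.differentiableOn_tsum_of_summable_norm
    ((summable_geometric_of_lt_one (norm_nonneg q) hq).mul_left (B s₀ + 1)) (fun k => ?_) hopen
    (fun k s hs => ?_)).differentiableAt (hopen.mem_nhds hmem)
  · refine DifferentiableOn.mono ?_ Set.inter_subset_left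
    have hi := differentiable_qInf hq
    have hp := differentiable_qPoch q k
    have key : ∀ y : ℂ → ℂ, DifferentiableOn ℂ y U → (∀ s ∈ U, y s ≠ 0) →
        DifferentiableOn ℂ (fun s => jFac q (x s) (y s) k) U := fun y hy ny =>
      (hp.comp_differentiableOn (hx.mul hy)).mul
        (hi.comp_differentiableOn (((hx.mul_const q).div hy ny).mul_const _))
    exact ((((hx.mul_const _).mul (((hx.mul_const _).pow 2).const_sub 1))).mul
      ((hp.comp_differentiableOn (hx.pow 2)).const_mul (qInf q (q * q ^ k)))).mul
      (((((key y₁ h₁ n₁).mul (key y₂ h₂ n₂)).mul (key y₃ h₃ n₃)).mul (key y₄ h₄ n₄)).mul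
        (key y₅ h₅ n₅))
  · refine (norm_jTerm_le hq _ _ _ _ _ _ k).trans ?_
    have := hs.2
    exact mul_le_mul_of_nonneg_right (le_of_lt this) (by positivity)

/-! ### Uniqueness for q-difference equations on the punctured plane -/

/-- Two functions continuous at a point agree there if they agree off a countable set. -/
theorem eq_of_continuousAt_of_countable {f g : ℂ → ℂ} {s₀ : ℂ} (hf : ContinuousAt f s₀)
    (hg : ContinuousAt g s₀) {E : Set ℂ} (hE : E.Countable) (h : ∀ s ∉ E, f s = g s) :
    f s₀ = g s₀ := by
  have hd := hE.dense_compl ℂ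
  have : (𝓝[Eᶜ] s₀).NeBot := mem_closure_iff_nhdsWithin_neBot.mp (hd s₀)
  refine tendsto_nhds_unique (f := f) (l := 𝓝[Eᶜ] s₀) (hf.mono_left nhdsWithin_le_nhds) ?_
  refine (hg.mono_left nhdsWithin_le_nhds : Tendsto g (𝓝[Eᶜ] s₀) _).congr' ?_
  filter_upwards [self_mem_nhdsWithin] with s hs using (h s hs).symm

/-- A `q`-periodic holomorphic function on the punctured plane is constant. -/
theorem eq_of_mul_left_periodic {q : ℂ} (hq0 : q ≠ 0) (hq : ‖q‖ < 1) {F : ℂ → ℂ}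
    (hF : ∀ s ≠ 0, DifferentiableAt ℂ F s) (hp : ∀ s ≠ 0, F (q * s) = F s) {s s' : ℂ}
    (hs : s ≠ 0) (hs' : s' ≠ 0) : F s = F s' := by
  have hpow : ∀ (n : ℤ) (s : ℂ), s ≠ 0 → F (q ^ n * s) = F s := by
    intro n
    induction n using Int.induction_on with
    | zero => simp
    | succ n ih =>
      intro s hs
      rw [zpow_add_one₀ hq0, mul_assoc, ih _ (mul_ne_zero hq0 hs), hp s hs]
    | pred n ih =>
      intro s hs
      rw [zpow_sub_one₀ hq0, mul_assoc, ih _ (mul_ne_zero (inv_ne_zero hq0) hs),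
        ← hp _ (mul_ne_zero (inv_ne_zero hq0) hs), mul_inv_cancel_left₀ hq0]
  have hq0' : 0 < ‖q‖ := norm_pos_iff.mpr hq0
  let K : Set ℂ := Metric.closedBall 0 ‖q‖⁻¹ ∩ {s | 1 ≤ ‖s‖}
  have hK : IsCompact K := (isCompact_closedBall _ _).inter_right
    (isClosed_le continuous_const continuous_norm)
  have hKc : ContinuousOn F K := fun s hs => (hF s (by
    rintro rfl
    have : (1 : ℝ) ≤ ‖(0 : ℂ)‖ := hs.2
    simp at this; linarith)).continuousAt.continuousWithinAt
  -- Every nonzero point is moved by a power of q into the compact annulus 1 ≤ |s| ≤ 1/|q|, so the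
  -- values of F on the punctured plane are those on the annulus. Liouville's theorem then applies
  -- to F ∘ exp.
  have hb : Bornology.IsBounded (Set.range (F ∘ Complex.exp)) := by
    refine (hK.image_of_continuousOn hKc).isBounded.subset ?_
    rintro _ ⟨w, rfl⟩
    obtain ⟨n, hn1, hn2⟩ := exists_mem_Ico_zpow (norm_pos_iff.mpr (Complex.exp_ne_zero w))
      ((one_lt_inv₀ hq0').mpr hq)
    refine ⟨q ^ n * Complex.exp w, ⟨?_, ?_⟩, hpow n _ (Complex.exp_ne_zero w)⟩
    · rw [mem_closedBall_zero_iff, norm_mul, norm_zpow]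
      rw [inv_zpow, zpow_add_one₀ hq0'.ne', mul_inv] at hn2
      have := mul_le_mul_of_nonneg_left hn2.le (zpow_pos hq0' n).le
      rwa [mul_inv_cancel_left₀ (zpow_pos hq0' n).ne'] at this
    · show 1 ≤ ‖_‖
      rw [norm_mul, norm_zpow]
      rw [inv_zpow] at hn1
      have := mul_le_mul_of_nonneg_left hn1 (zpow_pos hq0' n).le
      rwa [mul_inv_cancel₀ (zpow_pos hq0' n).ne'] at this
  have hd : Differentiable ℂ (F ∘ Complex.exp) := fun w =>
    (hF _ (Complex.exp_ne_zero w)).comp w Complex.differentiable_exp.differentiableAt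
  have := hd.apply_eq_apply_of_bounded hb (Complex.log s) (Complex.log s')
  simpa [Complex.exp_log hs, Complex.exp_log hs'] using this

/-- If `f` and `g` are holomorphic on the punctured plane with the same first order
`q`-difference equation, and no `q`-orbit consists of zeros of `g`, then `f` and `g` are
proportional. -/
theorem eq_of_proportional_of_qDiff {q : ℂ} (hq0 : q ≠ 0) (hq : ‖q‖ < 1) {f g : ℂ → ℂ}
    (hf : ∀ s ≠ 0, DifferentiableAt ℂ f s) (hg : ∀ s ≠ 0, DifferentiableAt ℂ g s)
    (h : ∀ (n : ℕ), ∀ s ≠ 0, f s * g (q ^ n * s) = f (q ^ n * s) * g s)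
    (hz : ∀ s ≠ 0, ∃ m : ℤ, g (q ^ m * s) ≠ 0) {s₁ : ℂ} (h₁ : s₁ ≠ 0) (hfg : f s₁ = g s₁)
    (hg₁ : g s₁ ≠ 0) {s : ℂ} (hs : s ≠ 0) : f s = g s := by
  have hne : ∀ (m : ℤ) {s : ℂ}, s ≠ 0 → q ^ m * s ≠ 0 := fun m s hs =>
    mul_ne_zero (zpow_ne_zero _ hq0) hs
  have hcross : ∀ (m n : ℤ), ∀ s ≠ 0,
      f (q ^ m * s) * g (q ^ n * s) = f (q ^ n * s) * g (q ^ m * s) := by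
    intro m n s hs
    wlog hmn : m ≤ n generalizing m n
    · exact (this n m (le_of_not_ge hmn)).symm
    obtain ⟨k, rfl⟩ := Int.le.dest hmn
    have := h k (q ^ m * s) (hne m hs)
    rw [← zpow_natCast, ← mul_assoc, ← zpow_add₀ hq0, add_comm] at this
    exact this
  classical
  -- The quotient f/g is evaluated at a point of the orbit of s where g does not vanish. By `hcross`
  -- the value does not depend on the point, so F extends f/g across the zeros of g.
  let M : ℂ → ℤ := fun s => if hs : s ≠ 0 then (hz s hs).choose else 0
  have hM : ∀ s ≠ 0, g (q ^ M s * s) ≠ 0 := fun s hs => by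
    simp only [M, dif_pos hs]; exact (hz s hs).choose_spec
  let F : ℂ → ℂ := fun s => f (q ^ M s * s) / g (q ^ M s * s)
  have hFeq : ∀ (m : ℤ), ∀ s ≠ 0, g (q ^ m * s) ≠ 0 →
      F s = f (q ^ m * s) / g (q ^ m * s) := fun m s hs hm => by
    rw [div_eq_div_iff (hM s hs) hm]; exact hcross _ _ s hs
  have hFd : ∀ s ≠ 0, DifferentiableAt ℂ F s := by
    intro s hs
    have hd : ∀ u : ℂ → ℂ, (∀ s ≠ 0, DifferentiableAt ℂ u s) →
        DifferentiableAt ℂ (fun z => u (q ^ M s * z)) s := fun u hu =>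
      (hu _ (hne _ hs)).comp s (f := fun z => q ^ M s * z) (by fun_prop)
    -- The index M s, chosen at the centre, remains admissible nearby because g is continuous. So F
    -- is locally a quotient of holomorphic functions, although M itself need not be locally
    -- constant.
    refine ((hd f hf).div (hd g hg) (hM s hs)).congr_of_eventuallyEq ?_
    filter_upwards [(hd g hg).continuousAt.eventually_ne (hM s hs), eventually_ne_nhds hs]
      with z hz1 hz0 using hFeq _ z hz0 hz1
  have hFp : ∀ s ≠ 0, F (q * s) = F s := by
    intro s hs
    have e : q ^ M (q * s) * (q * s) = q ^ (M (q * s) + 1) * s := by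
      rw [zpow_add_one₀ hq0, mul_assoc]
    have h2 := hM (q * s) (mul_ne_zero hq0 hs)
    rw [e] at h2
    rw [hFeq _ s hs h2]
    simp only [F]
    rw [e]
  have h1 : F s = 1 := by
    rw [eq_of_mul_left_periodic hq0 hq hFd hFp hs h₁, hFeq 0 s₁ h₁ (by simpa using hg₁)]
    simp [hfg, div_self hg₁]
  have h2 := hcross 0 (M s) s hs
  simp only [F, div_eq_one_iff_eq (hM s hs)] at h1
  rw [h1, mul_comm] at h2
  simpa using mul_left_cancel₀ (hM s hs) h2

/-! ### Comparison of the two sides of the nonterminating Jackson sum -/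

/-- The part of `jRight` depending on `s = t₂`, as `t₂ t₅` is kept fixed; here `w = t₀ t₁`,
`β = t₃` and `γ = t₄`. -/
noncomputable def jMid (q w β γ s : ℂ) : ℂ :=
  qInf q (q / (β * s)) * qInf q (q / (γ * s)) * (qInf q (w * γ * s) * qInf q (w * β * s))

/-- With w = t₀t₁ this is the equation of `jLeft_contiguous`, which makes the two sides comparable.
-/
theorem jMid_contiguous {q : ℂ} (hq0 : q ≠ 0) (hq : ‖q‖ < 1) {w β γ s u : ℂ}
    (h : w * β * γ * s * u = 1) :
    u ^ 2 * ((1 - s * β) * (1 - s * γ)) * jMid q w β γ s =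
      s ^ 2 * ((1 - u * β) * (1 - u * γ)) * jMid q w β γ (q * s) := by
  have hw : w ≠ 0 := by rintro rfl; simp at h
  have hβ : β ≠ 0 := by rintro rfl; simp at h
  have hγ : γ ≠ 0 := by rintro rfl; simp at h
  have hs : s ≠ 0 := by rintro rfl; simp at h
  have e1 : ∀ y : ℂ, qInf q (q / (y * (q * s))) = (1 - 1 / (y * s)) * qInf q (q / (y * s)) := by
    intro y
    rw [mul_left_comm, ← div_div, div_self hq0, qInf_succ hq, one_div_mul_eq_div]
  have e2 : ∀ y : ℂ, qInf q (w * y * s) = (1 - w * y * s) * qInf q (w * y * (q * s)) := by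
    intro y
    rw [qInf_succ hq]; ring_nf
  obtain rfl : u = 1 / (w * β * γ * s) := by field_simp; linear_combination h
  simp only [jMid]
  rw [e1, e1, e2, e2]
  field_simp
  ring

theorem differentiableAt_jMid {q : ℂ} (hq : ‖q‖ < 1) {w β γ s : ℂ}
    (hβ : β ≠ 0) (hγ : γ ≠ 0) (hs : s ≠ 0) : DifferentiableAt ℂ (jMid q w β γ) s := by
  have hi := differentiable_qInf hq
  have h1 : ∀ y : ℂ, y ≠ 0 → DifferentiableAt ℂ (fun s => qInf q (q / (y * s))) s := fun y hy =>
    (hi _).comp s (f := fun s => q / (y * s)) (by fun_prop (disch := exact mul_ne_zero hy hs))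
  have h2 : ∀ y : ℂ, DifferentiableAt ℂ (fun s => qInf q (y * s)) s := fun y =>
    (hi _).comp s (f := fun s => y * s) (by fun_prop)
  exact ((h1 β hβ).mul (h1 γ hγ)).mul ((h2 (w * γ)).mul (h2 (w * β)))

theorem qInf_ne_zero_of_forall_zpow {q : ℂ} (hq : ‖q‖ < 1) {x : ℂ}
    (h : ∀ m : ℤ, x ≠ q ^ m) : qInf q x ≠ 0 := by
  rw [qInf_ne_zero_iff hq]
  intro j hj
  apply h (-(j : ℤ))
  rw [zpow_neg, zpow_natCast]
  exact eq_inv_of_mul_eq_one_left (sub_eq_zero.mp hj).symm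

theorem exists_norm_mul_pow_lt_one {q : ℂ} (hq : ‖q‖ < 1) (x y : ℂ) :
    ∃ m : ℕ, ‖x * q ^ m‖ < 1 ∧ ‖y * q ^ m‖ < 1 := by
  have h : ∀ x : ℂ, Tendsto (fun m : ℕ => ‖x * q ^ m‖) atTop (𝓝 0) := fun x => by
    have := (((tendsto_pow_atTop_nhds_zero_of_norm_lt_one hq).const_mul x)).norm
    simpa using this
  exact (((h x).eventually_lt_const one_pos).and ((h y).eventually_lt_const one_pos)).exists

/-- The first two factors of `jMid` can vanish only if βs or γs is a power of q, the last two only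
if wβs or wγs is. Genericity excludes that both happen on one orbit. Moving far enough along the
orbit, in the right direction, brings the arguments of the remaining dangerous pair below 1 in norm.
-/
theorem exists_jMid_ne_zero {q : ℂ} (hq0 : q ≠ 0) (hq : ‖q‖ < 1) {w β γ s : ℂ} (hβ : β ≠ 0)
    (hγ : γ ≠ 0) (hs : s ≠ 0) (h0 : ∀ m : ℤ, w ≠ q ^ m) (h1 : ∀ m : ℤ, w * β ≠ γ * q ^ m)
    (h2 : ∀ m : ℤ, w * γ ≠ β * q ^ m) : ∃ m : ℤ, jMid q w β γ (q ^ m * s) ≠ 0 := by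
  by_cases hc : (∃ a : ℤ, β * s = q ^ a) ∨ (∃ a : ℤ, γ * s = q ^ a)
  · have hwβ : ∀ m : ℤ, w * β * s ≠ q ^ m := by
      intro m hm
      rcases hc with ⟨a, ha⟩ | ⟨a, ha⟩
      · apply h0 (m - a)
        rw [zpow_sub₀ hq0, eq_div_iff (zpow_ne_zero _ hq0), ← hm, ← ha]; ring
      · apply h1 (m - a)
        rw [zpow_sub₀ hq0, mul_div, eq_div_iff (zpow_ne_zero _ hq0), ← hm, ← ha]; ring
    have hwγ : ∀ m : ℤ, w * γ * s ≠ q ^ m := by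
      intro m hm
      rcases hc with ⟨a, ha⟩ | ⟨a, ha⟩
      · apply h2 (m - a)
        rw [zpow_sub₀ hq0, mul_div, eq_div_iff (zpow_ne_zero _ hq0), ← hm, ← ha]; ring
      · apply h0 (m - a)
        rw [zpow_sub₀ hq0, eq_div_iff (zpow_ne_zero _ hq0), ← hm, ← ha]; ring
    obtain ⟨m, hm1, hm2⟩ := exists_norm_mul_pow_lt_one hq (q / (β * s)) (q / (γ * s))
    have e : ∀ y : ℂ, q / (y * (q ^ (-(m : ℤ)) * s)) = q / (y * s) * q ^ m := fun y => by
      rw [zpow_neg, zpow_natCast, mul_left_comm, inv_mul_eq_div, div_div_eq_mul_div]; ring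
    have e' : ∀ y : ℂ, (∀ m : ℤ, y * s ≠ q ^ m) → qInf q (y * (q ^ (-(m : ℤ)) * s)) ≠ 0 :=
      fun y hy => qInf_ne_zero_of_forall_zpow hq fun k hk => hy (k + m) <| by
        have h3 := zpow_ne_zero (m : ℤ) hq0
        rw [zpow_add₀ hq0, ← hk, zpow_neg]; field_simp
    refine ⟨-m, mul_ne_zero (mul_ne_zero ?_ ?_) (mul_ne_zero (e' _ hwγ) (e' _ hwβ))⟩
    · rw [e]; exact qInf_ne_zero_of_norm_lt_one hq hm1
    · rw [e]; exact qInf_ne_zero_of_norm_lt_one hq hm2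
  · push Not at hc
    obtain ⟨m, hm1, hm2⟩ := exists_norm_mul_pow_lt_one hq (w * γ * s) (w * β * s)
    have e : ∀ y : ℂ, y * (q ^ (m : ℤ) * s) = y * s * q ^ m := fun y => by
      rw [zpow_natCast]; ring
    have e' : ∀ y : ℂ, y ≠ 0 → (∀ m : ℤ, y * s ≠ q ^ m) →
        qInf q (q / (y * (q ^ (m : ℤ) * s))) ≠ 0 :=
      fun y hy0 hy => qInf_ne_zero_of_forall_zpow hq fun k hk => hy (1 - k - m) <| by
        rw [div_eq_iff (by exact mul_ne_zero hy0 (mul_ne_zero (zpow_ne_zero _ hq0) hs))] at hk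
        rw [zpow_sub₀ hq0, zpow_sub₀ hq0, zpow_one, eq_div_iff (zpow_ne_zero _ hq0),
          eq_div_iff (zpow_ne_zero _ hq0)]
        linear_combination -hk
    refine ⟨m, mul_ne_zero (mul_ne_zero (e' _ hβ hc.1) (e' _ hγ hc.2)) (mul_ne_zero ?_ ?_)⟩
    · rw [e]; exact qInf_ne_zero_of_norm_lt_one hq hm1
    · rw [e]; exact qInf_ne_zero_of_norm_lt_one hq hm2

theorem differentiableAt_jLeft {q : ℂ} (hq : ‖q‖ < 1) {t₀ t₁ t₂ t₃ t₄ t₅ : ℂ → ℂ} {U : Set ℂ}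
    (hU : IsOpen U) (h₀ : DifferentiableOn ℂ t₀ U) (h₁ : DifferentiableOn ℂ t₁ U)
    (h₂ : DifferentiableOn ℂ t₂ U) (h₃ : DifferentiableOn ℂ t₃ U) (h₄ : DifferentiableOn ℂ t₄ U)
    (h₅ : DifferentiableOn ℂ t₅ U) (n₀ : ∀ s ∈ U, t₀ s ≠ 0) (n₁ : ∀ s ∈ U, t₁ s ≠ 0)
    (n₂ : ∀ s ∈ U, t₂ s ≠ 0) (n₃ : ∀ s ∈ U, t₃ s ≠ 0) (n₄ : ∀ s ∈ U, t₄ s ≠ 0)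
    (n₅ : ∀ s ∈ U, t₅ s ≠ 0) {s : ℂ} (hs : s ∈ U) :
    DifferentiableAt ℂ (fun s => jLeft q (t₀ s) (t₁ s) (t₂ s) (t₃ s) (t₄ s) (t₅ s)) s := by
  have d : ∀ t : ℂ → ℂ, DifferentiableOn ℂ t U → DifferentiableAt ℂ (fun s => qInf q (t s)) s :=
    fun t ht => (differentiable_qInf hq _).comp s (ht.differentiableAt (hU.mem_nhds hs))
  exact ((differentiableAt_jSum hq hU h₀ h₁ h₂ h₃ h₄ h₅ n₁ n₂ n₃ n₄ n₅ hs).mul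
    ((d _ (h₁.pow 2)).mul ((((d _ (h₁.mul h₂)).mul (d _ (h₁.mul h₃))).mul
      (d _ (h₁.mul h₄))).mul (d _ (h₁.mul h₅))))).sub
    ((differentiableAt_jSum hq hU h₁ h₀ h₂ h₃ h₄ h₅ n₀ n₂ n₃ n₄ n₅ hs).mul
    ((d _ (h₀.pow 2)).mul ((((d _ (h₀.mul h₂)).mul (d _ (h₀.mul h₃))).mul
      (d _ (h₀.mul h₄))).mul (d _ (h₀.mul h₅)))))

theorem jRight_eq_mul_jMid {q : ℂ} (hq0 : q ≠ 0) {t₀ t₁ t₂ t₃ t₄ t₅ : ℂ}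
    (h : t₀ * t₁ * t₂ * t₃ * t₄ * t₅ = q) :
    jRight q t₀ t₁ t₂ t₃ t₄ t₅ =
      t₀ * (qInf q q * qInf q (q * t₀ / t₁) * qInf q (t₁ / t₀) * qInf q (t₀ ^ 2) *
        qInf q (t₁ ^ 2)) * (qInf q (t₀ * t₁ * t₃ * t₄) * qInf q (q / (t₃ * t₄))) *
        jMid q (t₀ * t₁) t₃ t₄ t₂ := by
  have h2 : t₂ ≠ 0 := by rintro rfl; simp at h; exact hq0 h.symm
  have h3 : t₃ ≠ 0 := by rintro rfl; simp at h; exact hq0 h.symm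
  have h4 : t₄ ≠ 0 := by rintro rfl; simp at h; exact hq0 h.symm
  have h5 : t₅ ≠ 0 := by rintro rfl; simp at h; exact hq0 h.symm
  have e1 : q / (t₃ * t₅) = t₀ * t₁ * t₄ * t₂ := by rw [← h]; field_simp
  have e2 : q / (t₄ * t₅) = t₀ * t₁ * t₃ * t₂ := by rw [← h]; field_simp
  have e3 : q / (t₂ * t₅) = t₀ * t₁ * t₃ * t₄ := by rw [← h]; field_simp
  rw [jRight, jMid, e1, e2, e3, mul_comm t₂ t₃, mul_comm t₂ t₄]
  ring

/-- Both sides are regarded as functions of s = t₂ with t₂t₅ = p fixed. The conditions `h0`, `h1`,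
`h2` exclude an orbit of zeros of the product side, and `h3` to `h6` make its variable part nonzero
at the normalising point s = 1/t₀. -/
theorem jLeft_eq_jRight_of_generic {q : ℂ} (hq0 : q ≠ 0) (hq : ‖q‖ < 1) {t₀ t₁ t₂ t₃ t₄ t₅ : ℂ}
    (h : t₀ * t₁ * t₂ * t₃ * t₄ * t₅ = q) (h0 : ∀ m : ℤ, t₀ * t₁ ≠ q ^ m)
    (h1 : ∀ m : ℤ, t₀ * t₁ * t₃ ≠ t₄ * q ^ m) (h2 : ∀ m : ℤ, t₀ * t₁ * t₄ ≠ t₃ * q ^ m)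
    (h3 : ∀ m : ℤ, t₀ ≠ t₃ * q ^ m) (h4 : ∀ m : ℤ, t₀ ≠ t₄ * q ^ m)
    (h5 : ∀ m : ℤ, t₁ * t₃ ≠ q ^ m) (h6 : ∀ m : ℤ, t₁ * t₄ ≠ q ^ m) :
    jLeft q t₀ t₁ t₂ t₃ t₄ t₅ = jRight q t₀ t₁ t₂ t₃ t₄ t₅ := by
  have n0 : t₀ ≠ 0 := by rintro rfl; simp at h; exact hq0 h.symm
  have n1 : t₁ ≠ 0 := by rintro rfl; simp at h; exact hq0 h.symm
  have n2 : t₂ ≠ 0 := by rintro rfl; simp at h; exact hq0 h.symm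
  have n3 : t₃ ≠ 0 := by rintro rfl; simp at h; exact hq0 h.symm
  have n4 : t₄ ≠ 0 := by rintro rfl; simp at h; exact hq0 h.symm
  have n5 : t₅ ≠ 0 := by rintro rfl; simp at h; exact hq0 h.symm
  set p := q / (t₀ * t₁ * t₃ * t₄) with hp
  have hp0 : p ≠ 0 := by rw [hp]; positivity
  have hprod : ∀ s ≠ 0, t₀ * t₁ * s * t₃ * t₄ * (p / s) = q := fun s hs => by
    rw [hp]; field_simp
  obtain rfl : t₅ = p / t₂ := by rw [hp, ← h]; field_simp
  set f : ℂ → ℂ := fun s => jLeft q t₀ t₁ s t₃ t₄ (p / s) with hf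
  set C := t₀ * (qInf q q * qInf q (q * t₀ / t₁) * qInf q (t₁ / t₀) * qInf q (t₀ ^ 2) *
        qInf q (t₁ ^ 2)) * (qInf q (t₀ * t₁ * t₃ * t₄) * qInf q (q / (t₃ * t₄))) with hC
  set g : ℂ → ℂ := jMid q (t₀ * t₁) t₃ t₄ with hg
  have hR : ∀ s ≠ 0, jRight q t₀ t₁ s t₃ t₄ (p / s) = C * g s := fun s hs =>
    jRight_eq_mul_jMid hq0 (hprod s hs)
  have hU : IsOpen {s : ℂ | s ≠ 0} := isOpen_ne
  have hfd : ∀ s ≠ 0, DifferentiableAt ℂ f s := fun s hs => by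
    have hc : ∀ c : ℂ, DifferentiableOn ℂ (fun _ : ℂ => c) {s : ℂ | s ≠ 0} := fun c =>
      differentiableOn_const c
    exact differentiableAt_jLeft hq hU (hc t₀) (hc t₁) differentiableOn_id (hc t₃) (hc t₄)
      ((hc p).div differentiableOn_id fun _ h => h) (fun _ _ => n0) (fun _ _ => n1)
      (fun _ h => h) (fun _ _ => n3) (fun _ _ => n4) (fun _ h => div_ne_zero hp0 h) hs
  have hgd : ∀ s ≠ 0, DifferentiableAt ℂ g s := fun s hs => differentiableAt_jMid hq n3 n4 hs
  -- The two excluded values of s are those where ut₃ = 1 or ut₄ = 1, so that the coefficient to be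
  -- divided by vanishes.
  have rel : ∀ s ≠ 0, s * q ≠ p * t₃ → s * q ≠ p * t₄ → ∃ a, f (q * s) = a * f s ∧
      g (q * s) = a * g s := by
    intro s hs hs3 hs4
    set u := p / (q * s) with hu
    have hrel : t₀ * t₁ * t₃ * t₄ * s * u = 1 := by rw [hu, hp]; field_simp
    have r1 := jLeft_contiguous hq0 hq (x := t₀) (α := t₁) (β := t₃) (γ := t₄) (t := s) (u := u)
      (by linear_combination hrel)
    have r2 := jMid_contiguous hq0 hq (w := t₀ * t₁) (β := t₃) (γ := t₄) (s := s) (u := u)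
      (by linear_combination hrel)
    have e1 : q * u = p / s := by rw [hu]; field_simp
    rw [e1] at r1
    have hB : s ^ 2 * ((1 - u * t₃) * (1 - u * t₄)) ≠ 0 := by
      refine mul_ne_zero (pow_ne_zero _ hs) (mul_ne_zero ?_ ?_)
      · intro h; apply hs3; rw [hu] at h; field_simp at h; linear_combination h
      · intro h; apply hs4; rw [hu] at h; field_simp at h; linear_combination h
    refine ⟨u ^ 2 * ((1 - s * t₃) * (1 - s * t₄)) / (s ^ 2 * ((1 - u * t₃) * (1 - u * t₄))),
      ?_, ?_⟩
    · rw [div_mul_eq_mul_div, eq_div_iff hB, mul_comm]; exact r1.symm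
    · rw [div_mul_eq_mul_div, eq_div_iff hB, mul_comm]; exact r2.symm
  have cross : ∀ (n : ℕ), ∀ s ≠ 0, f s * g (q ^ n * s) = f (q ^ n * s) * g s := by
    intro n s hs
    have hsn : q ^ n * s ≠ 0 := mul_ne_zero (pow_ne_zero _ hq0) hs
    have hcont : ∀ u : ℂ → ℂ, (∀ s ≠ 0, DifferentiableAt ℂ u s) →
        ContinuousAt (fun z => u (q ^ n * z)) s := fun u hu =>
      ContinuousAt.comp (f := fun z => q ^ n * z) (hu _ hsn).continuousAt (by fun_prop)
    -- The points whose forward orbit meets an excluded value of `rel`. They are countably many, so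
    -- the cross relation extends to them by continuity.
    let E : Set ℂ := {0} ∪ ((Set.range fun i : ℕ => p * t₃ / (q * q ^ i)) ∪
      (Set.range fun i : ℕ => p * t₄ / (q * q ^ i)))
    have hE : E.Countable := (Set.countable_singleton _).union
      ((Set.countable_range _).union (Set.countable_range _))
    refine eq_of_continuousAt_of_countable ((hfd s hs).continuousAt.mul (hcont g hgd))
      ((hcont f hfd).mul (hgd s hs).continuousAt) hE fun z hz => ?_
    have hz0 : z ≠ 0 := fun h => hz (Or.inl h)
    clear hcont hsn
    show f z * g (q ^ n * z) = f (q ^ n * z) * g z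
    induction n with
    | zero => simp
    | succ n ih =>
      have hzn : q ^ n * z ≠ 0 := mul_ne_zero (pow_ne_zero _ hq0) hz0
      obtain ⟨a, ha1, ha2⟩ := rel (q ^ n * z) hzn
        (fun h => hz (Or.inr (Or.inl ⟨n, by
          show p * t₃ / (q * q ^ n) = z
          rw [← h]; field_simp⟩)))
        (fun h => hz (Or.inr (Or.inr ⟨n, by
          show p * t₄ / (q * q ^ n) = z
          rw [← h]; field_simp⟩)))
      rw [pow_succ', mul_assoc, ha1, ha2]
      linear_combination a * ih
  have hinv : (1 / t₀ : ℂ) ≠ 0 := one_div_ne_zero n0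
  have g1 : g (1 / t₀) ≠ 0 := by
    refine mul_ne_zero (mul_ne_zero ?_ ?_) (mul_ne_zero ?_ ?_) <;>
      refine qInf_ne_zero_of_forall_zpow hq fun m hm => ?_
    · apply h3 (m - 1)
      rw [zpow_sub_one₀ hq0, ← hm]; field_simp
    · apply h4 (m - 1)
      rw [zpow_sub_one₀ hq0, ← hm]; field_simp
    · apply h6 m
      rw [← hm]; field_simp
    · apply h5 m
      rw [← hm]; field_simp
  have f1 : f (1 / t₀) = C * g (1 / t₀) := by
    rw [← hR _ hinv]
    exact jLeft_eq_jRight_of_mul_eq_one hq0 hq (hprod _ hinv) (mul_one_div_cancel n0)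
  rw [hR _ n2]
  -- Comparing f + (1 - C)g with g, instead of f with Cg, avoids dividing by C, which may be zero.
  have := eq_of_proportional_of_qDiff hq0 hq (f := fun s => f s + (1 - C) * g s) (g := g)
    (fun s hs => (hfd s hs).add ((hgd s hs).const_mul _)) hgd
    (fun n s hs => by linear_combination cross n s hs)
    (fun s hs => exists_jMid_ne_zero hq0 hq n3 n4 hs h0 h1 h2) hinv (by rw [f1]; ring) g1 n2
  linear_combination this

theorem countable_setOf_mul_zpow {q a b : ℂ} (ha : a ≠ 0) :
    {s : ℂ | ∃ m : ℤ, a * s = b * q ^ m}.Countable := by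
  refine (Set.countable_range fun m : ℤ => b * q ^ m / a).mono ?_
  rintro s ⟨m, hm⟩
  exact ⟨m, by simp only; rw [← hm]; field_simp⟩

theorem countable_setOf_mul_sq_zpow {q a b : ℂ} (ha : a ≠ 0) :
    {s : ℂ | ∃ m : ℤ, a * s ^ 2 = b * q ^ m}.Countable := by
  have : {s : ℂ | ∃ m : ℤ, a * s ^ 2 = b * q ^ m} = ⋃ m : ℤ, {s : ℂ | a * s ^ 2 = b * q ^ m} := by
    ext s; simp
  rw [this]
  refine Set.countable_iUnion fun m => ?_
  by_cases hne : ∃ s : ℂ, a * s ^ 2 = b * q ^ m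
  · obtain ⟨s₁, h₁⟩ := hne
    refine (Set.Countable.insert s₁ (Set.countable_singleton (-s₁))).mono fun s hs => ?_
    have : s ^ 2 = s₁ ^ 2 := mul_left_cancel₀ ha (Eq.trans hs h₁.symm)
    exact sq_eq_sq_iff_eq_or_eq_neg.mp this
  · rw [Set.eq_empty_of_forall_notMem fun s hs => hne ⟨s, hs⟩]
    exact Set.countable_empty

/-- Bailey's nonterminating extension of Jackson's sum, with the denominators cleared. -/
theorem jLeft_eq_jRight {q : ℂ} (hq0 : q ≠ 0) (hq : ‖q‖ < 1) {t₀ t₁ t₂ t₃ t₄ t₅ : ℂ}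
    (h : t₀ * t₁ * t₂ * t₃ * t₄ * t₅ = q) :
    jLeft q t₀ t₁ t₂ t₃ t₄ t₅ = jRight q t₀ t₁ t₂ t₃ t₄ t₅ := by
  have n0 : t₀ ≠ 0 := by rintro rfl; simp at h; exact hq0 h.symm
  have n1 : t₁ ≠ 0 := by rintro rfl; simp at h; exact hq0 h.symm
  have n2 : t₂ ≠ 0 := by rintro rfl; simp at h; exact hq0 h.symm
  have n3 : t₃ ≠ 0 := by rintro rfl; simp at h; exact hq0 h.symm
  have n4 : t₄ ≠ 0 := by rintro rfl; simp at h; exact hq0 h.symm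
  have n5 : t₅ ≠ 0 := by rintro rfl; simp at h; exact hq0 h.symm
  have hU : IsOpen {s : ℂ | s ≠ 0} := isOpen_ne
  have hc : ∀ c : ℂ, DifferentiableOn ℂ (fun _ : ℂ => c) {s : ℂ | s ≠ 0} := fun c =>
    differentiableOn_const c
  have hm : ∀ c : ℂ, DifferentiableOn ℂ (fun s : ℂ => c * s) {s : ℂ | s ≠ 0} := fun c => by
    fun_prop
  -- The deformation t₁s, t₃s, t₄s, t₅/s³ keeps the product of the parameters. Each genericity
  -- condition then depends on s through s or s², and so fails for only countably many s.
  have hl : ContinuousAt (fun s : ℂ => jLeft q t₀ (t₁ * s) t₂ (t₃ * s) (t₄ * s) (t₅ / s ^ 3)) 1 :=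
    (differentiableAt_jLeft hq hU (hc t₀) (hm t₁) (hc t₂) (hm t₃) (hm t₄)
      ((hc t₅).div (by fun_prop) fun s hs => pow_ne_zero 3 hs) (fun _ _ => n0)
      (fun _ h => mul_ne_zero n1 h) (fun _ _ => n2) (fun _ h => mul_ne_zero n3 h)
      (fun _ h => mul_ne_zero n4 h) (fun _ h => div_ne_zero n5 (pow_ne_zero _ h))
      one_ne_zero).continuousAt
  have hr : ContinuousAt (fun s : ℂ => jRight q t₀ (t₁ * s) t₂ (t₃ * s) (t₄ * s) (t₅ / s ^ 3)) 1 := by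
    have hi := fun x => (continuous_qInf hq).continuousAt (x := x)
    have key : ∀ t : ℂ → ℂ, ContinuousAt t 1 → ContinuousAt (fun s => qInf q (t s)) 1 :=
      fun t ht => ContinuousAt.comp (hi _) ht
    unfold jRight
    refine (continuousAt_const.mul ((((continuousAt_const.mul (key _ ?_)).mul
      (key _ ?_)).mul continuousAt_const).mul (key _ ?_))).mul (((((key _ ?_).mul
      (key _ ?_)).mul (key _ ?_)).mul (key _ ?_)).mul ((key _ ?_).mul (key _ ?_)))
    all_goals fun_prop (disch := simp [n1, n2, n3, n4, n5])
  let E : Set ℂ := {0} ∪ ({s | ∃ m : ℤ, t₀ * t₁ * s = 1 * q ^ m} ∪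
    ({s | ∃ m : ℤ, t₀ * t₁ * t₃ * s = t₄ * q ^ m} ∪
    ({s | ∃ m : ℤ, t₀ * t₁ * t₄ * s = t₃ * q ^ m} ∪
    ({s | ∃ m : ℤ, t₃ * s = t₀ * q ^ m} ∪ ({s | ∃ m : ℤ, t₄ * s = t₀ * q ^ m} ∪
    ({s | ∃ m : ℤ, t₁ * t₃ * s ^ 2 = 1 * q ^ m} ∪
    {s | ∃ m : ℤ, t₁ * t₄ * s ^ 2 = 1 * q ^ m}))))))
  have hE : E.Countable := (Set.countable_singleton _).union
    ((countable_setOf_mul_zpow (by positivity)).union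
    ((countable_setOf_mul_zpow (by positivity)).union
    ((countable_setOf_mul_zpow (by positivity)).union
    ((countable_setOf_mul_zpow (by positivity)).union
    ((countable_setOf_mul_zpow (by positivity)).union
    ((countable_setOf_mul_sq_zpow (by positivity)).union
    (countable_setOf_mul_sq_zpow (by positivity))))))))
  have := eq_of_continuousAt_of_countable hl hr hE fun s hs => by
    simp only [E, Set.mem_union, Set.mem_singleton_iff, Set.mem_ofPred_eq, not_or, not_exists,
      one_mul] at hs
    obtain ⟨hs0, hs1, hs2, hs3, hs4, hs5, hs6, hs7⟩ := hs
    refine jLeft_eq_jRight_of_generic hq0 hq (by rw [← h]; field_simp) (fun m hm => hs1 m ?_)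
      (fun m hm => hs2 m ?_) (fun m hm => hs3 m ?_) (fun m hm => hs4 (-m) ?_)
      (fun m hm => hs5 (-m) ?_) (fun m hm => hs6 m ?_) (fun m hm => hs7 m ?_)
    · rw [← hm]; ring
    · apply mul_right_cancel₀ hs0; linear_combination hm
    · apply mul_right_cancel₀ hs0; linear_combination hm
    · rw [zpow_neg, ← div_eq_mul_inv, eq_div_iff (zpow_ne_zero _ hq0), hm]
    · rw [zpow_neg, ← div_eq_mul_inv, eq_div_iff (zpow_ne_zero _ hq0), hm]
    · rw [← hm]; ring
    · rw [← hm]; ring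
  simpa using this

/-! ### Translation of the hypergeometric series into symmetric form -/

theorem qFac_neg_natCast {q : ℂ} (hq0 : q ≠ 0) (x : ℂ) (m : ℕ) :
    qFac q x (-(m : ℤ)) = (qPoch q (x * (q ^ m)⁻¹) m)⁻¹ := by
  rcases m with - | m
  · simp [qFac]
  · change qFac q x (Int.negSucc m) = _
    rw [qFac, qPoch, ← Finset.prod_range_reflect]
    congr 1
    refine Finset.prod_congr rfl fun j hj => ?_
    obtain ⟨i, hi⟩ : ∃ i, m = j + i := Nat.exists_eq_add_of_le (by
      have := Finset.mem_range.mp hj; omega)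
    subst hi
    have e : j + i + 1 - 1 - j = i := by omega
    rw [e, zpow_neg, ← Nat.cast_add_one, zpow_natCast]
    field_simp
    ring

/-- Splitting (xq^{-n})_m, or (xq^{-n})_n when m < n, gives one formula for both signs of m - n. It
turns the sum over k ≥ -n into a sum over m ≥ 0. -/
theorem qFac_sub {q : ℂ} (hq0 : q ≠ 0) {x : ℂ} {n : ℕ} (h : qPoch q (x * (q ^ n)⁻¹) n ≠ 0)
    (m : ℕ) : qFac q x ((m : ℤ) - n) =
      qPoch q (x * (q ^ n)⁻¹) m / qPoch q (x * (q ^ n)⁻¹) n := by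
  rcases le_total n m with hmn | hmn
  · obtain ⟨i, rfl⟩ := Nat.exists_eq_add_of_le hmn
    have e : ((n + i : ℕ) : ℤ) - n = (i : ℕ) := by push_cast; ring
    rw [e, qFac_natCast, qPoch_add, mul_div_cancel_left₀ _ h,
      inv_mul_cancel_right₀ (pow_ne_zero _ hq0)]
  · obtain ⟨i, rfl⟩ := Nat.exists_eq_add_of_le hmn
    have e : (m : ℤ) - (m + i : ℕ) = -(i : ℤ) := by push_cast; ring
    have e2 : x * (q ^ (m + i))⁻¹ * q ^ m = x * (q ^ i)⁻¹ := by
      rw [pow_add]; field_simp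
    rw [qPoch_add, e2] at h
    rw [e, qFac_neg_natCast hq0, qPoch_add, e2, div_mul_cancel_left₀ (left_ne_zero_of_mul h)]

/-- The form suited to denominator parameters: unlike `qFac_eq_div` it does not need (xq^k)_∞ ≠ 0.
If that product vanishes, both sides are 0 by the convention for the inverse, and division by them
still gives (xq^k)_∞/(x)_∞ = 0. -/
theorem qFac_eq_inv {q : ℂ} (hq0 : q ≠ 0) (hq : ‖q‖ < 1) {x : ℂ} (h : qInf q x ≠ 0) (k : ℤ) :
    qFac q x k = (qInf q (x * q ^ k) / qInf q x)⁻¹ := by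
  obtain ⟨m, rfl | rfl⟩ := k.eq_nat_or_neg
  · rw [qFac_natCast, zpow_natCast, qInf_eq_qPoch_mul hq x m, inv_div,
      mul_div_cancel_right₀ _ (qInf_mul_pow_ne_zero hq h m)]
  · rw [qFac_neg_natCast hq0, zpow_neg, zpow_natCast, qInf_eq_qPoch_mul hq (x * (q ^ m)⁻¹) m,
      inv_mul_cancel_right₀ (pow_ne_zero _ hq0), mul_div_cancel_right₀ _ h]

/-- The factor by which reversal changes a finite `q`-shifted factorial. -/
noncomputable def qTau (q : ℂ) (n : ℕ) : ℂ := ∏ j ∈ Finset.range n, -(q ^ (j + 1))⁻¹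

theorem qTau_ne_zero {q : ℂ} (hq0 : q ≠ 0) (n : ℕ) : qTau q n ≠ 0 :=
  Finset.prod_ne_zero_iff.mpr fun _ _ => neg_ne_zero.mpr (inv_ne_zero (pow_ne_zero _ hq0))

/-- The exponents 1, …, n add up to n(n+1)/2, and squaring removes the sign. -/
theorem qTau_sq {q : ℂ} (hq0 : q ≠ 0) (n : ℕ) : qTau q n ^ 2 * ((q ^ n) ^ n * q ^ n) = 1 := by
  induction n with
  | zero => simp [qTau]
  | succ n ih =>
    have : qTau q (n + 1) = qTau q n * -(q ^ (n + 1))⁻¹ := Finset.prod_range_succ _ _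
    rw [← ih, this]
    field_simp
    ring

/-- Factor by factor, 1 - cq^{-i} = -cq^{-i}(1 - q^i/c), with the order of the factors reversed. -/
theorem qPoch_reverse {q : ℂ} (hq0 : q ≠ 0) {c : ℂ} (hc : c ≠ 0) (n : ℕ) :
    qPoch q (c * (q ^ n)⁻¹) n = c ^ n * qTau q n * qPoch q (q / c) n := by
  have e : c ^ n = ∏ _j ∈ Finset.range n, c := by simp
  rw [qPoch, ← Finset.prod_range_reflect, e, qTau, qPoch, ← Finset.prod_mul_distrib,
    ← Finset.prod_mul_distrib]
  refine Finset.prod_congr rfl fun j hj => ?_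
  obtain ⟨i, hi⟩ : ∃ i, n = j + i + 1 := ⟨n - (j + 1), by
    have := Finset.mem_range.mp hj; omega⟩
  subst hi
  have e : j + i + 1 - 1 - j = i := by omega
  rw [e]
  field_simp
  ring

theorem qFac_mul_div_qFac {q : ℂ} (hq0 : q ≠ 0) (hq : ‖q‖ < 1) {r : ℂ} (h : qInf q r ≠ 0) {n : ℕ}
    (hn : qPoch q (q * r * (q ^ n)⁻¹) n ≠ 0) (m : ℕ) :
    qFac q (q * r) ((m : ℤ) - n) / qFac q r ((m : ℤ) - n) =
      (1 - r * q ^ ((m : ℤ) - n)) / (1 - r) := by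
  have e1 : r * q ^ ((m : ℤ) - n) = r * (q ^ n)⁻¹ * q ^ m := by
    rw [zpow_sub₀ hq0, zpow_natCast, zpow_natCast]; ring
  have h1 := qInf_succ hq (r * (q ^ n)⁻¹ * q ^ m)
  have h2 := qInf_eq_qPoch_mul hq (q * r * (q ^ n)⁻¹) m
  have h3 := qInf_eq_qPoch_mul hq (q * r * (q ^ n)⁻¹) n
  have h4 := qInf_succ hq r
  have e2 : q * r * (q ^ n)⁻¹ * q ^ m = r * (q ^ n)⁻¹ * q ^ m * q := by ring
  have e3 : q * r * (q ^ n)⁻¹ * q ^ n = r * q := by field_simp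
  rw [e2] at h2
  rw [e3] at h3
  have h5 : 1 - r ≠ 0 := fun h0 => h (by rw [h4, h0, zero_mul])
  rw [qFac_sub hq0 hn, qFac_eq_inv hq0 hq h, div_inv_eq_mul, e1, div_mul_div_comm,
    div_eq_div_iff (mul_ne_zero hn h) h5, h1, h4]
  linear_combination (1 - r * (q ^ n)⁻¹ * q ^ m) * (1 - r) * (h3 - h2)

/-- Used for every well-poised pair of an upper and a lower parameter. The normalising denominator
does not depend on m and can be taken out of the sum. -/
theorem qFac_div_qFac_eq_jFac {q : ℂ} (hq0 : q ≠ 0) (hq : ‖q‖ < 1) {u v x y : ℂ} {n : ℕ}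
    (hu : u = x * y * q ^ n) (hv : v = x * q / y * q ^ n)
    (hxy : qPoch q (x * y) n ≠ 0) (h : qInf q v ≠ 0) (m : ℕ) :
    qFac q u ((m : ℤ) - n) / qFac q v ((m : ℤ) - n) =
      jFac q x y m / (qPoch q (x * y) n * qInf q v) := by
  have e1 : u * (q ^ n)⁻¹ = x * y := by rw [hu, mul_inv_cancel_right₀ (pow_ne_zero _ hq0)]
  have e2 : v * q ^ ((m : ℤ) - n) = x * q / y * q ^ m := by
    rw [hv, zpow_sub₀ hq0, zpow_natCast, zpow_natCast]; field_simp
  rw [← e1] at hxy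
  rw [qFac_sub hq0 hxy, qFac_eq_inv hq0 hq h, div_inv_eq_mul, div_mul_div_comm, e1, e2, jFac]

theorem jTerm_eq {q x : ℂ} (hx : x ≠ 0) (y₁ y₂ y₃ y₄ y₅ : ℂ) (m : ℕ) :
    jTerm q x y₁ y₂ y₃ y₄ y₅ m = x * q ^ m * (1 - (x * q ^ m) ^ 2) * (jFac q x x m *
      (jFac q x y₁ m * jFac q x y₂ m * jFac q x y₃ m * jFac q x y₄ m * jFac q x y₅ m)) := by
  have : jFac q x x m = qInf q (q * q ^ m) * qPoch q (x ^ 2) m := by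
    rw [jFac, mul_div_cancel_left₀ _ hx, sq, mul_comm]
  rw [this, jTerm]; ring

/-- After k = m - n the upper parameters are those of the series with x = rq^{-n}: aq^{-2n} = x·x, b
= x·(bq^n/r), cq^{-n} = x·(c/r), and likewise for d, e, f. The parameters ±q√a produce the
very-well-poised factor 1 - (xq^m)². -/
theorem semiTerm_eq {q a r b c d e f : ℂ} (hq0 : q ≠ 0) (hq : ‖q‖ < 1) (hb0 : b ≠ 0)
    (hr0 : r ≠ 0) (hr : r ^ 2 = a) {n : ℕ}
    (h₁ : qInf q r ≠ 0) (h₂ : qInf q (-r) ≠ 0) (h₃ : qInf q (a * q ^ (1 - (n : ℤ)) / b) ≠ 0)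
    (hc : qInf q (a * q / c) ≠ 0) (hd : qInf q (a * q / d) ≠ 0) (he : qInf q (a * q / e) ≠ 0)
    (hf : qInf q (a * q / f) ≠ 0) (h₄ : qPoch q (q * r * (q ^ n)⁻¹) n ≠ 0)
    (h₅ : qPoch q (q * (-r) * (q ^ n)⁻¹) n ≠ 0) (h₆ : qPoch q ((r * (q ^ n)⁻¹) ^ 2) n ≠ 0)
    (h₇ : qPoch q b n ≠ 0) (hc' : qPoch q (c * (q ^ n)⁻¹) n ≠ 0)
    (hd' : qPoch q (d * (q ^ n)⁻¹) n ≠ 0) (he' : qPoch q (e * (q ^ n)⁻¹) n ≠ 0)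
    (hf' : qPoch q (f * (q ^ n)⁻¹) n ≠ 0) (m : ℕ) :
    semiTerm q a r b c d e f n ((m : ℤ) - n) =
      (r * (1 - a) * (qPoch q ((r * (q ^ n)⁻¹) ^ 2) n * qInf q (q * q ^ n)) *
        (qPoch q b n * qInf q (a * q ^ (1 - (n : ℤ)) / b)) *
        (qPoch q (c * (q ^ n)⁻¹) n * qInf q (a * q / c)) *
        (qPoch q (d * (q ^ n)⁻¹) n * qInf q (a * q / d)) *
        (qPoch q (e * (q ^ n)⁻¹) n * qInf q (a * q / e)) *
        (qPoch q (f * (q ^ n)⁻¹) n * qInf q (a * q / f)))⁻¹ *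
      jTerm q (r * (q ^ n)⁻¹) (b * q ^ n / r) (c / r) (d / r) (e / r) (f / r) m := by
  set x := r * (q ^ n)⁻¹ with hx
  have hQ : q ^ n ≠ 0 := pow_ne_zero _ hq0
  have hx0 : x ≠ 0 := mul_ne_zero hr0 (inv_ne_zero hQ)
  have exy : ∀ y, x * (y / r) = y * (q ^ n)⁻¹ := fun y => by rw [hx]; field_simp
  have key : ∀ y : ℂ, qPoch q (y * (q ^ n)⁻¹) n ≠ 0 → qInf q (a * q / y) ≠ 0 →
      qFac q y ((m : ℤ) - n) / qFac q (a * q / y) ((m : ℤ) - n) =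
      jFac q x (y / r) m / (qPoch q (y * (q ^ n)⁻¹) n * qInf q (a * q / y)) := by
    intro y h1 h2
    rw [← exy] at h1 ⊢
    refine qFac_div_qFac_eq_jFac hq0 hq ?_ ?_ h1 h2 m
    · rw [exy]; field_simp
    · rw [hx, ← hr]
      rcases eq_or_ne y 0 with rfl | hy
      · simp
      · field_simp
  have exb : x * (b * q ^ n / r) = b := by rw [hx]; field_simp
  have k0 := qFac_mul_div_qFac hq0 hq h₁ h₄ m
  have k1 := qFac_mul_div_qFac hq0 hq h₂ h₅ m
  have k2 : qFac q (b * q ^ n) ((m : ℤ) - n) / qFac q (a * q ^ (1 - (n : ℤ)) / b) ((m : ℤ) - n) =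
      jFac q x (b * q ^ n / r) m / (qPoch q b n * qInf q (a * q ^ (1 - (n : ℤ)) / b)) := by
    rw [← exb] at h₇
    have := qFac_div_qFac_eq_jFac hq0 hq (u := b * q ^ n) (v := a * q ^ (1 - (n : ℤ)) / b)
      (x := x) (y := b * q ^ n / r) (by rw [exb]) (by
        rw [hx, ← hr, zpow_sub₀ hq0, zpow_one, zpow_natCast]; field_simp) h₇ h₃ m
    rwa [exb] at this
  have k3 : qFac q (a * q ^ (-(n : ℤ))) ((m : ℤ) - n) / qFac q (q ^ (1 + n)) ((m : ℤ) - n) =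
      jFac q x x m / (qPoch q (x ^ 2) n * qInf q (q * q ^ n)) := by
    rw [sq] at h₆ ⊢
    have e1 : q ^ (1 + n) = q * q ^ n := by rw [pow_add, pow_one]
    rw [e1]
    refine qFac_div_qFac_eq_jFac hq0 hq ?_ ?_ h₆ (qInf_mul_pow_ne_zero hq (qInf_self_ne_zero hq) n) m
    · rw [hx, ← hr, zpow_neg, zpow_natCast]; field_simp
    · field_simp
  have kc := key c hc' hc
  have kd := key d hd' hd
  have ke := key e he' he
  have kf := key f hf' hf
  have k4 : r * q ^ ((m : ℤ) - n) = x * q ^ m := by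
    rw [hx, zpow_sub₀ hq0, zpow_natCast, zpow_natCast]; ring
  have k5 : (1 - r * q ^ ((m : ℤ) - n)) / (1 - r) * ((1 - -r * q ^ ((m : ℤ) - n)) / (1 - -r)) =
      (1 - (x * q ^ m) ^ 2) / (1 - a) := by
    rw [div_mul_div_comm, neg_mul, k4, ← hr]
    congr 1 <;> ring
  have k6 : q ^ ((m : ℤ) - n) = x * q ^ m / r := by
    rw [← k4]; field_simp
  have e0 : -(q * r) = q * -r := by ring
  rw [jTerm_eq hx0]
  calc semiTerm q a r b c d e f n ((m : ℤ) - n)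
      = (qFac q (a * q ^ (-(n : ℤ))) ((m : ℤ) - n) / qFac q (q ^ (1 + n)) ((m : ℤ) - n)) *
        ((qFac q (q * r) ((m : ℤ) - n) / qFac q r ((m : ℤ) - n)) *
          (qFac q (q * -r) ((m : ℤ) - n) / qFac q (-r) ((m : ℤ) - n))) *
        (qFac q (b * q ^ n) ((m : ℤ) - n) / qFac q (a * q ^ (1 - (n : ℤ)) / b) ((m : ℤ) - n)) *
        (qFac q c ((m : ℤ) - n) / qFac q (a * q / c) ((m : ℤ) - n)) *
        (qFac q d ((m : ℤ) - n) / qFac q (a * q / d) ((m : ℤ) - n)) *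
        (qFac q e ((m : ℤ) - n) / qFac q (a * q / e) ((m : ℤ) - n)) *
        (qFac q f ((m : ℤ) - n) / qFac q (a * q / f) ((m : ℤ) - n)) * q ^ ((m : ℤ) - n) := by
        simp only [semiTerm, qFacs, List.map_cons, List.map_nil, List.prod_cons, List.prod_nil,
          e0, mul_one, div_eq_mul_inv, mul_inv]
        ring
    _ = _ := by
        rw [k0, k1, k5, k2, k3, kc, kd, ke, kf, k6]
        simp only [div_eq_mul_inv, mul_inv]
        ring

/-- The series on the right-hand side is the companion of the one in `semiTerm_eq`: rq^{-n} and
bq^n/r have exchanged roles, and the base is (bq^n/r)² = b²q^{2n}/a. -/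
theorem phiTerm_eq {q a r b c d e f : ℂ} (hq0 : q ≠ 0) (hq : ‖q‖ < 1) (hb0 : b ≠ 0)
    (hr0 : r ≠ 0) (hr : r ^ 2 = a) {n : ℕ} (hphi : qInfs q (lowerParams q a r b c d e f n) ≠ 0)
    (m : ℕ) :
    phiTerm q (upperParams q a r b c d e f n) (lowerParams q a r b c d e f n) q m =
      (b * q ^ n / r * (1 - (b * q ^ n / r) ^ 2) * qInf q q * qInf q (b * q ^ (1 + 2 * n) / a) *
        qInf q (b * q ^ (1 + n) / c) * qInf q (b * q ^ (1 + n) / d) *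
        qInf q (b * q ^ (1 + n) / e) * qInf q (b * q ^ (1 + n) / f))⁻¹ *
      jTerm q (b * q ^ n / r) (r * (q ^ n)⁻¹) (c / r) (d / r) (e / r) (f / r) m := by
  set x := b * q ^ n / r with hx
  have hQ : q ^ n ≠ 0 := pow_ne_zero _ hq0
  have hx0 : x ≠ 0 := div_ne_zero (mul_ne_zero hb0 hQ) hr0
  simp only [qInfs, lowerParams, List.map_cons, List.map_nil, List.prod_cons, List.prod_nil,
    ne_eq, mul_eq_zero, not_or, one_ne_zero, not_false_eq_true, and_true, ← hx] at hphi
  obtain ⟨h1, h2, h3, h4, h5, h6, h7⟩ := hphi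
  have key : ∀ y u v : ℂ, u = x * y → v = x * q / y → qInf q v ≠ 0 →
      qFac q u m / qFac q v m = jFac q x y m / qInf q v := by
    intro y u v hu hv h
    have := qFac_div_qFac_eq_jFac hq0 hq (u := u) (v := v) (x := x) (y := y) (n := 0)
      (by simpa using hu) (by simpa using hv) (by simp) h m
    simpa using this
  have key' : ∀ y v : ℂ, v = b * q ^ (1 + n) / y → qInf q v ≠ 0 →
      qFac q (b * y * q ^ n / a) m / qFac q v m = jFac q x (y / r) m / qInf q v := by
    intro y v hv h
    refine key _ _ _ ?_ ?_ h
    · rw [hx, ← hr]; field_simp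
    · rw [hv, hx, pow_add, pow_one]
      rcases eq_or_ne y 0 with rfl | hy
      · simp
      · field_simp
  have k0 : qFac q (q * x) m / qFac q x m = (1 - x * q ^ m) / (1 - x) := by
    simpa using qFac_mul_div_qFac hq0 hq h1 (n := 0) (by simp) m
  have k1 : qFac q (q * -x) m / qFac q (-x) m = (1 - -x * q ^ m) / (1 - -x) := by
    simpa using qFac_mul_div_qFac hq0 hq h2 (n := 0) (by simp) m
  have k5 : (1 - x * q ^ m) / (1 - x) * ((1 - -x * q ^ m) / (1 - -x)) =
      (1 - (x * q ^ m) ^ 2) / (1 - x ^ 2) := by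
    rw [div_mul_div_comm, neg_mul]
    congr 1 <;> ring
  have k2 : qFac q b m / qFac q (b * q ^ (1 + 2 * n) / a) m =
      jFac q x (r * (q ^ n)⁻¹) m / qInf q (b * q ^ (1 + 2 * n) / a) := by
    refine key _ _ _ ?_ ?_ h3
    · rw [hx]; field_simp
    · rw [hx, ← hr]; field_simp; ring
  have k3 : qFac q (b ^ 2 * q ^ (2 * n) / a) m / qFac q q m = jFac q x x m / qInf q q := by
    refine key _ _ _ ?_ ?_ (qInf_self_ne_zero hq)
    · rw [hx, ← hr]; field_simp; ring
    · field_simp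
  have kc := key' c _ rfl h4
  have kd := key' d _ rfl h5
  have ke := key' e _ rfl h6
  have kf := key' f _ rfl h7
  have e0 : b * q ^ (1 + n) / r = q * x := by rw [hx]; ring
  have e1 : -(q * x) = q * -x := by ring
  rw [jTerm_eq hx0]
  calc phiTerm q (upperParams q a r b c d e f n) (lowerParams q a r b c d e f n) q m
      = (qFac q (b ^ 2 * q ^ (2 * n) / a) m / qFac q q m) *
        ((qFac q (q * x) m / qFac q x m) * (qFac q (q * -x) m / qFac q (-x) m)) *
        (qFac q b m / qFac q (b * q ^ (1 + 2 * n) / a) m) *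
        (qFac q (b * c * q ^ n / a) m / qFac q (b * q ^ (1 + n) / c) m) *
        (qFac q (b * d * q ^ n / a) m / qFac q (b * q ^ (1 + n) / d) m) *
        (qFac q (b * e * q ^ n / a) m / qFac q (b * q ^ (1 + n) / e) m) *
        (qFac q (b * f * q ^ n / a) m / qFac q (b * q ^ (1 + n) / f) m) * q ^ m := by
        simp only [phiTerm, upperParams, lowerParams, qFacs, List.map_cons, List.map_nil,
          List.prod_cons, List.prod_nil, e0, e1, ← hx, mul_one, div_eq_mul_inv, mul_inv]
        ring
    _ = _ := by
        rw [k0, k1, k5, k2, k3, kc, kd, ke, kf]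
        simp only [div_eq_mul_inv, mul_inv]
        field_simp

theorem qInfs_ne_zero_iff (q : ℂ) (xs : List ℂ) : qInfs q xs ≠ 0 ↔ ∀ x ∈ xs, qInf q x ≠ 0 := by
  simp [qInfs, List.prod_eq_zero_iff]

/-- The shift `m ↦ m - n` as an equivalence between `ℕ` and the integers `≥ -n`. -/
def natEquivIci (n : ℕ) : ℕ ≃ Set.Ici (-(n : ℤ)) where
  toFun m := ⟨(m : ℤ) - n, by simp⟩
  invFun k := ((k : ℤ) + n).toNat
  left_inv m := by simp
  right_inv k := by
    have := k.2
    simp only [Set.mem_Ici] at this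
    ext
    simp only
    omega

theorem phi_eq {q a r b c d e f : ℂ} (hq0 : q ≠ 0) (hq : ‖q‖ < 1) (hb0 : b ≠ 0)
    (hr0 : r ≠ 0) (hr : r ^ 2 = a) {n : ℕ} (hphi : qInfs q (lowerParams q a r b c d e f n) ≠ 0) :
    phi q (upperParams q a r b c d e f n) (lowerParams q a r b c d e f n) q =
      (b * q ^ n / r * (1 - (b * q ^ n / r) ^ 2) * qInf q q * qInf q (b * q ^ (1 + 2 * n) / a) *
        qInf q (b * q ^ (1 + n) / c) * qInf q (b * q ^ (1 + n) / d) *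
        qInf q (b * q ^ (1 + n) / e) * qInf q (b * q ^ (1 + n) / f))⁻¹ *
      jSum q (b * q ^ n / r) (r * (q ^ n)⁻¹) (c / r) (d / r) (e / r) (f / r) := by
  rw [phi, jSum, ← tsum_mul_left]
  exact tsum_congr (phiTerm_eq hq0 hq hb0 hr0 hr hphi)

/-- Up to the constant of `semiTerm_eq`, A_n times the product that accompanies the first series in
`jLeft` is the second half of `jLeft`, with positive sign. -/
theorem rhsFirst_mul {q a r b c d e f : ℂ} (hq0 : q ≠ 0) (hq : ‖q‖ < 1)
    (ha : a ≠ 0) (hb0 : b ≠ 0)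
    (hr0 : r ≠ 0) (hr : r ^ 2 = a) (ha1 : 1 - a ≠ 0) {n : ℕ}
    (hb : qPoch q b n ≠ 0) (hab : qInf q (a * q ^ (1 - (n : ℤ)) / b) ≠ 0)
    (hx : qPoch q ((r * (q ^ n)⁻¹) ^ 2) n ≠ 0)
    (hc' : qPoch q (c * (q ^ n)⁻¹) n ≠ 0) (hd' : qPoch q (d * (q ^ n)⁻¹) n ≠ 0)
    (he' : qPoch q (e * (q ^ n)⁻¹) n ≠ 0) (hf' : qPoch q (f * (q ^ n)⁻¹) n ≠ 0)
    (hc1 : qInf q (a * q / c) ≠ 0) (hd1 : qInf q (a * q / d) ≠ 0) (he1 : qInf q (a * q / e) ≠ 0)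
    (hf1 : qInf q (a * q / f) ≠ 0)
    (h₁ : qInf q (b * c * q ^ n / a) ≠ 0) (h₂ : qInf q (b * d * q ^ n / a) ≠ 0)
    (h₃ : qInf q (b * e * q ^ n / a) ≠ 0) (h₄ : qInf q (b * f * q ^ n / a) ≠ 0)
    (h₅ : qInf q (b ^ 2 * q ^ (1 + 2 * n) / a) ≠ 0)
    (hphi : qInfs q (lowerParams q a r b c d e f n) ≠ 0) :
    rhsFirst q a r b c d e f n * (qInf q ((b * q ^ n / r) ^ 2) *
      (qInf q (b * c * q ^ n / a) * qInf q (b * d * q ^ n / a) * qInf q (b * e * q ^ n / a) *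
        qInf q (b * f * q ^ n / a))) =
      (r * (1 - a) * (qPoch q ((r * (q ^ n)⁻¹) ^ 2) n * qInf q (q * q ^ n)) *
        (qPoch q b n * qInf q (a * q ^ (1 - (n : ℤ)) / b)) *
        (qPoch q (c * (q ^ n)⁻¹) n * qInf q (a * q / c)) *
        (qPoch q (d * (q ^ n)⁻¹) n * qInf q (a * q / d)) *
        (qPoch q (e * (q ^ n)⁻¹) n * qInf q (a * q / e)) *
        (qPoch q (f * (q ^ n)⁻¹) n * qInf q (a * q / f)))⁻¹ *
      (jSum q (b * q ^ n / r) (r * (q ^ n)⁻¹) (c / r) (d / r) (e / r) (f / r) *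
        (qInf q ((r * (q ^ n)⁻¹) ^ 2) * (qInf q (c * (q ^ n)⁻¹) * qInf q (d * (q ^ n)⁻¹) *
          qInf q (e * (q ^ n)⁻¹) * qInf q (f * (q ^ n)⁻¹)))) := by
  have hQ : q ^ n ≠ 0 := pow_ne_zero _ hq0
  have hphi' := hphi
  rw [qInfs_ne_zero_iff] at hphi'
  simp only [lowerParams, List.mem_cons, List.not_mem_nil, or_false, forall_eq_or_imp,
    forall_eq] at hphi'
  obtain ⟨p1, p2, p3, p4, p5, p6, p7⟩ := hphi'
  have hqq := qInf_self_ne_zero hq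
  have hqn : qPoch q q n ≠ 0 := qPoch_ne_zero hq hqq n
  have hqn' : qInf q (q * q ^ n) ≠ 0 := qInf_mul_pow_ne_zero hq hqq n
  have s1 : 1 - b * q ^ n / r ≠ 0 := fun h => p1 (by rw [qInf_succ hq, h, zero_mul])
  have s2 : 1 + b * q ^ n / r ≠ 0 := fun h => p2 (by
    rw [qInf_succ hq, sub_neg_eq_add, h, zero_mul])
  have s3 : 1 - (b * q ^ n / r) ^ 2 ≠ 0 := by
    have := mul_ne_zero s1 s2
    intro h; apply this; linear_combination h
  have hphisum := phi_eq hq0 hq hb0 hr0 hr hphi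
  have f1 : qInf q ((r * (q ^ n)⁻¹) ^ 2) = qPoch q ((r * (q ^ n)⁻¹) ^ 2) n *
      (a ^ n * qTau q n * qPoch q (q / a) n * ((1 - a) * qInf q (a * q))) := by
    rw [qInf_eq_qPoch_mul hq _ n, ← qPoch_reverse hq0 ha, ← qInf_succ hq]
    have := qInf_eq_qPoch_mul hq (a * (q ^ n)⁻¹) n
    rw [inv_mul_cancel_right₀ hQ] at this
    rw [← this, ← hr]
    congr 2
    field_simp
  have f2 := qInf_eq_qPoch_mul hq q n
  have f3 : ∀ y, qInf q (y * (q ^ n)⁻¹) = qPoch q (y * (q ^ n)⁻¹) n * qInf q y := fun y => by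
    rw [qInf_eq_qPoch_mul hq _ n, inv_mul_cancel_right₀ hQ]
  have f4 : qInf q ((b * q ^ n / r) ^ 2) =
      (1 - (b * q ^ n / r) ^ 2) * qInf q (b ^ 2 * q ^ (1 + 2 * n) / a) := by
    rw [qInf_succ hq, ← hr]
    congr 2
    field_simp
    ring
  have f5 : qInf q (a * q ^ (1 - (n : ℤ)) / b) =
      (a * q / b) ^ n * qTau q n * qPoch q (b / a) n * qInf q (a * q / b) := by
    have e1 : a * q ^ (1 - (n : ℤ)) / b = a * q / b * (q ^ n)⁻¹ := by
      rw [zpow_sub₀ hq0, zpow_one, zpow_natCast]; ring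
    have e2 : q / (a * q / b) = b / a := by field_simp
    rw [e1, f3, qPoch_reverse hq0 (by positivity), e2]
  have f6 : (a * q / b) ^ n = a ^ n * q ^ n / b ^ n := by rw [div_pow, mul_pow]
  rw [f5] at hab
  have n1 := right_ne_zero_of_mul hab
  have n2 := right_ne_zero_of_mul (left_ne_zero_of_mul hab)
  have ht := qTau_ne_zero hq0 n
  rw [rhsFirst, hphisum, f1, f4, f5, f6, f3, f3, f3, f3]
  simp only [qInfs, qFacs, qFac_natCast, List.map_cons, List.map_nil, List.prod_cons,
    List.prod_nil, mul_one]
  rw [f2]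
  -- With the infinite products and shifted factorials replaced by independent variables, a rational
  -- identity remains.
  generalize jSum q (b * q ^ n / r) (r * (q ^ n)⁻¹) (c / r) (d / r) (e / r) (f / r) = S at *
  generalize qInf q (b ^ 2 * q ^ (1 + 2 * n) / a) = A1 at *
  generalize qInf q (b * c * q ^ n / a) = A2 at *
  generalize qInf q (b * d * q ^ n / a) = A3 at *
  generalize qInf q (b * e * q ^ n / a) = A4 at *
  generalize qInf q (b * f * q ^ n / a) = A5 at *
  generalize qInf q (b * q ^ (1 + 2 * n) / a) = A6 at *
  generalize qInf q (b * q ^ (1 + n) / c) = A7 at *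
  generalize qInf q (b * q ^ (1 + n) / d) = A8 at *
  generalize qInf q (b * q ^ (1 + n) / e) = A9 at *
  generalize qInf q (b * q ^ (1 + n) / f) = A10 at *
  generalize qInf q (a * q / c) = C1 at *
  generalize qInf q (a * q / d) = C2 at *
  generalize qInf q (a * q / e) = C3 at *
  generalize qInf q (a * q / f) = C4 at *
  generalize qInf q (a * q / b) = C5 at *
  generalize qPoch q (c * (q ^ n)⁻¹) n = D1 at *
  generalize qPoch q (d * (q ^ n)⁻¹) n = D2 at *
  generalize qPoch q (e * (q ^ n)⁻¹) n = D3 at *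
  generalize qPoch q (f * (q ^ n)⁻¹) n = D4 at *
  generalize qPoch q ((r * (q ^ n)⁻¹) ^ 2) n = D5 at *
  generalize qPoch q (b / a) n = D6 at *
  generalize qPoch q (q / a) n = D7 at *
  generalize qInf q (q * q ^ n) = D8 at *
  generalize qTau q n = T at *
  generalize 1 - (b * q ^ n / r) ^ 2 = U at *
  generalize 1 - a = V at *
  field_simp
  rw [← hr]
  ring

-- The counterpart of `rhsFirst_mul` for B_n: the same factor and the same constant turn it into
-- `jRight`.
set_option maxHeartbeats 1000000 in
theorem rhsSecond_mul {q a r b c d e f : ℂ} (hq0 : q ≠ 0) (hq : ‖q‖ < 1)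
    (ha : a ≠ 0) (hc : c ≠ 0) (hd : d ≠ 0) (he : e ≠ 0) (hf : f ≠ 0)
    (hr0 : r ≠ 0) (hr : r ^ 2 = a) (hbdef : b * (c * d * e * f) = q * a ^ 2)
    (ha1 : 1 - a ≠ 0) {n : ℕ}
    (hb : qPoch q b n ≠ 0) (hab : qInf q (a * q ^ (1 - (n : ℤ)) / b) ≠ 0)
    (hx : qPoch q ((r * (q ^ n)⁻¹) ^ 2) n ≠ 0)
    (hc' : qPoch q (c * (q ^ n)⁻¹) n ≠ 0) (hd' : qPoch q (d * (q ^ n)⁻¹) n ≠ 0)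
    (he' : qPoch q (e * (q ^ n)⁻¹) n ≠ 0) (hf' : qPoch q (f * (q ^ n)⁻¹) n ≠ 0)
    (hc1 : qInf q (a * q / c) ≠ 0) (hd1 : qInf q (a * q / d) ≠ 0) (he1 : qInf q (a * q / e) ≠ 0)
    (hf1 : qInf q (a * q / f) ≠ 0)
    (h₁ : qInf q (b * c * q ^ n / a) ≠ 0) (h₂ : qInf q (b * d * q ^ n / a) ≠ 0)
    (h₃ : qInf q (b * e * q ^ n / a) ≠ 0) (h₄ : qInf q (b * f * q ^ n / a) ≠ 0) :
    rhsSecond q a b c d e f n * (qInf q ((b * q ^ n / r) ^ 2) *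
      (qInf q (b * c * q ^ n / a) * qInf q (b * d * q ^ n / a) * qInf q (b * e * q ^ n / a) *
        qInf q (b * f * q ^ n / a))) =
      (r * (1 - a) * (qPoch q ((r * (q ^ n)⁻¹) ^ 2) n * qInf q (q * q ^ n)) *
        (qPoch q b n * qInf q (a * q ^ (1 - (n : ℤ)) / b)) *
        (qPoch q (c * (q ^ n)⁻¹) n * qInf q (a * q / c)) *
        (qPoch q (d * (q ^ n)⁻¹) n * qInf q (a * q / d)) *
        (qPoch q (e * (q ^ n)⁻¹) n * qInf q (a * q / e)) *
        (qPoch q (f * (q ^ n)⁻¹) n * qInf q (a * q / f)))⁻¹ *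
      jRight q (r * (q ^ n)⁻¹) (b * q ^ n / r) (c / r) (d / r) (e / r) (f / r) := by
  have hQ : q ^ n ≠ 0 := pow_ne_zero _ hq0
  have hb0 : b ≠ 0 := by rintro rfl; simp [hq0, ha] at hbdef
  have hqq := qInf_self_ne_zero hq
  have hqn' : qInf q (q * q ^ n) ≠ 0 := qInf_mul_pow_ne_zero hq hqq n
  have f1 : qInf q ((r * (q ^ n)⁻¹) ^ 2) = qPoch q ((r * (q ^ n)⁻¹) ^ 2) n *
      (a ^ n * qTau q n * qPoch q (q / a) n * ((1 - a) * qInf q (a * q))) := by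
    rw [qInf_eq_qPoch_mul hq _ n, ← qPoch_reverse hq0 ha, ← qInf_succ hq]
    have := qInf_eq_qPoch_mul hq (a * (q ^ n)⁻¹) n
    rw [inv_mul_cancel_right₀ hQ] at this
    rw [← this, ← hr]
    congr 2
    field_simp
  have f2 := qInf_eq_qPoch_mul hq q n
  have e1 : a * q ^ (1 - (n : ℤ)) / b = a * q * (q ^ n)⁻¹ / b := by
    rw [zpow_sub₀ hq0, zpow_one, zpow_natCast]; ring
  have f4 : qInf q (q * (r * (q ^ n)⁻¹) / (b * q ^ n / r)) =
      (a * q * (q ^ n)⁻¹ / b) ^ n * qTau q n * qPoch q (b * q ^ n / a) n *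
        qInf q (a * q * (q ^ n)⁻¹ / b) := by
    have e3 : q * (r * (q ^ n)⁻¹) / (b * q ^ n / r) = a * q * (q ^ n)⁻¹ / b * (q ^ n)⁻¹ := by
      rw [← hr]; field_simp
    have e2 : q / (a * q * (q ^ n)⁻¹ / b) = b * q ^ n / a := by field_simp
    rw [e3, qInf_eq_qPoch_mul hq _ n, inv_mul_cancel_right₀ hQ, qPoch_reverse hq0 (by positivity),
      e2]
  have f5 : qInf q (b * q ^ n / a) = qPoch q (b * q ^ n / a) n *
      qInf q (b * q ^ n / r / (r * (q ^ n)⁻¹)) := by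
    rw [qInf_eq_qPoch_mul hq _ n, ← hr]
    congr 2
    field_simp
  have f6 : ∀ y z : ℂ, q / (y / r * (z / r)) = a * q / (y * z) := fun y z => by
    rw [← hr, div_mul_div_comm, div_div_eq_mul_div]; ring
  have g := fun y (hy : y ≠ 0) => qPoch_reverse hq0 (c := y) hy n
  have ht := qTau_ne_zero hq0 n
  -- The balancing condition gives aq/b = cdef/a. This matches the power from reversing
  -- (aq^{1-2n}/b)_n with those from reversing the factorials of c, d, e, f; the power q^{-n²} is
  -- expressed through `qTau_sq`.
  have hkey : (a * q * (q ^ n)⁻¹ / b) ^ n =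
      c ^ n * d ^ n * e ^ n * f ^ n * qTau q n ^ 2 * q ^ n / a ^ n := by
    have h1 := qTau_sq hq0 n
    have h2 : (a * q * (q ^ n)⁻¹ / b) = c * d * e * f * (q ^ n)⁻¹ / a := by
      field_simp; linear_combination -hbdef
    rw [h2, eq_div_iff (pow_ne_zero _ ha), div_pow, div_mul_cancel₀ _ (pow_ne_zero _ ha)]
    simp only [mul_pow, inv_pow]
    field_simp
    linear_combination -h1
  rw [g c hc] at hc' ⊢
  rw [g d hd] at hd' ⊢
  rw [g e he] at he' ⊢
  rw [g f hf] at hf' ⊢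
  have hc2 := right_ne_zero_of_mul hc'
  have hd2 := right_ne_zero_of_mul hd'
  have he2 := right_ne_zero_of_mul he'
  have hf2 := right_ne_zero_of_mul hf'
  rw [e1] at hab ⊢
  rw [rhsSecond, jRight, f1, f4, f6, f6, f6, f6, f6, f6, hkey]
  simp only [qInfs, qFacs, qFac_natCast, List.map_cons, List.map_nil, List.prod_cons,
    List.prod_nil, mul_one]
  rw [f5, f2]
  generalize qInf q (b * c * q ^ n / a) = A2 at *
  generalize qInf q (b * d * q ^ n / a) = A3 at *
  generalize qInf q (b * e * q ^ n / a) = A4 at *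
  generalize qInf q (b * f * q ^ n / a) = A5 at *
  generalize qInf q (b * q ^ n / r / (r * (q ^ n)⁻¹)) = A6 at *
  generalize qPoch q (b * q ^ n / a) n = A7 at *
  generalize qInf q (a * q / c) = C1 at *
  generalize qInf q (a * q / d) = C2 at *
  generalize qInf q (a * q / e) = C3 at *
  generalize qInf q (a * q / f) = C4 at *
  generalize qInf q (a * q * (q ^ n)⁻¹ / b) = C5 at *
  generalize qPoch q ((r * (q ^ n)⁻¹) ^ 2) n = D5 at *
  generalize qPoch q (q / a) n = D7 at *
  generalize qInf q (q * q ^ n) = D8 at *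
  generalize qPoch q (q / c) n = E1 at *
  generalize qPoch q (q / d) n = E2 at *
  generalize qPoch q (q / e) n = E3 at *
  generalize qPoch q (q / f) n = E4 at *
  generalize qTau q n = T at *
  generalize 1 - a = V at *
  have hcn := pow_ne_zero n hc
  have hdn := pow_ne_zero n hd
  have hen := pow_ne_zero n he
  have hfn := pow_ne_zero n hf
  have han := pow_ne_zero n ha
  generalize c ^ n = cn at *
  generalize d ^ n = dn at *
  generalize e ^ n = en at *
  generalize f ^ n = fn at *
  generalize a ^ n = an at *
  generalize q ^ n = Q at *
  generalize qPoch q q n = G1 at *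
  generalize qPoch q b n = G2 at *
  generalize qInf q (a * q) = G3 at *
  generalize qInf q ((b * Q / r) ^ 2) = G4 at *
  generalize qInf q (a * q / (c * d)) = G5 at *
  generalize qInf q (a * q / (c * e)) = G6 at *
  generalize qInf q (a * q / (c * f)) = G7 at *
  generalize qInf q (a * q / (d * e)) = G8 at *
  generalize qInf q (a * q / (d * f)) = G9 at *
  generalize qInf q (a * q / (e * f)) = G10 at *
  clear g f6 f5 f4 f1 f2 hkey hc' hd' he' hf' e1 hqq
  field_simp

/-- The semi-finite form of Bailey's summation formula. -/
theorem semiSum_eq {q a r b c d e f : ℂ} (hq0 : q ≠ 0) (hq : ‖q‖ < 1)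
    (ha : a ≠ 0) (hc : c ≠ 0) (hd : d ≠ 0) (he : e ≠ 0) (hf : f ≠ 0)
    (hr : r ^ 2 = a) (hb : b = q * a ^ 2 / (c * d * e * f)) {n : ℕ}
    (hsum_nonneg : qInfs q [r, -r, a * q ^ (1 - (n : ℤ)) / b,
      a * q / c, a * q / d, a * q / e, a * q / f] ≠ 0)
    (hsum_neg : qFacs q [q ^ (1 + n) / a, 1 / r, -(1 / r), b, q / c, q / d, q / e, q / f] n ≠ 0)
    (hprod : qInfs q [b * c * q ^ n / a, b * d * q ^ n / a, b * e * q ^ n / a,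
      b * f * q ^ n / a, b ^ 2 * q ^ (1 + 2 * n) / a] ≠ 0)
    (hphi : qInfs q (lowerParams q a r b c d e f n) ≠ 0) :
    (Summable fun k : Set.Ici (-(n : ℤ)) => semiTerm q a r b c d e f n k) ∧
      Summable (phiTerm q (upperParams q a r b c d e f n) (lowerParams q a r b c d e f n) q) ∧
      semiSum q a r b c d e f n = rhsFirst q a r b c d e f n + rhsSecond q a b c d e f n := by
  have hQ : q ^ n ≠ 0 := pow_ne_zero _ hq0
  have hr0 : r ≠ 0 := by rintro rfl; apply ha; rw [← hr]; simp
  have hcdef : c * d * e * f ≠ 0 := by positivity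
  have hbdef : b * (c * d * e * f) = q * a ^ 2 := by rw [hb, div_mul_cancel₀ _ hcdef]
  have hb0 : b ≠ 0 := by rintro rfl; simp [hq0, ha] at hbdef
  rw [qInfs_ne_zero_iff] at hsum_nonneg hprod
  simp only [List.mem_cons, List.not_mem_nil, or_false, forall_eq_or_imp, forall_eq]
    at hsum_nonneg hprod
  simp only [qFacs, qFac_natCast, List.map_cons, List.map_nil, List.prod_cons,
    List.prod_nil, mul_one, ne_eq, mul_eq_zero, not_or] at hsum_neg
  obtain ⟨a1, a2, a3, a4, a5, a6, a7⟩ := hsum_nonneg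
  obtain ⟨b1, b2, b3, b4, b5, b6, b7, b8⟩ := hsum_neg
  obtain ⟨c1, c2, c3, c4, c5⟩ := hprod
  have hphi' := hphi
  rw [qInfs_ne_zero_iff] at hphi'
  simp only [lowerParams, List.mem_cons, List.not_mem_nil, or_false, forall_eq_or_imp,
    forall_eq] at hphi'
  obtain ⟨p1, p2, -⟩ := hphi'
  have ha1 : 1 - a ≠ 0 := by
    have s1 : 1 - r ≠ 0 := fun h => a1 (by rw [qInf_succ hq, h, zero_mul])
    have s2 : 1 - -r ≠ 0 := fun h => a2 (by rw [qInf_succ hq, h, zero_mul])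
    have := mul_ne_zero s1 s2
    intro h; apply this; linear_combination h - hr
  have rev : ∀ y : ℂ, y ≠ 0 → qPoch q (q / y) n ≠ 0 → qPoch q (y * (q ^ n)⁻¹) n ≠ 0 :=
    fun y hy h => by
      rw [qPoch_reverse hq0 hy]
      exact mul_ne_zero (mul_ne_zero (pow_ne_zero _ hy) (qTau_ne_zero hq0 n)) h
  have hc' := rev c hc b5
  have hd' := rev d hd b6
  have he' := rev e he b7
  have hf' := rev f hf b8
  have h4 : qPoch q (q * r * (q ^ n)⁻¹) n ≠ 0 := rev _ (mul_ne_zero hq0 hr0) (by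
    rwa [← div_div, div_self hq0])
  have h5 : qPoch q (q * (-r) * (q ^ n)⁻¹) n ≠ 0 := rev _ (mul_ne_zero hq0 (neg_ne_zero.mpr hr0))
    (by rwa [← div_div, div_self hq0, div_neg])
  have h6 : qPoch q ((r * (q ^ n)⁻¹) ^ 2) n ≠ 0 := by
    have e1 : (r * (q ^ n)⁻¹) ^ 2 = a * (q ^ n)⁻¹ * (q ^ n)⁻¹ := by rw [← hr]; ring
    have e2 : q / (a * (q ^ n)⁻¹) = q ^ (1 + n) / a := by rw [pow_add, pow_one]; field_simp
    rw [e1]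
    exact rev _ (by positivity) (by rwa [e2])
  have hterm := semiTerm_eq hq0 hq hb0 hr0 hr a1 a2 a3 a4 a5 a6 a7 h4 h5 h6 b4 hc' hd' he' hf'
  have hcomp : ∀ m : ℕ, semiTerm q a r b c d e f n (natEquivIci n m) =
      semiTerm q a r b c d e f n ((m : ℤ) - n) := fun m => rfl
  -- The product that accompanies the first series in `jLeft`. The identity is proved after
  -- multiplication by it.
  have hP : qInf q ((b * q ^ n / r) ^ 2) *
      (qInf q (b * c * q ^ n / a) * qInf q (b * d * q ^ n / a) * qInf q (b * e * q ^ n / a) *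
        qInf q (b * f * q ^ n / a)) ≠ 0 := by
    refine mul_ne_zero ?_ (by positivity)
    have s1 : 1 - b * q ^ n / r ≠ 0 := fun h => p1 (by rw [qInf_succ hq, h, zero_mul])
    have s2 : 1 + b * q ^ n / r ≠ 0 := fun h => p2 (by
      rw [qInf_succ hq, sub_neg_eq_add, h, zero_mul])
    have e1 : (b * q ^ n / r) ^ 2 * q = b ^ 2 * q ^ (1 + 2 * n) / a := by
      rw [← hr]; field_simp; ring
    rw [qInf_succ hq, e1]
    refine mul_ne_zero ?_ c5
    have := mul_ne_zero s1 s2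
    intro h; apply this; linear_combination h
  refine ⟨?_, ?_, ?_⟩
  · rw [← (natEquivIci n).summable_iff]
    refine Summable.congr ((summable_jTerm hq (r * (q ^ n)⁻¹) (b * q ^ n / r) (c / r) (d / r)
      (e / r) (f / r)).mul_left _) fun m => ((hcomp m).trans (hterm m)).symm
  · exact Summable.congr ((summable_jTerm hq _ _ _ _ _ _).mul_left _)
      fun m => (phiTerm_eq hq0 hq hb0 hr0 hr hphi m).symm
  · apply mul_right_cancel₀ hP
    rw [add_mul, rhsFirst_mul hq0 hq ha hb0 hr0 hr ha1 b4 a3 h6 hc' hd' he' hf'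
      a4 a5 a6 a7 c1 c2 c3 c4 c5 hphi, rhsSecond_mul hq0 hq ha hc hd he hf hr0 hr hbdef ha1 b4 a3 h6
      hc' hd' he' hf' a4 a5 a6 a7 c1 c2 c3 c4, ← jLeft_eq_jRight hq0 hq (by
        rw [← hr] at hbdef
        field_simp
        linear_combination hbdef)]
    have hS : semiSum q a r b c d e f n = _ := ((natEquivIci n).tsum_eq _).symm.trans
      ((tsum_congr fun m => (hcomp m).trans (hterm m)).trans tsum_mul_left)
    have e1 : ∀ y, b * q ^ n / r * (y / r) = b * y * q ^ n / a := fun y => by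
      rw [← hr]; field_simp
    have e2 : ∀ y, r * (q ^ n)⁻¹ * (y / r) = y * (q ^ n)⁻¹ := fun y => by field_simp
    rw [hS, jLeft]
    simp only [e1, e2]
    rw [jSum, jSum]
    ring

/-! ### Absolute convergence of Bailey's bilateral series -/

theorem qPoch_mul_inv_ne_zero {q : ℂ} (hq0 : q ≠ 0) {y : ℂ} (hy : y ≠ 0) {n : ℕ}
    (h : qPoch q (q / y) n ≠ 0) : qPoch q (y * (q ^ n)⁻¹) n ≠ 0 := by
  rw [qPoch_reverse hq0 hy]
  exact mul_ne_zero (mul_ne_zero (pow_ne_zero _ hy) (qTau_ne_zero hq0 n)) h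

theorem qFac_neg_div_qFac_neg {q : ℂ} (hq0 : q ≠ 0) (y v : ℂ) (m : ℕ) :
    qFac q y (-(m : ℤ)) / qFac q v (-(m : ℤ)) =
      qPoch q (v * (q ^ m)⁻¹) m / qPoch q (y * (q ^ m)⁻¹) m := by
  rw [qFac_neg_natCast hq0, qFac_neg_natCast hq0, inv_div_inv]

theorem qPoch_reverse_div {q : ℂ} (hq0 : q ≠ 0) {y v : ℂ} (hy : y ≠ 0) (hv : v ≠ 0) (m : ℕ) :
    qPoch q (v * (q ^ m)⁻¹) m / qPoch q (y * (q ^ m)⁻¹) m =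
      (v / y) ^ m * (qPoch q (q / v) m / qPoch q (q / y) m) := by
  have := qTau_ne_zero hq0 m
  rw [qPoch_reverse hq0 hy, qPoch_reverse hq0 hv, div_pow, mul_div_mul_comm,
    mul_div_mul_right _ _ this]

theorem vwp_factor {q a r : ℂ} (hq0 : q ≠ 0) (hq : ‖q‖ < 1) (ha : a ≠ 0) (hr : r ^ 2 = a)
    (h₁ : qInf q r ≠ 0) (h₂ : qInf q (-r) ≠ 0) (h₃ : qInf q (1 / r) ≠ 0)
    (h₄ : qInf q (-(1 / r)) ≠ 0) (k : ℤ) :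
    qFac q (q * r) k / qFac q r k * (qFac q (q * -r) k / qFac q (-r) k) =
      (1 - a * (q ^ k) ^ 2) / (1 - a) := by
  have hr0 : r ≠ 0 := by rintro rfl; apply ha; rw [← hr]; simp
  obtain ⟨m, n, rfl⟩ : ∃ m n : ℕ, k = (m : ℤ) - n := ⟨k.toNat, (-k).toNat, by omega⟩
  rw [qFac_mul_div_qFac hq0 hq h₁, qFac_mul_div_qFac hq0 hq h₂, div_mul_div_comm, ← hr]
  · congr 1 <;> ring
  · refine qPoch_mul_inv_ne_zero hq0 (mul_ne_zero hq0 (neg_ne_zero.mpr hr0)) ?_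
    rw [← div_div, div_self hq0, div_neg]
    exact qPoch_ne_zero hq h₄ n
  · refine qPoch_mul_inv_ne_zero hq0 (mul_ne_zero hq0 hr0) ?_
    rw [← div_div, div_self hq0]
    exact qPoch_ne_zero hq h₃ n

theorem one_sub_ne_zero_of_qInf {q a r : ℂ} (hq : ‖q‖ < 1) (hr : r ^ 2 = a)
    (h₁ : qInf q r ≠ 0) (h₂ : qInf q (-r) ≠ 0) : 1 - a ≠ 0 := by
  have s1 : 1 - r ≠ 0 := fun h => h₁ (by rw [qInf_succ hq, h, zero_mul])
  have s2 : 1 - -r ≠ 0 := fun h => h₂ (by rw [qInf_succ hq, h, zero_mul])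
  have := mul_ne_zero s1 s2
  intro h; apply this; linear_combination h - hr

/-- The terms of the series in Bailey's formula. -/
noncomputable abbrev baileyTerm (q a r c d e f : ℂ) : ℤ → ℂ :=
  psiTerm q [q * r, -(q * r), c, d, e, f] [r, -r, a * q / c, a * q / d, a * q / e, a * q / f]
    (q * a ^ 2 / (c * d * e * f))

theorem baileyTerm_eq (q a r c d e f : ℂ) (k : ℤ) :
    baileyTerm q a r c d e f k =
      (qFac q (q * r) k / qFac q r k * (qFac q (q * -r) k / qFac q (-r) k)) *
        (qFac q c k / qFac q (a * q / c) k * (qFac q d k / qFac q (a * q / d) k) *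
          (qFac q e k / qFac q (a * q / e) k) * (qFac q f k / qFac q (a * q / f) k)) *
        (q * a ^ 2 / (c * d * e * f)) ^ k := by
  have e0 : -(q * r) = q * -r := by ring
  simp only [baileyTerm, psiTerm, qFacs, List.map_cons, List.map_nil, List.prod_cons,
    List.prod_nil, mul_one, e0, div_eq_mul_inv, mul_inv]
  ring

/-- A bound for the quotients `(y; q)_k / (aq/y; q)_k`. -/
noncomputable def pairMaj (q a y : ℂ) : ℝ :=
  qMaj q y * (qMaj q (a * q / y) / ‖qInf q (a * q / y)‖) +
    qMaj q (y / a) * (qMaj q (q / y) / ‖qInf q (q / y)‖)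

theorem norm_pos_pair_le {q a y : ℂ} (hq : ‖q‖ < 1) (h : qInf q (a * q / y) ≠ 0) (m : ℕ) :
    ‖qPoch q y m / qPoch q (a * q / y) m‖ ≤ pairMaj q a y := by
  have h0 := fun y => (qMaj_pos q y).le
  rw [div_eq_mul_inv, norm_mul]
  refine (mul_le_mul (norm_qPoch_le hq _ _) (norm_qPoch_inv_le hq _ h _) (norm_nonneg _)
    (h0 _)).trans (le_add_of_nonneg_right ?_)
  exact mul_nonneg (h0 _) (div_nonneg (h0 _) (norm_nonneg _))

theorem norm_neg_pair_le {q a y : ℂ} (hq : ‖q‖ < 1) (h : qInf q (q / y) ≠ 0) (m : ℕ) :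
    ‖qPoch q (y / a) m / qPoch q (q / y) m‖ ≤ pairMaj q a y := by
  have h0 := fun y => (qMaj_pos q y).le
  rw [div_eq_mul_inv, norm_mul]
  refine (mul_le_mul (norm_qPoch_le hq _ _) (norm_qPoch_inv_le hq _ h _) (norm_nonneg _)
    (h0 _)).trans (le_add_of_nonneg_left ?_)
  exact mul_nonneg (h0 _) (div_nonneg (h0 _) (norm_nonneg _))

theorem pairMaj_nonneg (q a y : ℂ) : 0 ≤ pairMaj q a y := by
  have h0 := fun y => (qMaj_pos q y).le
  exact add_nonneg (mul_nonneg (h0 _) (div_nonneg (h0 _) (norm_nonneg _)))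
    (mul_nonneg (h0 _) (div_nonneg (h0 _) (norm_nonneg _)))

/-- A bound for the terms of the series in Bailey's formula, up to a geometric factor. -/
noncomputable def baileyMaj (q a c d e f : ℂ) : ℝ :=
  (1 + ‖a‖) / ‖1 - a‖ * (pairMaj q a c * pairMaj q a d * pairMaj q a e * pairMaj q a f)

theorem baileyMaj_nonneg (q a c d e f : ℂ) : 0 ≤ baileyMaj q a c d e f := by
  have := pairMaj_nonneg q a
  exact mul_nonneg (by positivity)
    (mul_nonneg (mul_nonneg (mul_nonneg (this _) (this _)) (this _)) (this _))

theorem norm_baileyTerm_le {q a r c d e f : ℂ} (hq0 : q ≠ 0) (hq : ‖q‖ < 1)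
    (ha : a ≠ 0) (hc : c ≠ 0) (hd : d ≠ 0) (he : e ≠ 0) (hf : f ≠ 0) (hr : r ^ 2 = a)
    (hpsi : qInfs q [r, -r, 1 / r, -(1 / r), q / c, q / d, q / e, q / f,
      a * q / c, a * q / d, a * q / e, a * q / f] ≠ 0) (k : ℤ) :
    ‖baileyTerm q a r c d e f k‖ ≤
      baileyMaj q a c d e f * ‖q * a ^ 2 / (c * d * e * f)‖ ^ k.natAbs := by
  rw [qInfs_ne_zero_iff] at hpsi
  simp only [List.mem_cons, List.not_mem_nil, or_false, forall_eq_or_imp, forall_eq] at hpsi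
  obtain ⟨h1, h2, h3, h4, c1, d1, e1, f1, c2, d2, e2, f2⟩ := hpsi
  have n1 := one_sub_ne_zero_of_qInf hq hr h1 h2
  have hM := pairMaj_nonneg q a
  have hqm : ∀ m : ℕ, ‖q ^ m‖ ≤ 1 := fun m => by
    rw [norm_pow]; exact pow_le_one₀ (norm_nonneg _) hq.le
  rw [baileyTerm_eq, vwp_factor hq0 hq ha hr h1 h2 h3 h4]
  obtain ⟨m, rfl | rfl⟩ := k.eq_nat_or_neg
  · simp only [qFac_natCast, zpow_natCast, Int.natAbs_natCast, baileyMaj]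
    have p1 : ‖(1 - a * (q ^ m) ^ 2) / (1 - a)‖ ≤ (1 + ‖a‖) / ‖1 - a‖ := by
      rw [norm_div]
      gcongr
      refine (norm_sub_le _ _).trans ?_
      rw [norm_one, norm_mul, norm_pow]
      gcongr
      exact mul_le_of_le_one_right (norm_nonneg _) (pow_le_one₀ (norm_nonneg _) (hqm m))
    have pc := norm_pos_pair_le hq c2 m
    have pd := norm_pos_pair_le hq d2 m
    have pe := norm_pos_pair_le hq e2 m
    have pf := norm_pos_pair_le hq f2 m
    rw [norm_mul, norm_mul, norm_mul, norm_mul, norm_mul, norm_pow]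
    have := hM c
    have := hM d
    have := hM e
    gcongr
  -- For k = -m, reversing the four pairs produces ∏ (aq/y²)^m = (b²q²)^m over y = c, d, e, f. The
  -- very-well-poised factor contributes q^{-2m} and the argument b^{-m}, so b^m is left, and the
  -- terms decay at the same rate as for positive k.
  · have key : (1 - a * (q ^ (-(m : ℤ))) ^ 2) / (1 - a) *
        (qFac q c (-(m : ℤ)) / qFac q (a * q / c) (-(m : ℤ)) *
          (qFac q d (-(m : ℤ)) / qFac q (a * q / d) (-(m : ℤ))) *
          (qFac q e (-(m : ℤ)) / qFac q (a * q / e) (-(m : ℤ))) *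
          (qFac q f (-(m : ℤ)) / qFac q (a * q / f) (-(m : ℤ)))) *
        (q * a ^ 2 / (c * d * e * f)) ^ (-(m : ℤ)) =
        ((q ^ m) ^ 2 - a) / (1 - a) * (qPoch q (c / a) m / qPoch q (q / c) m *
          (qPoch q (d / a) m / qPoch q (q / d) m) * (qPoch q (e / a) m / qPoch q (q / e) m) *
          (qPoch q (f / a) m / qPoch q (q / f) m)) * (q * a ^ 2 / (c * d * e * f)) ^ m := by
      have hp : ∀ y : ℂ, y ≠ 0 → qFac q y (-(m : ℤ)) / qFac q (a * q / y) (-(m : ℤ)) =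
          (a * q / y / y) ^ m * (qPoch q (y / a) m / qPoch q (q / y) m) := fun y hy => by
        have e3 : q / (a * q / y) = y / a := by field_simp
        rw [qFac_neg_div_qFac_neg hq0, qPoch_reverse_div hq0 hy (by positivity), e3]
      rw [hp c hc, hp d hd, hp e he, hp f hf, zpow_neg, zpow_neg, zpow_natCast, zpow_natCast]
      generalize qPoch q (c / a) m / qPoch q (q / c) m = A
      generalize qPoch q (d / a) m / qPoch q (q / d) m = B
      generalize qPoch q (e / a) m / qPoch q (q / e) m = C
      generalize qPoch q (f / a) m / qPoch q (q / f) m = D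
      simp only [div_pow, mul_pow]
      field_simp
      ring
    rw [key, baileyMaj, Int.natAbs_neg, Int.natAbs_natCast]
    have p1 : ‖((q ^ m) ^ 2 - a) / (1 - a)‖ ≤ (1 + ‖a‖) / ‖1 - a‖ := by
      rw [norm_div]
      gcongr
      refine (norm_sub_le _ _).trans ?_
      rw [norm_pow]
      gcongr
      exact pow_le_one₀ (norm_nonneg _) (hqm m)
    have pc := norm_neg_pair_le (a := a) hq c1 m
    have pd := norm_neg_pair_le (a := a) hq d1 m
    have pe := norm_neg_pair_le (a := a) hq e1 m
    have pf := norm_neg_pair_le (a := a) hq f1 m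
    rw [norm_mul, norm_mul, norm_mul, norm_mul, norm_mul, norm_pow]
    have := hM c
    have := hM d
    have := hM e
    gcongr

theorem summable_pow_natAbs {ρ : ℝ} (h0 : 0 ≤ ρ) (h1 : ρ < 1) :
    Summable fun k : ℤ => ρ ^ k.natAbs := by
  have h := summable_geometric_of_lt_one h0 h1
  refine Summable.of_nat_of_neg ?_ ?_ <;> simpa using h

theorem summable_baileyTerm {q a r c d e f : ℂ} (hq0 : q ≠ 0) (hq : ‖q‖ < 1)
    (ha : a ≠ 0) (hc : c ≠ 0) (hd : d ≠ 0) (he : e ≠ 0) (hf : f ≠ 0) (hr : r ^ 2 = a)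
    (hb : ‖q * a ^ 2 / (c * d * e * f)‖ < 1)
    (hpsi : qInfs q [r, -r, 1 / r, -(1 / r), q / c, q / d, q / e, q / f,
      a * q / c, a * q / d, a * q / e, a * q / f] ≠ 0) :
    Summable (baileyTerm q a r c d e f) :=
  Summable.of_norm_bounded ((summable_pow_natAbs (norm_nonneg _) hb).mul_left _)
    (norm_baileyTerm_le hq0 hq ha hc hd he hf hr hpsi)

/-! ### Limit of the semi-finite sum by dominated convergence -/

/-- The quotient of the terms of the semi-finite sum and of Bailey's series. -/
noncomputable def semiRatio (q a b : ℂ) (n : ℕ) (k : ℤ) : ℂ :=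
  qFac q (a * (q ^ n)⁻¹) k / qFac q (a * q / b * (q ^ n)⁻¹) k *
    (qFac q (b * q ^ n) k / qFac q (q * q ^ n) k) * (q / b) ^ k

theorem semiTerm_eq_baileyTerm_mul {q a r b c d e f : ℂ} (hq0 : q ≠ 0) (hb0 : b ≠ 0)
    (hb : b = q * a ^ 2 / (c * d * e * f)) (n : ℕ) (k : ℤ) :
    semiTerm q a r b c d e f n k = baileyTerm q a r c d e f k * semiRatio q a b n k := by
  have e0 : q ^ k = b ^ k * (q / b) ^ k := by rw [← mul_zpow, mul_div_cancel₀ _ hb0]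
  have e1 : a * q ^ (-(n : ℤ)) = a * (q ^ n)⁻¹ := by rw [zpow_neg, zpow_natCast]
  have e2 : a * q ^ (1 - (n : ℤ)) / b = a * q / b * (q ^ n)⁻¹ := by
    rw [zpow_sub₀ hq0, zpow_one, zpow_natCast]; ring
  have e3 : q ^ (1 + n) = q * q ^ n := by rw [pow_add, pow_one]
  have e4 : -(q * r) = q * -r := by ring
  simp only [baileyTerm_eq, ← hb, semiTerm, semiRatio, qFacs, List.map_cons, List.map_nil,
    List.prod_cons, List.prod_nil, mul_one, e0, e1, e2, e3, e4, div_eq_mul_inv, mul_inv]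
  ring

/-- The range 0 ≤ k ≤ n. Reversing the factorials that contain q^{-n} removes the negative powers of
q and the factor (q/b)^k, leaving arguments that are bounded in n and, for fixed k, tend to 0. -/
theorem semiRatio_natCast {q a b : ℂ} (hq0 : q ≠ 0) (ha : a ≠ 0) (hb0 : b ≠ 0) (i k : ℕ) :
    semiRatio q a b (k + i) k = qPoch q (q / a * q ^ i) k / qPoch q (b / a * q ^ i) k *
      (qPoch q (b * q ^ (k + i)) k / qPoch q (q * q ^ (k + i)) k) := by
  have e1 : ∀ y : ℂ, y * (q ^ (k + i))⁻¹ = y * (q ^ i)⁻¹ * (q ^ k)⁻¹ := fun y => by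
    rw [pow_add]; field_simp
  have e2 : q / (a * (q ^ i)⁻¹) = q / a * q ^ i := by field_simp
  have e3 : q / (a * q / b * (q ^ i)⁻¹) = b / a * q ^ i := by field_simp
  have e4 : a * (q ^ i)⁻¹ / (a * q / b * (q ^ i)⁻¹) = (q / b)⁻¹ := by field_simp
  have h1 : (q / b) ^ k ≠ 0 := pow_ne_zero _ (div_ne_zero hq0 hb0)
  simp only [semiRatio, qFac_natCast, zpow_natCast]
  rw [e1, e1, qPoch_reverse_div hq0 (by positivity) (by positivity), e2, e3, e4, inv_pow]
  field_simp

/-- The range k ≥ n. Only the first n factors are reversed, so (q/b)^{k-n} survives. -/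
theorem semiRatio_natCast_add {q a b : ℂ} (hq0 : q ≠ 0) (ha : a ≠ 0) (hb0 : b ≠ 0) (n i : ℕ) :
    semiRatio q a b n (n + i : ℕ) = qPoch q (q / a) n / qPoch q (b / a) n *
      (qPoch q a i / qPoch q (a * q / b) i) *
      (qPoch q (b * q ^ n) (n + i) / qPoch q (q * q ^ n) (n + i)) * (q / b) ^ i := by
  have e3 : q / (a * q / b) = b / a := by field_simp
  have e4 : a / (a * q / b) = (q / b)⁻¹ := by field_simp
  have h1 : (q / b) ^ n ≠ 0 := pow_ne_zero _ (div_ne_zero hq0 hb0)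
  simp only [semiRatio, qFac_natCast, zpow_natCast]
  rw [qPoch_add q (a * (q ^ n)⁻¹), qPoch_add q (a * q / b * (q ^ n)⁻¹),
    inv_mul_cancel_right₀ (pow_ne_zero _ hq0), inv_mul_cancel_right₀ (pow_ne_zero _ hq0),
    mul_div_mul_comm, qPoch_reverse_div hq0 (by positivity) (by positivity), e3, e4, inv_pow,
    pow_add]
  field_simp

theorem semiRatio_neg {q a b : ℂ} (hq0 : q ≠ 0) (ha : a ≠ 0) (hb0 : b ≠ 0) (i m : ℕ) :
    semiRatio q a b (m + i) (-(m : ℤ)) =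
      qPoch q (b / a * q ^ (m + i)) m / qPoch q (q / a * q ^ (m + i)) m *
      (qPoch q (q * q ^ i) m / qPoch q (b * q ^ i) m) := by
  have e1 : ∀ y : ℂ, y * q ^ (m + i) * (q ^ m)⁻¹ = y * q ^ i := fun y => by
    rw [pow_add]; field_simp
  have e2 : q / (a * (q ^ (m + i))⁻¹) = q / a * q ^ (m + i) := by field_simp
  have e3 : q / (a * q / b * (q ^ (m + i))⁻¹) = b / a * q ^ (m + i) := by field_simp
  have e4 : a * q / b * (q ^ (m + i))⁻¹ / (a * (q ^ (m + i))⁻¹) = q / b := by field_simp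
  have h1 : (q / b) ^ m ≠ 0 := pow_ne_zero _ (div_ne_zero hq0 hb0)
  simp only [semiRatio]
  rw [qFac_neg_div_qFac_neg hq0, qFac_neg_div_qFac_neg hq0, e1, e1,
    qPoch_reverse_div hq0 (by positivity) (by positivity), e2, e3, e4, zpow_neg, zpow_natCast]
  field_simp

/-- A bound for the norms of all `1 / (x q^i; q)_k`. -/
noncomputable def qLow (q x : ℂ) : ℝ := qMaj q x * (qMaj q x / ‖qInf q x‖)

theorem qLow_nonneg (q x : ℂ) : 0 ≤ qLow q x :=
  mul_nonneg (qMaj_pos _ _).le (div_nonneg (qMaj_pos _ _).le (norm_nonneg _))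

/-- The reciprocal of (xq^i)_k is (x)_i/(x)_{i+k}, and both parts are bounded uniformly. -/
theorem norm_qPoch_shift_inv_le {q x : ℂ} (hq : ‖q‖ < 1) (h : qInf q x ≠ 0) (i k : ℕ) :
    ‖(qPoch q (x * q ^ i) k)⁻¹‖ ≤ qLow q x := by
  have h1 := qPoch_ne_zero hq h i
  have e : (qPoch q (x * q ^ i) k)⁻¹ = qPoch q x i * (qPoch q x (i + k))⁻¹ := by
    rw [qPoch_add, mul_inv, mul_inv_cancel_left₀ h1]
  rw [e, norm_mul]
  exact mul_le_mul (norm_qPoch_le hq _ _) (norm_qPoch_inv_le hq _ h _) (norm_nonneg _)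
    (qMaj_pos _ _).le

theorem norm_qPoch_shift_div_le {q x y : ℂ} (hq : ‖q‖ < 1) (h : qInf q y ≠ 0) (j i k : ℕ) :
    ‖qPoch q (x * q ^ j) k / qPoch q (y * q ^ i) k‖ ≤ qMaj q x * qLow q y := by
  rw [div_eq_mul_inv, norm_mul]
  exact mul_le_mul ((norm_qPoch_le hq _ _).trans (qMaj_le_qMaj hq (norm_mul_pow_le hq _ _)))
    (norm_qPoch_shift_inv_le hq h _ _) (norm_nonneg _) (qMaj_pos _ _).le

/-- For |k| ≤ n the ratio is bounded. For k = n + i it is at most a constant times |q/b|^i, and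
|b|^{n+i}|q/b|^i = |b|^n|q|^i ≤ max(|b|, |q|)^k. The condition on b/a keeps (b/a)_∞ and (aq/b)_∞
away from zero. -/
theorem exists_semiRatio_bound {q a b : ℂ} (hq0 : q ≠ 0) (hq : ‖q‖ < 1) (ha : a ≠ 0)
    (hb0 : b ≠ 0) (hb1 : ‖b‖ < 1) (hab : ∀ m : ℤ, b ≠ a * q ^ m) :
    ∃ C : ℝ, 0 ≤ C ∧ ∀ᶠ n : ℕ in atTop, ∀ k : ℤ, -(n : ℤ) ≤ k →
      ‖b‖ ^ k.natAbs * ‖semiRatio q a b n k‖ ≤ C * max ‖b‖ ‖q‖ ^ k.natAbs := by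
  have h0 := fun x => (qMaj_pos q x).le
  have h1 := qLow_nonneg q
  have hba : qInf q (b / a) ≠ 0 := qInf_ne_zero_of_forall_zpow hq fun m hm => hab m (by
    rw [← hm]; field_simp)
  have hqab : qInf q (a * q / b) ≠ 0 := qInf_ne_zero_of_forall_zpow hq fun m hm => hab (1 - m) (by
    rw [zpow_sub₀ hq0, ← hm]; field_simp)
  have hb : qInf q b ≠ 0 := qInf_ne_zero_of_norm_lt_one hq hb1
  have hqq := qInf_self_ne_zero hq
  -- (q/a)_∞ may vanish, so the argument is first shifted into the unit disc. This is why the bound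
  -- is claimed only for large n.
  obtain ⟨N, hN, -⟩ := exists_norm_mul_pow_lt_one hq (q / a) 0
  have hN' := qInf_ne_zero_of_norm_lt_one hq hN
  have nn : ∀ x y, 0 ≤ qMaj q x * qLow q y := fun x y => mul_nonneg (h0 _) (h1 _)
  set C₁ := qMaj q (q / a) * qLow q (b / a) * (qMaj q b * qLow q q) with hC₁
  set C₂ := qMaj q (q / a) * qLow q (b / a) * (qMaj q a * qLow q (a * q / b)) *
    (qMaj q b * qLow q q) with hC₂
  set C₃ := qMaj q (b / a) * qLow q (q / a * q ^ N) * (qMaj q q * qLow q b) with hC₃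
  have nC₁ : 0 ≤ C₁ := mul_nonneg (nn _ _) (nn _ _)
  have nC₂ : 0 ≤ C₂ := mul_nonneg (mul_nonneg (nn _ _) (nn _ _)) (nn _ _)
  have nC₃ : 0 ≤ C₃ := mul_nonneg (nn _ _) (nn _ _)
  refine ⟨C₁ + C₂ + C₃, by positivity, ?_⟩
  filter_upwards [eventually_ge_atTop N] with n hn k hk
  have hmul : ∀ {m : ℕ} {x C : ℝ}, 0 ≤ C → C ≤ C₁ + C₂ + C₃ → x ≤ C →
      ‖b‖ ^ m * x ≤ (C₁ + C₂ + C₃) * max ‖b‖ ‖q‖ ^ m := by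
    intro m x C hC hC' hx
    rw [mul_comm]
    exact mul_le_mul (hx.trans hC') (pow_le_pow_left₀ (norm_nonneg _) (le_max_left _ _) _)
      (by positivity) (hC.trans hC')
  obtain ⟨m, rfl | rfl⟩ := k.eq_nat_or_neg
  · rw [Int.natAbs_natCast]
    rcases le_total m n with hmn | hmn
    · obtain ⟨i, rfl⟩ := Nat.exists_eq_add_of_le hmn
      refine hmul nC₁ (by linarith) ?_
      rw [semiRatio_natCast hq0 ha hb0, norm_mul]
      exact mul_le_mul (norm_qPoch_shift_div_le hq hba _ _ _)
        (norm_qPoch_shift_div_le hq hqq _ _ _) (norm_nonneg _) (nn _ _)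
    · obtain ⟨i, rfl⟩ := Nat.exists_eq_add_of_le hmn
      rw [semiRatio_natCast_add hq0 ha hb0, norm_mul]
      have p1 := norm_qPoch_shift_div_le (x := q / a) hq hba 0 0 n
      have p2 := norm_qPoch_shift_div_le (x := a) hq hqab 0 0 i
      have p3 := norm_qPoch_shift_div_le (x := b) hq hqq n n (n + i)
      simp only [pow_zero, mul_one] at p1 p2
      have p4 : ‖qPoch q (q / a) n / qPoch q (b / a) n *
          (qPoch q a i / qPoch q (a * q / b) i) *
          (qPoch q (b * q ^ n) (n + i) / qPoch q (q * q ^ n) (n + i))‖ ≤ C₂ := by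
        rw [norm_mul, norm_mul]
        exact mul_le_mul (mul_le_mul p1 p2 (norm_nonneg _) (nn _ _)) p3 (norm_nonneg _)
          (mul_nonneg (nn _ _) (nn _ _))
      have p5 : ‖b‖ ^ (n + i) * ‖(q / b) ^ i‖ = ‖b‖ ^ n * ‖q‖ ^ i := by
        have := norm_ne_zero_iff.mpr hb0
        rw [norm_pow, norm_div, div_pow, pow_add]; field_simp
      have p6 : ‖b‖ ^ n * ‖q‖ ^ i ≤ max ‖b‖ ‖q‖ ^ (n + i) := by
        rw [pow_add]
        gcongr
        · exact le_max_left _ _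
        · exact le_max_right _ _
      calc _ = ‖qPoch q (q / a) n / qPoch q (b / a) n *
          (qPoch q a i / qPoch q (a * q / b) i) *
          (qPoch q (b * q ^ n) (n + i) / qPoch q (q * q ^ n) (n + i))‖ *
            (‖b‖ ^ (n + i) * ‖(q / b) ^ i‖) := by ring
        _ ≤ (C₁ + C₂ + C₃) * max ‖b‖ ‖q‖ ^ (n + i) := by
          rw [p5]
          exact mul_le_mul (p4.trans (by linarith)) p6 (by positivity) (by positivity)
  · rw [Int.natAbs_neg, Int.natAbs_natCast]
    obtain ⟨i, rfl⟩ := Nat.exists_eq_add_of_le (show m ≤ n by omega)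
    refine hmul nC₃ (by linarith) ?_
    obtain ⟨j, hj⟩ := Nat.exists_eq_add_of_le hn
    have e1 : q / a * q ^ (m + i) = q / a * q ^ N * q ^ j := by rw [hj, pow_add]; ring
    rw [semiRatio_neg hq0 ha hb0, norm_mul, e1]
    exact mul_le_mul (norm_qPoch_shift_div_le hq hN' _ _ _)
      (norm_qPoch_shift_div_le hq hb _ _ _) (norm_nonneg _) (nn _ _)

theorem tendsto_qPoch_mul_pow {q : ℂ} (hq : ‖q‖ < 1) (x : ℂ) (k : ℕ) :
    Tendsto (fun n : ℕ => qPoch q (x * q ^ n) k) atTop (𝓝 1) := by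
  have h1 : Tendsto (fun k : ℕ => x * q ^ k) atTop (𝓝 0) := by
    simpa using (tendsto_pow_atTop_nhds_zero_of_norm_lt_one hq).const_mul x
  have := ((continuous_qPoch q k).tendsto 0).comp h1
  simpa [qPoch] using! this

theorem tendsto_semiRatio {q a b : ℂ} (hq0 : q ≠ 0) (hq : ‖q‖ < 1) (ha : a ≠ 0) (hb0 : b ≠ 0)
    (k : ℤ) : Tendsto (fun n => semiRatio q a b n k) atTop (𝓝 1) := by
  have h := fun x m => tendsto_qPoch_mul_pow hq x m
  obtain ⟨m, rfl | rfl⟩ := k.eq_nat_or_neg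
  · refine (tendsto_add_atTop_iff_nat m).mp ?_
    have h' := fun x => (h x m).comp (tendsto_add_atTop_nat m)
    have := ((h (q / a) m).div (h (b / a) m) one_ne_zero).mul
      ((h' b).div (h' q) one_ne_zero)
    simp only [div_one, mul_one] at this
    refine this.congr fun n => ?_
    rw [add_comm n m, semiRatio_natCast hq0 ha hb0, add_comm m n]
    rfl
  · refine (tendsto_add_atTop_iff_nat m).mp ?_
    have h' := fun x => (h x m).comp (tendsto_add_atTop_nat m)
    have := ((h' (b / a)).div (h' (q / a)) one_ne_zero).mul
      ((h q m).div (h b m) one_ne_zero)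
    simp only [div_one, mul_one] at this
    refine this.congr fun n => ?_
    rw [add_comm n m, semiRatio_neg hq0 ha hb0, add_comm m n]
    rfl

/-- The sums are extended by zero to all integers. The terms converge to those of Bailey's series
and are dominated by a multiple of max(|b|, |q|)^{|k|}. -/
theorem tendsto_semiSum {q a r b c d e f : ℂ} (hq0 : q ≠ 0) (hq : ‖q‖ < 1)
    (ha : a ≠ 0) (hc : c ≠ 0) (hd : d ≠ 0) (he : e ≠ 0) (hf : f ≠ 0) (hr : r ^ 2 = a)
    (hb : b = q * a ^ 2 / (c * d * e * f)) (hb1 : ‖b‖ < 1) (hab : ∀ m : ℤ, b ≠ a * q ^ m)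
    (hpsi : qInfs q [r, -r, 1 / r, -(1 / r), q / c, q / d, q / e, q / f,
      a * q / c, a * q / d, a * q / e, a * q / f] ≠ 0) :
    Tendsto (semiSum q a r b c d e f) atTop (𝓝 (∑' k, baileyTerm q a r c d e f k)) := by
  have hb0 : b ≠ 0 := by rw [hb]; positivity
  obtain ⟨C, hC, hbound⟩ := exists_semiRatio_bound hq0 hq ha hb0 hb1 hab
  have esum : semiSum q a r b c d e f = fun n : ℕ => ∑' k : ℤ, (Set.Ici (-(n : ℤ))).indicator
      (semiTerm q a r b c d e f n) k := by
    funext n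
    exact tsum_subtype (Set.Ici (-(n : ℤ))) (semiTerm q a r b c d e f n)
  rw [esum]
  refine tendsto_tsum_of_dominated_convergence
    (bound := fun k => baileyMaj q a c d e f * (C * max ‖b‖ ‖q‖ ^ k.natAbs))
    (((summable_pow_natAbs (le_max_of_le_left (norm_nonneg _)) (max_lt hb1 hq)).mul_left
      _).mul_left _) (fun k => ?_) ?_
  · have h1 := (tendsto_semiRatio hq0 hq ha hb0 k).const_mul (baileyTerm q a r c d e f k)
    rw [mul_one] at h1
    refine h1.congr' ?_
    filter_upwards [eventually_ge_atTop k.natAbs] with n hn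
    rw [Set.indicator_of_mem (by simp only [Set.mem_Ici]; omega),
      semiTerm_eq_baileyTerm_mul hq0 hb0 hb]
  · filter_upwards [hbound] with n hn k
    by_cases hk : k ∈ Set.Ici (-(n : ℤ))
    · rw [Set.indicator_of_mem hk, semiTerm_eq_baileyTerm_mul hq0 hb0 hb, norm_mul]
      have h1 := norm_baileyTerm_le hq0 hq ha hc hd he hf hr hpsi k
      rw [← hb] at h1
      calc _ ≤ baileyMaj q a c d e f * ‖b‖ ^ k.natAbs * ‖semiRatio q a b n k‖ :=
            mul_le_mul_of_nonneg_right h1 (norm_nonneg _)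
        _ = baileyMaj q a c d e f * (‖b‖ ^ k.natAbs * ‖semiRatio q a b n k‖) := by ring
        _ ≤ _ := mul_le_mul_of_nonneg_left (hn k hk) (baileyMaj_nonneg q a c d e f)
    · rw [Set.indicator_of_notMem hk, norm_zero]
      exact mul_nonneg (baileyMaj_nonneg q a c d e f) (by positivity)

/-! ### Limits of the two terms on the right-hand side -/

theorem tendsto_qInf_comp {q : ℂ} (hq : ‖q‖ < 1) {α : Type*} {l : Filter α} {u : α → ℂ} {x : ℂ}
    (h : Tendsto u l (𝓝 x)) : Tendsto (fun n => qInf q (u n)) l (𝓝 (qInf q x)) :=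
  ((continuous_qInf hq).tendsto x).comp h

theorem tendsto_qInfs_nil (q : ℂ) {α : Type*} {l : Filter α} :
    Tendsto (fun _ : α => qInfs q []) l (𝓝 (qInfs q [])) := tendsto_const_nhds

theorem tendsto_qInfs_cons {q : ℂ} (hq : ‖q‖ < 1) {α : Type*} {l : Filter α} {u : α → ℂ} {x : ℂ}
    {us : α → List ℂ} {xs : List ℂ} (h : Tendsto u l (𝓝 x))
    (hs : Tendsto (fun n => qInfs q (us n)) l (𝓝 (qInfs q xs))) :
    Tendsto (fun n => qInfs q (u n :: us n)) l (𝓝 (qInfs q (x :: xs))) := by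
  simpa [qInfs] using (tendsto_qInf_comp hq h).mul hs

theorem tendsto_qFacs {q : ℂ} (hq : ‖q‖ < 1) (xs : List ℂ) :
    Tendsto (fun n : ℕ => qFacs q xs n) atTop (𝓝 (qInfs q xs)) := by
  induction xs with
  | nil => simp [qFacs, qInfs]
  | cons x xs ih => simpa [qFacs, qInfs, qFac_natCast] using (tendsto_qPoch hq x).mul ih

theorem tendsto_mul_pow_div {q : ℂ} (hq : ‖q‖ < 1) (x y : ℂ) :
    Tendsto (fun n : ℕ => x * q ^ n / y) atTop (𝓝 0) := by
  simpa using ((tendsto_pow_atTop_nhds_zero_of_norm_lt_one hq).const_mul x).div_const y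

theorem tendsto_mul_pow_one_add_div {q : ℂ} (hq : ‖q‖ < 1) (x y : ℂ) :
    Tendsto (fun n : ℕ => x * q ^ (1 + n) / y) atTop (𝓝 0) := by
  simp only [add_comm 1]
  exact (tendsto_mul_pow_div hq x y).comp (tendsto_add_atTop_nat 1)

theorem tendsto_mul_pow_two_mul_div {q : ℂ} (hq : ‖q‖ < 1) (x y : ℂ) :
    Tendsto (fun n : ℕ => x * q ^ (1 + 2 * n) / y) atTop (𝓝 0) :=
  (tendsto_mul_pow_one_add_div hq x y).comp (tendsto_id.const_mul_atTop' two_pos)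

theorem tendsto_lowerParams {q a r b c d e f : ℂ} (hq : ‖q‖ < 1) :
    Tendsto (fun n => qInfs q (lowerParams q a r b c d e f n)) atTop (𝓝 1) := by
  have h : Tendsto (fun n => qInfs q (lowerParams q a r b c d e f n)) atTop
      (𝓝 (qInfs q [0, -0, 0, 0, 0, 0, 0])) := by
    unfold lowerParams
    have h1 := tendsto_mul_pow_one_add_div hq b
    exact tendsto_qInfs_cons hq (tendsto_mul_pow_div hq b r) (tendsto_qInfs_cons hq
      (tendsto_mul_pow_div hq b r).neg (tendsto_qInfs_cons hq (tendsto_mul_pow_two_mul_div hq b a)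
      (tendsto_qInfs_cons hq (h1 c) (tendsto_qInfs_cons hq (h1 d) (tendsto_qInfs_cons hq (h1 e)
      (tendsto_qInfs_cons hq (h1 f) (tendsto_qInfs_nil q)))))))
  simpa [qInfs] using h

theorem tendsto_denominators {q a b c d e f : ℂ} (hq : ‖q‖ < 1) :
    Tendsto (fun n : ℕ => qInfs q [b * c * q ^ n / a, b * d * q ^ n / a, b * e * q ^ n / a,
      b * f * q ^ n / a, b ^ 2 * q ^ (1 + 2 * n) / a]) atTop (𝓝 1) := by
  have h1 := fun y => tendsto_mul_pow_div hq y a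
  have h : Tendsto (fun n : ℕ => qInfs q [b * c * q ^ n / a, b * d * q ^ n / a, b * e * q ^ n / a,
      b * f * q ^ n / a, b ^ 2 * q ^ (1 + 2 * n) / a]) atTop (𝓝 (qInfs q [0, 0, 0, 0, 0])) :=
    tendsto_qInfs_cons hq (h1 _) (tendsto_qInfs_cons hq (h1 _) (tendsto_qInfs_cons hq (h1 _)
      (tendsto_qInfs_cons hq (h1 _) (tendsto_qInfs_cons hq (tendsto_mul_pow_two_mul_div hq _ a)
      (tendsto_qInfs_nil q)))))
  simpa [qInfs] using h

theorem tendsto_rhsSecond {q a b c d e f : ℂ} (hq : ‖q‖ < 1) (hb1 : ‖b‖ < 1)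
    (hb : b = q * a ^ 2 / (c * d * e * f))
    (h : qInfs q [q / c, q / d, q / e, q / f,
      a * q / c, a * q / d, a * q / e, a * q / f] ≠ 0) :
    Tendsto (rhsSecond q a b c d e f) atTop (𝓝 (baileyProduct q a c d e f)) := by
  rw [qInfs_ne_zero_iff] at h
  simp only [List.mem_cons, List.not_mem_nil, or_false, forall_eq_or_imp, forall_eq] at h
  obtain ⟨c1, d1, e1, f1, c2, d2, e2, f2⟩ := h
  have hbi := qInf_ne_zero_of_norm_lt_one hq hb1
  have h1 := fun y => tendsto_mul_pow_div hq y a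
  have hc : ∀ x : ℂ, Tendsto (fun _ : ℕ => x) atTop (𝓝 x) := fun x => tendsto_const_nhds
  have t1 : Tendsto (fun n : ℕ => qInfs q [a * q, a * q / (c * d), a * q / (c * e),
      a * q / (c * f), a * q / (d * e), a * q / (d * f), a * q / (e * f), b * q ^ n / a]) atTop
      (𝓝 (qInfs q [a * q, a * q / (c * d), a * q / (c * e),
      a * q / (c * f), a * q / (d * e), a * q / (d * f), a * q / (e * f), 0])) :=
    tendsto_qInfs_cons hq (hc _) (tendsto_qInfs_cons hq (hc _) (tendsto_qInfs_cons hq (hc _)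
    (tendsto_qInfs_cons hq (hc _) (tendsto_qInfs_cons hq (hc _) (tendsto_qInfs_cons hq (hc _)
    (tendsto_qInfs_cons hq (hc _) (tendsto_qInfs_cons hq (h1 b) (tendsto_qInfs_nil q))))))))
  have t2 : Tendsto (fun n : ℕ => qInfs q [a * q / c, a * q / d, a * q / e, a * q / f,
      b * c * q ^ n / a, b * d * q ^ n / a, b * e * q ^ n / a, b * f * q ^ n / a]) atTop
      (𝓝 (qInfs q [a * q / c, a * q / d, a * q / e, a * q / f, 0, 0, 0, 0])) :=
    tendsto_qInfs_cons hq (hc _) (tendsto_qInfs_cons hq (hc _) (tendsto_qInfs_cons hq (hc _)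
    (tendsto_qInfs_cons hq (hc _) (tendsto_qInfs_cons hq (h1 _) (tendsto_qInfs_cons hq (h1 _)
    (tendsto_qInfs_cons hq (h1 _) (tendsto_qInfs_cons hq (h1 _) (tendsto_qInfs_nil q))))))))
  have t3 := (t1.div t2 (by simp [qInfs, c2, d2, e2, f2])).mul
    ((tendsto_qFacs hq [q, q / a]).div (tendsto_qFacs hq [b, q / c, q / d, q / e, q / f])
      (by simp [qInfs, hbi, c1, d1, e1, f1]))
  have e3 : baileyProduct q a c d e f = qInfs q [a * q, a * q / (c * d), a * q / (c * e),
      a * q / (c * f), a * q / (d * e), a * q / (d * f), a * q / (e * f), 0] /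
      qInfs q [a * q / c, a * q / d, a * q / e, a * q / f, 0, 0, 0, 0] *
      (qInfs q [q, q / a] / qInfs q [b, q / c, q / d, q / e, q / f]) := by
    simp only [baileyProduct, ← hb, qInfs, List.map_cons, List.map_nil, List.prod_cons,
      List.prod_nil, qInf_zero, mul_one, div_eq_mul_inv, mul_inv]
    ring
  rw [e3]
  exact t3

/-- A parameter may tend to infinity, as rq^{-n} does in `exists_phi_bound`. Only the combinations
xy and xq/y have to converge. -/
theorem tendsto_jMaj {q : ℂ} {l : Filter ℕ} {x y₁ y₂ y₃ y₄ y₅ : ℕ → ℂ} (hx : Tendsto x l (𝓝 0))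
    (h : ∀ y ∈ [y₁, y₂, y₃, y₄, y₅], (∃ z, Tendsto (fun n => x n * y n) l (𝓝 z)) ∧
      ∃ z, Tendsto (fun n => x n * q / y n) l (𝓝 z)) :
    ∃ C, Tendsto (fun n => jMaj q (x n) (y₁ n) (y₂ n) (y₃ n) (y₄ n) (y₅ n)) l (𝓝 C) := by
  simp only [List.mem_cons, List.not_mem_nil, or_false, forall_eq_or_imp, forall_eq] at h
  obtain ⟨h₁, h₂, h₃, h₄, h₅⟩ := h
  have hm : ∀ {u : ℕ → ℂ} {z : ℂ}, Tendsto u l (𝓝 z) →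
      Tendsto (fun n => qMaj q (u n)) l (𝓝 (qMaj q z)) := fun h =>
    ((continuous_qMaj q).tendsto _).comp h
  have key : ∀ y : ℕ → ℂ, ((∃ z, Tendsto (fun n => x n * y n) l (𝓝 z)) ∧
      ∃ z, Tendsto (fun n => x n * q / y n) l (𝓝 z)) → ∃ C,
      Tendsto (fun n => qMaj q (x n * y n) * qMaj q (x n * q / y n)) l (𝓝 C) := by
    rintro y ⟨⟨z, hz⟩, ⟨z', hz'⟩⟩
    exact ⟨_, (hm hz).mul (hm hz')⟩
  obtain ⟨_, k₁⟩ := key y₁ h₁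
  obtain ⟨_, k₂⟩ := key y₂ h₂
  obtain ⟨_, k₃⟩ := key y₃ h₃
  obtain ⟨_, k₄⟩ := key y₄ h₄
  obtain ⟨_, k₅⟩ := key y₅ h₅
  exact ⟨_, (((hx.norm.pow 2).const_add 1).mul ((hm (hx.pow 2)).const_mul _)).mul
    ((((k₁.mul k₂).mul k₃).mul k₄).mul k₅)⟩

theorem exists_phi_bound {q a r b c d e f : ℂ} (hq0 : q ≠ 0) (hq : ‖q‖ < 1) (hb0 : b ≠ 0)
    (ha : a ≠ 0) (hr : r ^ 2 = a) :
    ∃ C, ∀ᶠ n in atTop,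
      ‖phi q (upperParams q a r b c d e f n) (lowerParams q a r b c d e f n) q‖ ≤ C := by
  have hr0 : r ≠ 0 := by rintro rfl; apply ha; rw [← hr]; simp
  have h1 := fun y => tendsto_mul_pow_div hq y a
  have h2 := tendsto_mul_pow_one_add_div hq b
  have hx := tendsto_mul_pow_div hq b r
  have hpair : ∀ y : ℂ, (∃ z, Tendsto (fun n : ℕ => b * q ^ n / r * (y / r)) atTop (𝓝 z)) ∧
      ∃ z, Tendsto (fun n : ℕ => b * q ^ n / r * q / (y / r)) atTop (𝓝 z) := fun y =>
    ⟨⟨_, hx.mul_const _⟩, ⟨_, (hx.mul_const q).div_const _⟩⟩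
  have h0 : (∃ z, Tendsto (fun n : ℕ => b * q ^ n / r * (r * (q ^ n)⁻¹)) atTop (𝓝 z)) ∧
      ∃ z, Tendsto (fun n : ℕ => b * q ^ n / r * q / (r * (q ^ n)⁻¹)) atTop (𝓝 z) := by
    refine ⟨⟨b, tendsto_const_nhds.congr fun n => ?_⟩,
      ⟨0, (tendsto_mul_pow_two_mul_div hq b a).congr fun n => ?_⟩⟩
    · have := pow_ne_zero n hq0
      field_simp
    · rw [← hr]; field_simp; ring
  obtain ⟨C, hC⟩ := tendsto_jMaj (q := q) (y₁ := fun n => r * (q ^ n)⁻¹) (y₂ := fun _ => c / r)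
    (y₃ := fun _ => d / r) (y₄ := fun _ => e / r) (y₅ := fun _ => f / r) hx (by
      simp only [List.mem_cons, List.not_mem_nil, or_false, forall_eq_or_imp, forall_eq]
      exact ⟨h0, hpair c, hpair d, hpair e, hpair f⟩)
  have hi : ∀ {u : ℕ → ℂ}, Tendsto u atTop (𝓝 0) →
      Tendsto (fun n => qInf q (u n)) atTop (𝓝 1) := fun h => by
    simpa using tendsto_qInf_comp hq h
  have hD : Tendsto (fun n : ℕ => (1 - (b * q ^ n / r) ^ 2) * qInf q q *
      qInf q (b * q ^ (1 + 2 * n) / a) * qInf q (b * q ^ (1 + n) / c) *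
      qInf q (b * q ^ (1 + n) / d) * qInf q (b * q ^ (1 + n) / e) *
      qInf q (b * q ^ (1 + n) / f)) atTop (𝓝 ((1 - 0 ^ 2) * qInf q q * 1 * 1 * 1 * 1 * 1)) :=
    (((((((hx.pow 2).const_sub 1).mul_const _).mul
      (hi (tendsto_mul_pow_two_mul_div hq b a))).mul (hi (h2 c))).mul (hi (h2 d))).mul
      (hi (h2 e))).mul (hi (h2 f))
  obtain ⟨C', hDC⟩ : ∃ C', Tendsto _ atTop (𝓝 C') := ⟨_, ((hD.inv₀ (by simpa using qInf_self_ne_zero hq)).norm).mul (hC.mul_const (1 - ‖q‖)⁻¹)⟩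
  refine ⟨C' + 1, ?_⟩
  filter_upwards [hDC.eventually_le_const (lt_add_one C'),
    (tendsto_lowerParams (a := a) (r := r) (b := b) (c := c) (d := d) (e := e) (f := f)
      hq).eventually_ne one_ne_zero] with n hn hphi
  refine le_trans ?_ hn
  have hx0 : b * q ^ n / r ≠ 0 := div_ne_zero (mul_ne_zero hb0 (pow_ne_zero _ hq0)) hr0
  have hj := norm_jSum_le hq (b * q ^ n / r) (r * (q ^ n)⁻¹) (c / r) (d / r) (e / r) (f / r)
  rw [phi_eq hq0 hq hb0 hr0 hr hphi]
  have e1 : b * q ^ n / r * (1 - (b * q ^ n / r) ^ 2) * qInf q q *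
      qInf q (b * q ^ (1 + 2 * n) / a) * qInf q (b * q ^ (1 + n) / c) *
      qInf q (b * q ^ (1 + n) / d) * qInf q (b * q ^ (1 + n) / e) *
      qInf q (b * q ^ (1 + n) / f) = b * q ^ n / r * ((1 - (b * q ^ n / r) ^ 2) * qInf q q *
      qInf q (b * q ^ (1 + 2 * n) / a) * qInf q (b * q ^ (1 + n) / c) *
      qInf q (b * q ^ (1 + n) / d) * qInf q (b * q ^ (1 + n) / e) *
      qInf q (b * q ^ (1 + n) / f)) := by ring
  rw [e1, mul_inv, norm_mul, norm_mul, norm_inv (b * q ^ n / r)]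
  have hx0' := norm_ne_zero_iff.mpr hx0
  -- The normalisation divides by x = bq^n/r, which tends to 0. The bound for `jSum` contains the
  -- factor |x|, so the two cancel.
  refine (mul_le_mul_of_nonneg_left hj (by positivity)).trans (le_of_eq ?_)
  generalize ‖b * q ^ n / r‖ = X at *
  field_simp

/-- The factor b^{n+1} tends to 0, the products converge and the series stays bounded. The condition
on b/a gives (aq/b)_∞ ≠ 0 and (b/a)_∞ ≠ 0, so the limits of the denominators are nonzero. -/
theorem tendsto_rhsFirst {q a r b c d e f : ℂ} (hq0 : q ≠ 0) (hq : ‖q‖ < 1) (hb1 : ‖b‖ < 1)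
    (ha : a ≠ 0) (hb0 : b ≠ 0) (hr : r ^ 2 = a) (hab : ∀ m : ℤ, b ≠ a * q ^ m)
    (h : qInfs q [a * q / c, a * q / d, a * q / e, a * q / f] ≠ 0) :
    Tendsto (rhsFirst q a r b c d e f) atTop (𝓝 0) := by
  rw [qInfs_ne_zero_iff] at h
  simp only [List.mem_cons, List.not_mem_nil, or_false, forall_eq_or_imp, forall_eq] at h
  obtain ⟨c2, d2, e2, f2⟩ := h
  have hba : qInf q (b / a) ≠ 0 := qInf_ne_zero_of_forall_zpow hq fun m hm => hab m (by
    rw [← hm]; field_simp)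
  have hqab : qInf q (a * q / b) ≠ 0 := qInf_ne_zero_of_forall_zpow hq fun m hm => hab (1 - m) (by
    rw [zpow_sub₀ hq0, ← hm]; field_simp)
  have hbi := qInf_ne_zero_of_norm_lt_one hq hb1
  obtain ⟨C, hC⟩ := exists_phi_bound (c := c) (d := d) (e := e) (f := f) hq0 hq hb0 ha hr
  have h1 := fun y => tendsto_mul_pow_div hq y a
  have h2 := tendsto_mul_pow_one_add_div hq b
  have h3 := fun y => tendsto_mul_pow_two_mul_div hq y a
  have hc : ∀ x : ℂ, Tendsto (fun _ : ℕ => x) atTop (𝓝 x) := fun x => tendsto_const_nhds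
  have t1 : Tendsto (fun n : ℕ => qInfs q [a * q, c, d, e, f, b * q ^ (1 + 2 * n) / a,
      b * q ^ (1 + n) / c, b * q ^ (1 + n) / d, b * q ^ (1 + n) / e, b * q ^ (1 + n) / f]) atTop
      (𝓝 (qInfs q [a * q, c, d, e, f, 0, 0, 0, 0, 0])) :=
    tendsto_qInfs_cons hq (hc _) (tendsto_qInfs_cons hq (hc _) (tendsto_qInfs_cons hq (hc _)
    (tendsto_qInfs_cons hq (hc _) (tendsto_qInfs_cons hq (hc _) (tendsto_qInfs_cons hq (h3 b)
    (tendsto_qInfs_cons hq (h2 _) (tendsto_qInfs_cons hq (h2 _) (tendsto_qInfs_cons hq (h2 _)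
    (tendsto_qInfs_cons hq (h2 _) (tendsto_qInfs_nil q))))))))))
  have t2 : Tendsto (fun n : ℕ => qInfs q [a * q / b, a * q / c, a * q / d, a * q / e, a * q / f,
      b * c * q ^ n / a, b * d * q ^ n / a, b * e * q ^ n / a, b * f * q ^ n / a,
      b ^ 2 * q ^ (1 + 2 * n) / a]) atTop
      (𝓝 (qInfs q [a * q / b, a * q / c, a * q / d, a * q / e, a * q / f, 0, 0, 0, 0, 0])) :=
    tendsto_qInfs_cons hq (hc _) (tendsto_qInfs_cons hq (hc _) (tendsto_qInfs_cons hq (hc _)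
    (tendsto_qInfs_cons hq (hc _) (tendsto_qInfs_cons hq (hc _) (tendsto_qInfs_cons hq (h1 _)
    (tendsto_qInfs_cons hq (h1 _) (tendsto_qInfs_cons hq (h1 _) (tendsto_qInfs_cons hq (h1 _)
    (tendsto_qInfs_cons hq (h3 _) (tendsto_qInfs_nil q))))))))))
  have t3 := (tendsto_qFacs hq [q, q / a]).div (tendsto_qFacs hq [b, b / a])
    (by simp [qInfs, hbi, hba])
  have t4 : Tendsto (fun n : ℕ => b ^ (n + 1) / a) atTop (𝓝 0) := by
    simpa using ((tendsto_pow_atTop_nhds_zero_of_norm_lt_one hb1).comp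
      (tendsto_add_atTop_nat 1)).div_const a
  have t5 := (t1.div t2 (by simp [qInfs, hqab, c2, d2, e2, f2])).mul (t4.mul t3)
  rw [zero_mul, mul_zero] at t5
  have t6 := t5.norm.mul_const C
  rw [norm_zero, zero_mul] at t6
  refine squeeze_zero_norm' ?_ t6
  filter_upwards [hC] with n hn
  rw [rhsFirst, norm_mul]
  exact mul_le_mul_of_nonneg_left hn (norm_nonneg _)

/-- The identity of part (i) holds for all large n, since the parameters depending on n that could
cause a zero either tend to 0 or are covered by the condition on b/a. Bailey's formula is its limit.
-/
theorem baileyTerm_tsum_of_generic {q a r b c d e f : ℂ} (hq0 : q ≠ 0) (hq : ‖q‖ < 1)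
    (ha : a ≠ 0) (hc : c ≠ 0) (hd : d ≠ 0) (he : e ≠ 0) (hf : f ≠ 0) (hr : r ^ 2 = a)
    (hb : b = q * a ^ 2 / (c * d * e * f)) (hb1 : ‖b‖ < 1) (hab : ∀ m : ℤ, b ≠ a * q ^ m)
    (hpsi : qInfs q [r, -r, 1 / r, -(1 / r), q / c, q / d, q / e, q / f,
      a * q / c, a * q / d, a * q / e, a * q / f] ≠ 0) :
    Tendsto (semiSum q a r b c d e f) atTop (𝓝 (∑' k, baileyTerm q a r c d e f k)) ∧
      Tendsto (rhsFirst q a r b c d e f) atTop (𝓝 0) ∧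
      Tendsto (rhsSecond q a b c d e f) atTop (𝓝 (baileyProduct q a c d e f)) ∧
      ∑' k, baileyTerm q a r c d e f k = baileyProduct q a c d e f := by
  have hb0 : b ≠ 0 := by rw [hb]; positivity
  have hpsi' := hpsi
  rw [qInfs_ne_zero_iff] at hpsi'
  simp only [List.mem_cons, List.not_mem_nil, or_false, forall_eq_or_imp, forall_eq] at hpsi'
  obtain ⟨h1, h2, h3, h4, c1, d1, e1, f1, c2, d2, e2, f2⟩ := hpsi'
  have T1 := tendsto_semiSum hq0 hq ha hc hd he hf hr hb hb1 hab hpsi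
  have T2 := tendsto_rhsFirst (c := c) (d := d) (e := e) (f := f) hq0 hq hb1 ha hb0 hr hab
    (by simp [qInfs, c2, d2, e2, f2])
  have T3 := tendsto_rhsSecond hq hb1 hb
    (by simp [qInfs, c1, d1, e1, f1, c2, d2, e2, f2])
  refine ⟨T1, T2, T3, ?_⟩
  have T4 := T2.add T3
  rw [zero_add] at T4
  refine tendsto_nhds_unique T1 (T4.congr' ?_)
  have hqa : ∀ᶠ n : ℕ in atTop, ‖q ^ (1 + n) / a‖ < 1 := by
    have := (tendsto_mul_pow_one_add_div hq 1 a).norm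
    simp only [one_mul, norm_zero] at this
    exact this.eventually_lt_const one_pos
  filter_upwards [hqa, (tendsto_denominators (a := a) (b := b) (c := c) (d := d) (e := e) (f := f)
      hq).eventually_ne one_ne_zero,
    (tendsto_lowerParams (a := a) (r := r) (b := b) (c := c) (d := d) (e := e) (f := f)
      hq).eventually_ne one_ne_zero] with n hn hprod hphi
  refine (semiSum_eq hq0 hq ha hc hd he hf hr hb ?_ ?_ hprod hphi).2.2.symm
  · have : qInf q (a * q ^ (1 - (n : ℤ)) / b) ≠ 0 :=
      qInf_ne_zero_of_forall_zpow hq fun m hm => hab (1 - n - m) (by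
        rw [zpow_sub₀ hq0 _ m, ← hm]
        have := zpow_ne_zero (1 - (n : ℤ)) hq0
        field_simp)
    simp [qInfs, h1, h2, this, c2, d2, e2, f2]
  · have p := fun {x : ℂ} (h : qInf q x ≠ 0) => qPoch_ne_zero hq h n
    have p1 := p (qInf_ne_zero_of_norm_lt_one hq hn)
    have p2 := p (qInf_ne_zero_of_norm_lt_one hq hb1)
    have p3 := p h3
    have p4 := p h4
    simp only [qFacs, qFac_natCast, List.map_cons, List.map_nil, List.prod_cons, List.prod_nil,
      mul_one]
    exact mul_ne_zero p1 (mul_ne_zero p3 (mul_ne_zero p4 (mul_ne_zero p2 (mul_ne_zero (p c1)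
      (mul_ne_zero (p d1) (mul_ne_zero (p e1) (p f1)))))))

/-! ### Removal of the condition on b/a -/

theorem continuousAt_qFac_div {q a c : ℂ} (hq0 : q ≠ 0) (hq : ‖q‖ < 1) (hc : c ≠ 0)
    (h₁ : qInf q (q / c) ≠ 0) (h₂ : qInf q (a * q / c) ≠ 0) (k : ℤ) :
    ContinuousAt (fun s => qFac q (c * s) k / qFac q (a * q / (c * s)) k) 1 := by
  have hp := fun m x => (continuous_qPoch q m).continuousAt (x := x)
  have hv : ContinuousAt (fun s => a * q / (c * s)) 1 := by
    fun_prop (disch := simpa using hc)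
  obtain ⟨m, rfl | rfl⟩ := k.eq_nat_or_neg
  · simp only [qFac_natCast]
    refine ContinuousAt.div (ContinuousAt.comp (f := fun s => c * s) (hp m _) (by fun_prop))
      (ContinuousAt.comp (f := fun s => a * q / (c * s)) (hp m _) hv) ?_
    rw [mul_one]
    exact qPoch_ne_zero hq h₂ m
  · simp only [qFac_neg_div_qFac_neg hq0]
    refine ContinuousAt.div (ContinuousAt.comp (f := fun s => a * q / (c * s) * (q ^ m)⁻¹)
      (hp m _) (hv.mul_const _)) (ContinuousAt.comp (f := fun s => c * s * (q ^ m)⁻¹) (hp m _)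
      (by fun_prop)) ?_
    rw [mul_one]
    exact qPoch_mul_inv_ne_zero hq0 hc (qPoch_ne_zero hq h₁ m)

/-- The powers of q are isolated in the punctured plane. An equality would make s a power of q, and
|q| < |s| < 1/|q| leaves only s = 1. -/
theorem eventually_forall_ne_mul_zpow {q a b : ℂ} (hq0 : q ≠ 0) (hq : ‖q‖ < 1) (ha : a ≠ 0)
    {m₀ : ℤ} (h : b = a * q ^ m₀) : ∀ᶠ s in 𝓝[≠] (1 : ℂ), ∀ m : ℤ, b / s ≠ a * q ^ m := by
  have hq' := norm_pos_iff.mpr hq0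
  have h1 : ∀ᶠ s in 𝓝 (1 : ℂ), ‖q‖ < ‖s‖ ∧ ‖s‖ < ‖q‖⁻¹ := by
    have hc : Tendsto (fun s : ℂ => ‖s‖) (𝓝 1) (𝓝 1) := by
      simpa using (continuous_norm (E := ℂ)).tendsto 1
    exact (hc.eventually_const_lt hq).and (hc.eventually_lt_const ((one_lt_inv₀ hq').mpr hq))
  filter_upwards [self_mem_nhdsWithin, h1.filter_mono nhdsWithin_le_nhds] with s hs ⟨hs1, hs2⟩ m hm
  have hs0 : s ≠ 0 := norm_pos_iff.mp (hq'.trans hs1)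
  have e : s = q ^ (m₀ - m) := by
    rw [zpow_sub₀ hq0, eq_div_iff (zpow_ne_zero _ hq0)]
    rw [h, div_eq_iff hs0] at hm
    apply mul_left_cancel₀ ha
    linear_combination -hm
  rw [e, norm_zpow] at hs1 hs2
  have i1 : m₀ - m < 1 := by
    rw [← zpow_lt_zpow_iff_right_of_lt_one₀ hq' hq, zpow_one] at *
    exact hs1
  have i2 : -1 < m₀ - m := by
    rw [← zpow_lt_zpow_iff_right_of_lt_one₀ hq' hq, zpow_neg_one]
    exact hs2
  have i3 : m₀ - m = 0 := by omega
  rw [i3, zpow_zero] at e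
  exact hs e

/-- Bailey's `₆ψ₆` summation formula. -/
theorem tsum_baileyTerm {q a r c d e f : ℂ} (hq0 : q ≠ 0) (hq : ‖q‖ < 1)
    (ha : a ≠ 0) (hc : c ≠ 0) (hd : d ≠ 0) (he : e ≠ 0) (hf : f ≠ 0) (hr : r ^ 2 = a)
    (hb1 : ‖q * a ^ 2 / (c * d * e * f)‖ < 1)
    (hpsi : qInfs q [r, -r, 1 / r, -(1 / r), q / c, q / d, q / e, q / f,
      a * q / c, a * q / d, a * q / e, a * q / f] ≠ 0) :
    ∑' k, baileyTerm q a r c d e f k = baileyProduct q a c d e f := by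
  by_cases hab : ∀ m : ℤ, q * a ^ 2 / (c * d * e * f) ≠ a * q ^ m
  · exact (baileyTerm_tsum_of_generic hq0 hq ha hc hd he hf hr rfl hb1 hab hpsi).2.2.2
  -- In the exceptional case c is replaced by cs, hence b by b/s. For s ≠ 1 near 1 the generic case
  -- applies, and the limit s → 1 is taken on both sides.
  push Not at hab
  obtain ⟨m₀, hm₀⟩ := hab
  have hpsi' := hpsi
  rw [qInfs_ne_zero_iff] at hpsi'
  simp only [List.mem_cons, List.not_mem_nil, or_false, forall_eq_or_imp, forall_eq] at hpsi'
  obtain ⟨h1, h2, h3, h4, c1, d1, e1, f1, c2, d2, e2, f2⟩ := hpsi'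
  have hbi := qInf_ne_zero_of_norm_lt_one hq hb1
  have hi : ∀ {u : ℂ → ℂ}, ContinuousAt u 1 → ContinuousAt (fun s => qInf q (u s)) 1 := fun h =>
    ContinuousAt.comp (continuous_qInf hq).continuousAt h
  have hm : ∀ {u : ℂ → ℂ}, ContinuousAt u 1 → ContinuousAt (fun s => qMaj q (u s)) 1 := fun h =>
    ContinuousAt.comp (g := qMaj q) (continuous_qMaj q).continuousAt h
  have v0 : ContinuousAt (fun s : ℂ => c * s) 1 := by fun_prop
  have v1 : ContinuousAt (fun s => a * q / (c * s)) 1 := by fun_prop (disch := simpa using hc)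
  have v2 : ContinuousAt (fun s => q / (c * s)) 1 := by fun_prop (disch := simpa using hc)
  have vb : ContinuousAt (fun s => q * a ^ 2 / (c * s * d * e * f)) 1 := by
    fun_prop (disch := simp [hc, hd, he, hf])
  have e0 : ∀ s, q * a ^ 2 / (c * s * d * e * f) = q * a ^ 2 / (c * d * e * f) / s := fun s => by
    rw [div_div]; congr 1; ring
  have vM : ContinuousAt (fun s => baileyMaj q a (c * s) d e f) 1 := by
    have : ContinuousAt (fun s => pairMaj q a (c * s)) 1 := by
      refine ContinuousAt.add ((hm v0).mul ((hm v1).div (hi v1).norm ?_))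
        ((hm (v0.div_const a)).mul ((hm v2).div (hi v2).norm ?_))
      · simpa using c2
      · simpa using c1
    unfold baileyMaj
    exact continuousAt_const.mul (((this.mul continuousAt_const).mul continuousAt_const).mul
      continuousAt_const)
  -- A number strictly between |b| and 1 bounds |b/s| for all s near 1, which provides a summable
  -- majorant independent of s.
  obtain ⟨ρ, hρ1, hρ2⟩ := exists_between hb1
  have ev : ∀ᶠ s in 𝓝[≠] (1 : ℂ), s ≠ 0 ∧ baileyMaj q a (c * s) d e f ≤ baileyMaj q a c d e f + 1 ∧
      ‖q * a ^ 2 / (c * s * d * e * f)‖ ≤ ρ ∧ qInfs q [r, -r, 1 / r, -(1 / r), q / (c * s), q / d,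
        q / e, q / f, a * q / (c * s), a * q / d, a * q / e, a * q / f] ≠ 0 := by
    refine Eventually.filter_mono nhdsWithin_le_nhds ?_
    have w1 := (hi v1).eventually_ne (by simpa using c2)
    have w2 := (hi v2).eventually_ne (by simpa using c1)
    have w3 : Tendsto (fun s => baileyMaj q a (c * s) d e f) (𝓝 1) (𝓝 (baileyMaj q a c d e f)) := by
      have : Tendsto _ _ _ := vM
      simpa only [mul_one] using this
    have w4 : Tendsto (fun s => ‖q * a ^ 2 / (c * s * d * e * f)‖) (𝓝 1)
        (𝓝 ‖q * a ^ 2 / (c * d * e * f)‖) := by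
      have : Tendsto _ _ _ := vb.norm
      simpa only [mul_one] using this
    filter_upwards [eventually_ne_nhds one_ne_zero, w1, w2,
      w3.eventually_le_const (lt_add_one _), w4.eventually_le_const hρ1] with s s0 s1 s2 s3 s4
    exact ⟨s0, s3, s4, by simp [qInfs, h1, h2, s1, s2, d1, e1, f1, d2, e2, f2,
      by simpa using h3, by simpa using h4]⟩
  have L1 : Tendsto (fun s => ∑' k, baileyTerm q a r (c * s) d e f k) (𝓝[≠] 1)
      (𝓝 (∑' k, baileyTerm q a r c d e f k)) := by
    refine tendsto_tsum_of_dominated_convergence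
      (bound := fun k : ℤ => (baileyMaj q a c d e f + 1) * ρ ^ k.natAbs)
      ((summable_pow_natAbs ((norm_nonneg _).trans hρ1.le) hρ2).mul_left _) (fun k => ?_) ?_
    · have hk : ContinuousAt (fun s => baileyTerm q a r (c * s) d e f k) 1 := by
        simp only [baileyTerm_eq]
        refine (continuousAt_const.mul ((((continuousAt_qFac_div hq0 hq hc c1 c2 k).mul
          continuousAt_const).mul continuousAt_const).mul continuousAt_const)).mul
          (vb.zpow₀ k (Or.inl ?_))
        rw [mul_one]; positivity
      have : Tendsto _ _ _ := hk
      simp only [mul_one] at this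
      exact this.mono_left nhdsWithin_le_nhds
    · filter_upwards [ev] with s ⟨s0, s1, s2, s3⟩ k
      refine (norm_baileyTerm_le hq0 hq ha (mul_ne_zero hc s0) hd he hf hr s3 k).trans ?_
      exact mul_le_mul s1 (pow_le_pow_left₀ (norm_nonneg _) s2 _) (by positivity)
        ((baileyMaj_nonneg _ _ _ _ _ _).trans s1)
  have L2 : Tendsto (fun s => baileyProduct q a (c * s) d e f) (𝓝[≠] 1)
      (𝓝 (baileyProduct q a c d e f)) := by
    have hk : ContinuousAt (fun s => baileyProduct q a (c * s) d e f) 1 := by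
      simp only [baileyProduct, qInfs, List.map_cons, List.map_nil, List.prod_cons, List.prod_nil,
        mul_one]
      have v3 : ∀ y : ℂ, y ≠ 0 → ContinuousAt (fun s => a * q / (c * s * y)) 1 := fun y hy => by
        fun_prop (disch := simp [hc, hy])
      have k : ∀ x : ℂ, ContinuousAt (fun _ : ℂ => x) 1 := fun x => continuousAt_const
      refine ContinuousAt.div ((k _).mul ((k _).mul ((k _).mul ((hi (v3 d hd)).mul
        ((hi (v3 e he)).mul ((hi (v3 f hf)).mul (k _)))))))
        ((hi v2).mul ((k _).mul ((k _).mul ((k _).mul ((hi v1).mul ((k _).mul ((k _).mul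
        ((k _).mul (hi vb))))))))) ?_
      simp only [mul_one]
      positivity
    have : Tendsto _ _ _ := hk
    simp only [mul_one] at this
    exact this.mono_left nhdsWithin_le_nhds
  refine tendsto_nhds_unique L1 (L2.congr' ?_)
  filter_upwards [ev, eventually_forall_ne_mul_zpow hq0 hq ha hm₀] with s ⟨s0, s1, s2, s3⟩ s4
  refine (baileyTerm_tsum_of_generic hq0 hq ha (mul_ne_zero hc s0) hd he hf hr rfl
    (s2.trans_lt hρ2) (fun m => ?_) s3).2.2.2.symm
  rw [e0]
  exact s4 m

/-- `r` is either square root of `a`. In the first part, `hsum_nonneg` and `hsum_neg` say that no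
zero is divided by in the terms of the semi-finite sum with `k ≥ 0` and with `k < 0` (they also
cover the finite products and `(aq/b; q)_∞` on the right-hand side), `hprod` and `hphi` say the same
of the remaining infinite products and of the `_8φ_7`. In the second part, `hpsi` says it of
both sides of Bailey's formula. -/
theorem mainTheorem1 (q a r b c d e f : ℂ)
    (hq0 : q ≠ 0) (hq1 : ‖q‖ < 1)
    (ha : a ≠ 0) (hc : c ≠ 0) (hd : d ≠ 0) (he : e ≠ 0) (hf : f ≠ 0)
    (hr : r ^ 2 = a) (hb : b = q * a ^ 2 / (c * d * e * f)) :
    (∀ n : ℕ,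
      ∀ _hsum_nonneg : qInfs q [r, -r, a * q ^ (1 - (n : ℤ)) / b,
        a * q / c, a * q / d, a * q / e, a * q / f] ≠ 0,
      ∀ _hsum_neg : qFacs q [q ^ (1 + n) / a, 1 / r, -(1 / r), b,
        q / c, q / d, q / e, q / f] n ≠ 0,
      ∀ _hprod : qInfs q [b * c * q ^ n / a, b * d * q ^ n / a, b * e * q ^ n / a,
        b * f * q ^ n / a, b ^ 2 * q ^ (1 + 2 * n) / a] ≠ 0,
      ∀ _hphi : qInfs q (lowerParams q a r b c d e f n) ≠ 0,
        (Summable fun k : Set.Ici (-(n : ℤ)) => semiTerm q a r b c d e f n k) ∧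
        Summable (phiTerm q (upperParams q a r b c d e f n) (lowerParams q a r b c d e f n) q) ∧
        semiSum q a r b c d e f n = rhsFirst q a r b c d e f n + rhsSecond q a b c d e f n) ∧
    (‖b‖ < 1 →
      ∀ _hpsi : qInfs q [r, -r, 1 / r, -(1 / r), q / c, q / d, q / e, q / f,
        a * q / c, a * q / d, a * q / e, a * q / f] ≠ 0,
        ((∀ m : ℤ, b ≠ a * q ^ m) →
          Tendsto (semiSum q a r b c d e f) atTop
            (𝓝 (psi q [q * r, -(q * r), c, d, e, f]
              [r, -r, a * q / c, a * q / d, a * q / e, a * q / f]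
              (q * a ^ 2 / (c * d * e * f)))) ∧
          Tendsto (rhsFirst q a r b c d e f) atTop (𝓝 0) ∧
          Tendsto (rhsSecond q a b c d e f) atTop (𝓝 (baileyProduct q a c d e f))) ∧
        Summable (psiTerm q [q * r, -(q * r), c, d, e, f]
          [r, -r, a * q / c, a * q / d, a * q / e, a * q / f]
          (q * a ^ 2 / (c * d * e * f))) ∧
        psi q [q * r, -(q * r), c, d, e, f]
          [r, -r, a * q / c, a * q / d, a * q / e, a * q / f]
          (q * a ^ 2 / (c * d * e * f)) = baileyProduct q a c d e f) := by
  refine ⟨fun n h1 h2 h3 h4 => semiSum_eq hq0 hq1 ha hc hd he hf hr hb h1 h2 h3 h4,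
    fun hb1 hpsi => ⟨fun hab => ?_, ?_, ?_⟩⟩
  · obtain ⟨T1, T2, T3, -⟩ :=
      baileyTerm_tsum_of_generic hq0 hq1 ha hc hd he hf hr hb hb1 hab hpsi
    exact ⟨T1, T2, T3⟩
  · exact summable_baileyTerm hq0 hq1 ha hc hd he hf hr (hb ▸ hb1) hpsi
  · exact tsum_baileyTerm hq0 hq1 ha hc hd he hf hr (hb ▸ hb1) hpsi
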